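/- **Conventions.** For a field $k$, let $K_*^{\mathrm{MW}}(k)$ be the Milnor–Witt K-theory of $k$: the graded associative ring generated by $\eta$ of degree $-1$ and symbols $[a]$ of degree $1$ ($a\in k^\times$), with the relations $[a][1-a]=0$ for $a\neq 1$, $[ab]=[a]+[b]+\eta[a][b]$, $\eta[a]=[a]\eta$ and $(2+\eta[-1])\eta=0$. Put $\langle a\rangle=1+\eta[a]$. Let $p:K_1^{\mathrm{MW}}(k)\to K_1^{\mathrm{M}}(k)=k^\times$ be the homomorphism that kills $\eta$, so that $p([a])=a$. For $\operatorname{char} k\ne 2$, let $I(k)$ be the ideal of even-dimensional forms in the Witt ring $W(k)$, and write $\langle\langle a,b\rangle\rangle=(1-\langle a\rangle)(1-\langle b\rangle)\in I^2(k)$ for the Pfister form of $a,b$ (here $\langle a\rangle$ is the class in $W(k)$ of the one-dimensional form $\langle a\rangle$). For a one-dimensional $k$-vector space $V$, let $\mathrm{GW}(k,V)=K_0^{\mathrm{MW}}(k)\otimes_{\mathbf Z[k^\times]}\mathbf Z[V\setminus 0]$, where $u\in k^\times$ acts on $K_0^{\mathrm{MW}}(k)$ as multiplication by $\langle u\rangle$,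 and on $V\setminus 0$ by scaling. Let $F$ be a number field, $v$ a place of $F$ and $F_v$ the completion. Define $\widetilde{\mathrm{ord}}_v$ on $K_1^{\mathrm{MW}}(F_v)$ as follows. - If $v$ is finite, with valuation ring $\mathcal O_v$, maximal ideal $\mathfrak m_v$ and residue field $k(v)$, then $\widetilde{\mathrm{ord}}_v=\partial_v:K_1^{\mathrm{MW}}(F_v)\to \mathrm{GW}(k(v),(\mathfrak m_v/\mathfrak m_v^2)^\vee)$ is the residue map $x\mapsto\partial_v^{\pi}(x)\otimes\bar\pi$. Here $\pi$ is any uniformizer, $\bar\pi$ is the linear form dual to the class of $\pi$, and $\partial_v^\pi: K_*^{\mathrm{MW}}(F_v)\to K_{*-1}^{\mathrm{MW}}(k(v))$ is the homomorphism commuting with $\eta$ with $\partial_v^\pi([\pi,u_1,\dots,u_n])=[\bar u_1,\dots,\bar u_n]$ and $\partial_v^\pi([u_1,\dots,u_n])=0$ for units $u_i\in\mathcal O_v^\times$. - If $v$ is real, then $\widetilde{\mathrm{ord}}_v:K_1^{\mathrm{MW}}(F_v)\cong K_1^{\mathrm{MW}}(\mathbf R)\to\mathbf Z$ sends $[x]$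 to half the signature of the form $\langle\langle x\rangle\rangle=\langle 1\rangle\perp\langle -x\rangle$, that is, to $0$ if $x>0$ and to $1$ if $x<0$. - If $v$ is complex, then $\widetilde{\mathrm{ord}}_v=0$. Put $K_1^{\mathrm{MW}}(\mathcal O_v):=\ker(\widetilde{\mathrm{ord}}_v)$, and let $\mathcal O_v^\times:=\mathbf R_{>0}^\times$ if $v$ is real and $\mathcal O_v^\times:=\mathbf C^\times$ if $v$ is complex. **Lemma.** Let $v$ be a place of $F$. - If $v$ is infinite, or finite and not above $2$, then $p$ induces an isomorphism $K_1^{\mathrm{MW}}(\mathcal O_v)\cong\mathcal O_v^\times$ (for $v$ infinite, after identifying $F_v$ with $\mathbf R$ or with $\mathbf C$). - If $v$ is a finite place above $2$, then there is a short exact sequence $$0\to I^2(F_v)\to K_1^{\mathrm{MW}}(\mathcal O_v)\xrightarrow{\ p\ }\mathcal O_v^\times\to 0$$ in which the first map sends $\langle\langle a,b\rangle\rangle$ to $\eta[a][b]$ for all $a,b\in F_v^\times$. -/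

import Mathlib

set_option linter.unusedSectionVars false

noncomputable section

/-! ### Milnor–Witt K-theory of a field -/

/-- The generators of Milnor–Witt K-theory: `η`, and a symbol `[a]` for each unit `a`. -/
inductive MWGen (F : Type*) [Field F] where
  | eta : MWGen F
  | sym : Fˣ → MWGen F

/-- Degrees of the generators: `η` has degree `-1` and `[a]` has degree `1`. -/
def MWGen.deg {F : Type*} [Field F] : MWGen F → ℤ
  | .eta => -1
  | .sym _ => 1

/-- The defining relations of Milnor–Witt K-theory, imposed on the free associative `ℤ`-algebra on
the generators. -/
inductive MWRel (F : Type*) [Field F] :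
    FreeAlgebra ℤ (MWGen F) → FreeAlgebra ℤ (MWGen F) → Prop
  | steinberg (a b : Fˣ) (h : (b : F) = 1 - a) :
      MWRel F (FreeAlgebra.ι ℤ (.sym a) * FreeAlgebra.ι ℤ (.sym b)) 0
  | sym_mul (a b : Fˣ) :
      MWRel F (FreeAlgebra.ι ℤ (.sym (a * b)))
        (FreeAlgebra.ι ℤ (.sym a) + FreeAlgebra.ι ℤ (.sym b) +
          FreeAlgebra.ι ℤ .eta * FreeAlgebra.ι ℤ (.sym a) * FreeAlgebra.ι ℤ (.sym b))
  | eta_comm (a : Fˣ) :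
      MWRel F (FreeAlgebra.ι ℤ .eta * FreeAlgebra.ι ℤ (.sym a))
        (FreeAlgebra.ι ℤ (.sym a) * FreeAlgebra.ι ℤ .eta)
  | eta_hyp :
      MWRel F ((2 + FreeAlgebra.ι ℤ .eta * FreeAlgebra.ι ℤ (.sym (-1))) * FreeAlgebra.ι ℤ .eta) 0

/-- The Milnor–Witt K-theory ring `K_*^MW(F)`. -/
def KMW (F : Type*) [Field F] : Type _ := RingQuot (MWRel F)

namespace KMW

instance (F : Type*) [Field F] : Ring (KMW F) := inferInstanceAs (Ring (RingQuot (MWRel F)))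

/-- The quotient map onto `K_*^MW(F)`. -/
def mk (F : Type*) [Field F] : FreeAlgebra ℤ (MWGen F) →+* KMW F :=
  RingQuot.mkRingHom (MWRel F)

/-- The image of a generator in `K_*^MW(F)`. -/
def gen {F : Type*} [Field F] (g : MWGen F) : KMW F := mk F (FreeAlgebra.ι ℤ g)

/-- The element `η`. -/
def eta {F : Type*} [Field F] : KMW F := gen .eta

/-- The symbol `[a]`. -/
def sym {F : Type*} [Field F] (a : Fˣ) : KMW F := gen (.sym a)

/-- The element `⟨a⟩ = 1 + η[a]`. -/
def angle {F : Type*} [Field F] (a : Fˣ) : KMW F := 1 + eta * sym a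

section basic

variable {F : Type*} [Field F]

theorem mk_rel {x y : FreeAlgebra ℤ (MWGen F)} (h : MWRel F x y) : mk F x = mk F y :=
  RingQuot.mkRingHom_rel h

theorem steinberg (a b : Fˣ) (h : (b : F) = 1 - a) : (sym a * sym b : KMW F) = 0 := by
  have := mk_rel (MWRel.steinberg a b h)
  rwa [map_mul, map_zero] at this

theorem sym_mul (a b : Fˣ) : (sym (a * b) : KMW F) = sym a + sym b + eta * sym a * sym b := by
  have := mk_rel (MWRel.sym_mul a b)
  rwa [map_add, map_add, map_mul, map_mul] at this

theorem eta_comm (a : Fˣ) : (eta * sym a : KMW F) = sym a * eta := by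
  have := mk_rel (MWRel.eta_comm a)
  rwa [map_mul, map_mul] at this

theorem eta_hyp : ((2 + eta * sym (-1)) * eta : KMW F) = 0 := by
  have := mk_rel (MWRel.eta_hyp (F := F))
  rwa [map_mul, map_add, map_mul, map_zero, map_ofNat] at this

/-- The universal property of `K_*^MW(F)`: values for `η` and for the symbols that satisfy the
defining relations extend to a ring homomorphism. -/
def lift {A : Type*} [Ring A] (e : A) (s : Fˣ → A)
    (h1 : ∀ a b : Fˣ, (b : F) = 1 - a → s a * s b = 0)
    (h2 : ∀ a b : Fˣ, s (a * b) = s a + s b + e * s a * s b)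
    (h3 : ∀ a : Fˣ, e * s a = s a * e)
    (h4 : (2 + e * s (-1)) * e = 0) : KMW F →+* A :=
  RingQuot.lift ⟨((FreeAlgebra.lift ℤ (fun g : MWGen F => match g with
      | .eta => e
      | .sym a => s a)) : FreeAlgebra ℤ (MWGen F) →ₐ[ℤ] A).toRingHom, by
    intro x y h
    cases h with
    | steinberg a b h => simpa using h1 a b h
    | sym_mul a b => simpa using h2 a b
    | eta_comm a => simpa using h3 a
    | eta_hyp => simpa [map_ofNat] using h4⟩

section lift
variable {A : Type*} [Ring A] (e : A) (s : Fˣ → A)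
    (h1 : ∀ a b : Fˣ, (b : F) = 1 - a → s a * s b = 0)
    (h2 : ∀ a b : Fˣ, s (a * b) = s a + s b + e * s a * s b)
    (h3 : ∀ a : Fˣ, e * s a = s a * e)
    (h4 : (2 + e * s (-1)) * e = 0)

theorem lift_eta : lift e s h1 h2 h3 h4 eta = e := by
  unfold lift eta gen mk
  erw [RingQuot.lift_mkRingHom_apply]
  simp

theorem lift_sym (a : Fˣ) : lift e s h1 h2 h3 h4 (sym a) = s a := by
  unfold lift sym gen mk
  erw [RingQuot.lift_mkRingHom_apply]
  simp

end lift

/-- The graded piece `K_n^MW(F)`: the additive group generated by the words of degree `n` in the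
generators. -/
def graded (F : Type*) [Field F] (n : ℤ) : AddSubgroup (KMW F) :=
  AddSubgroup.closure
    {x | ∃ l : List (MWGen F), (l.map MWGen.deg).sum = n ∧ x = (l.map gen).prod}

theorem word_mem (l : List (MWGen F)) : (l.map gen).prod ∈ graded F (l.map MWGen.deg).sum :=
  AddSubgroup.subset_closure ⟨l, rfl, rfl⟩

theorem sym_mem (a : Fˣ) : sym a ∈ graded F 1 := by
  simpa [MWGen.deg, sym] using word_mem [MWGen.sym a]

theorem eta_mem : (eta : KMW F) ∈ graded F (-1) := by
  simpa [MWGen.deg, eta] using word_mem [(MWGen.eta : MWGen F)]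

theorem one_mem : (1 : KMW F) ∈ graded F 0 := by
  simpa using word_mem ([] : List (MWGen F))

theorem mul_mem {n m : ℤ} {x y : KMW F} (hx : x ∈ graded F n) (hy : y ∈ graded F m) :
    x * y ∈ graded F (n + m) := by
  induction hx using AddSubgroup.closure_induction with
  | mem x hx =>
    obtain ⟨l, rfl, rfl⟩ := hx
    induction hy using AddSubgroup.closure_induction with
    | mem y hy =>
      obtain ⟨l', rfl, rfl⟩ := hy
      simpa using word_mem (l ++ l')
    | zero => simp [zero_mem]
    | add y z _ _ h h' => rw [mul_add]; exact add_mem h h'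
    | neg y _ h => rw [mul_neg]; exact neg_mem h
  | zero => simp [zero_mem]
  | add y z _ _ h h' => rw [add_mul]; exact add_mem h h'
  | neg y _ h => rw [neg_mul]; exact neg_mem h

theorem angle_mem (a : Fˣ) : angle a ∈ graded F 0 :=
  add_mem one_mem (by simpa using mul_mem eta_mem (sym_mem a))

theorem eta_sym_symm (a b : Fˣ) : (eta * sym a * sym b : KMW F) = eta * sym b * sym a := by
  have h := sym_mul a b
  have h' := sym_mul b a
  rw [mul_comm a b, h'] at h
  rw [add_comm (sym b) (sym a)] at h
  exact (add_left_cancel h).symm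

theorem angle_comm_sym (a b : Fˣ) : (angle a * sym b : KMW F) = sym b * angle a := by
  rw [angle, add_mul, mul_add, one_mul, mul_one, eta_sym_symm, ← mul_assoc, eta_comm]

theorem angle_comm_eta (a : Fˣ) : (angle a * eta : KMW F) = eta * angle a := by
  rw [angle, add_mul, mul_add, one_mul, mul_one, mul_assoc, ← eta_comm]

theorem angle_mul (a b : Fˣ) : (angle (a * b) : KMW F) = angle a * angle b := by
  have h : (eta * sym a * (eta * sym b) : KMW F) = eta * (eta * sym a * sym b) := by
    rw [eta_comm a, mul_assoc, ← mul_assoc eta eta, ← mul_assoc, ← mul_assoc, ← mul_assoc]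
    rw [← eta_comm a, mul_assoc eta (sym a) eta, ← eta_comm a, ← mul_assoc]
  simp only [angle, sym_mul, mul_add, add_mul, one_mul, mul_one, h]
  abel

theorem angle_comm_angle (a b : Fˣ) : (angle a * angle b : KMW F) = angle b * angle a := by
  rw [← angle_mul, mul_comm, angle_mul]

theorem sym_mul' (a b : Fˣ) : (sym (a * b) : KMW F) = sym a + angle a * sym b := by
  rw [sym_mul, angle, add_mul, one_mul, add_assoc]

theorem angle_neg_one_eta : (angle (-1) * eta : KMW F) = -eta := by
  have h := eta_hyp (F := F)
  have h2 : (angle (-1) * eta + eta : KMW F) = (2 + eta * sym (-1)) * eta := by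
    rw [angle]; noncomm_ring
  rw [h] at h2
  exact eq_neg_of_add_eq_zero_left h2

theorem sym_one : (sym (1 : Fˣ) : KMW F) = 0 := by
  have h1 : (angle (-1) * sym (1 : Fˣ) : KMW F) = 0 := by
    have h := sym_mul' (-1 : Fˣ) 1
    rw [mul_one] at h
    exact (left_eq_add.mp h)
  have h2 : (eta * sym (1 : Fˣ) : KMW F) = 0 := by
    have : (eta * (angle (-1) * sym (1 : Fˣ)) : KMW F) = 0 := by rw [h1, mul_zero]
    rw [← mul_assoc, ← angle_comm_eta, angle_neg_one_eta, neg_mul] at this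
    exact neg_eq_zero.mp this
  have h := sym_mul (1 : Fˣ) 1
  rw [mul_one, h2, zero_mul, add_zero] at h
  exact left_eq_add.mp h

theorem angle_one : (angle (1 : Fˣ) : KMW F) = 1 := by rw [angle, sym_one, mul_zero, add_zero]

theorem sym_neg_one_angle : (angle (-1) * sym (-1 : Fˣ) : KMW F) = -sym (-1) := by
  have h := sym_mul' (-1 : Fˣ) (-1)
  rw [neg_mul_neg, one_mul, sym_one] at h
  exact eq_neg_of_add_eq_zero_right h.symm

theorem sym_sym_neg (a : Fˣ) : (sym a * sym (-a) : KMW F) = 0 := by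
  by_cases ha : a = 1
  · rw [ha, sym_one, zero_mul]
  have ha' : (1 : F) - a ≠ 0 := by
    intro h
    exact ha (Units.ext (by simpa using (sub_eq_zero.mp h).symm))
  have hai : (1 : F) - (a⁻¹ : Fˣ) ≠ 0 := by
    intro h
    apply ha
    have h2 := sub_eq_zero.mp h
    exact inv_eq_one.mp (Units.ext (by rw [← h2, Units.val_one]))
  set b : Fˣ := Units.mk0 _ ha' with hb
  set c : Fˣ := Units.mk0 _ hai with hc
  have hbc : b = -a * c := by
    ext
    simp [hb, hc]
    field_simp
    ring
  have h1 := steinberg a b (by simp [hb])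
  have h2 := steinberg a⁻¹ c (by simp [hc])
  have h3 : (sym a : KMW F) = -(angle a * sym a⁻¹) := by
    have h := sym_mul' a a⁻¹
    rw [mul_inv_cancel, sym_one] at h
    exact eq_neg_of_add_eq_zero_left h.symm
  rw [hbc, sym_mul', mul_add, ← mul_assoc, ← angle_comm_sym, mul_assoc] at h1
  have h4 : (sym a * sym c : KMW F) = 0 := by
    rw [h3, neg_mul, mul_assoc, h2, mul_zero, neg_zero]
  rw [h4, mul_zero, add_zero] at h1
  exact h1

theorem sym_neg_sym (a : Fˣ) : (sym (-a) * sym a : KMW F) = 0 := by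
  simpa using sym_sym_neg (-a)

theorem angle_neg_sym (a : Fˣ) : (angle (-a) * sym a : KMW F) = sym a := by
  rw [angle, add_mul, mul_assoc, sym_neg_sym, mul_zero, add_zero, one_mul]

theorem angle_sym_self (a : Fˣ) : (angle a * sym a : KMW F) = angle (-1) * sym a := by
  have h : (angle a : KMW F) = angle (-1) * angle (-a) := by rw [← angle_mul, neg_mul_neg, one_mul]
  rw [h, mul_assoc, angle_neg_sym]

/-- The element `h = 1 + ⟨-1⟩`. -/
def hyp : KMW F := 1 + angle (-1)

/-- The element `n_ε`, which is `⟨1⟩ + ⟨-1⟩ + ⟨1⟩ + ⋯` with `n` terms for `n ≥ 0`, and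
`-⟨-1⟩ (-n)_ε` for `n < 0`; in all cases it is `⌊n / 2⌋ h + (n mod 2)`. -/
def nEps (n : ℤ) : KMW F := (n / 2) • hyp + (n % 2) • 1

theorem angle_hyp : (angle (-1) * hyp : KMW F) = hyp := by
  rw [hyp, mul_add, mul_one, ← angle_mul, neg_mul_neg, one_mul, angle_one, add_comm]

theorem nEps_zero : (nEps 0 : KMW F) = 0 := by simp [nEps]

theorem nEps_one : (nEps 1 : KMW F) = 1 := by simp [nEps]

theorem nEps_even (k : ℤ) : (nEps (2 * k) : KMW F) = k • hyp := by simp [nEps]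

theorem nEps_odd (k : ℤ) : (nEps (2 * k + 1) : KMW F) = k • hyp + 1 := by
  have h1 : (2 * k + 1) / 2 = k := by omega
  have h2 : (2 * k + 1) % 2 = 1 := by omega
  rw [nEps, h1, h2, one_smul]

theorem nEps_mem (n : ℤ) : nEps n ∈ graded F 0 :=
  add_mem (zsmul_mem (add_mem one_mem (angle_mem _)) _) (zsmul_mem one_mem _)

theorem nEps_add (n m : ℤ) :
    (nEps (n + m) : KMW F) = nEps n + angle ((-1) ^ n) * nEps m := by
  have hk : ∀ k : ℤ, ((-1 : Fˣ) ^ (2 * k + 1)) = -1 := fun k => by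
    rw [zpow_add, zpow_mul]; simp
  rcases Int.even_or_odd' n with ⟨k, rfl | rfl⟩ <;> rcases Int.even_or_odd' m with ⟨l, rfl | rfl⟩
  · rw [← mul_add, nEps_even, nEps_even, nEps_even, zpow_mul]
    simp [angle_one, add_smul]
  · rw [← add_assoc, ← mul_add, nEps_even, nEps_odd, nEps_odd, zpow_mul]
    simp [angle_one, add_smul, add_assoc]
  · rw [show 2 * k + 1 + 2 * l = 2 * (k + l) + 1 by ring, nEps_even, nEps_odd, nEps_odd, hk k,
      mul_smul_comm, angle_hyp, add_smul]
    abel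
  · rw [show 2 * k + 1 + (2 * l + 1) = 2 * (k + l + 1) by ring, nEps_even, nEps_odd, nEps_odd,
      hk k, mul_add, mul_smul_comm, angle_hyp, add_smul, add_smul, one_smul, mul_one, hyp]
    abel

theorem hyp_sym_neg (a : Fˣ) : (hyp * sym (-a) : KMW F) = hyp * sym a := by
  have h : (hyp * sym (-1 : Fˣ) : KMW F) = 0 := by
    rw [hyp, add_mul, one_mul, sym_neg_one_angle, add_neg_cancel]
  have h2 : (hyp * angle (-1) : KMW F) = hyp := by
    rw [hyp, add_mul, one_mul, ← angle_mul, neg_mul_neg, one_mul, angle_one, add_comm]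
  rw [← neg_one_mul a, sym_mul', mul_add, h, zero_add, ← mul_assoc, h2]

end basic
end KMW

/-! ### Discrete valuations -/

namespace MWVal

open IsLocalRing

/-- The unit of `F` given by a uniformizer. -/
def unif {R : Type*} [CommRing R] [IsDomain R] (F : Type*) [Field F] [Algebra R F]
    [IsFractionRing R F] {π : R} (hπ : Irreducible π) : Fˣ :=
  Units.mk0 (algebraMap R F π) (by simpa using hπ.ne_zero)

theorem exists_decomp {R : Type*} [CommRing R] [IsDomain R] [IsDiscreteValuationRing R]
    {F : Type*} [Field F] [Algebra R F] [IsFractionRing R F] {π : R} (hπ : Irreducible π)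
    (a : Fˣ) : ∃ p : ℤ × Rˣ, a = unif F hπ ^ p.1 * Units.map (algebraMap R F) p.2 := by
  obtain ⟨n, u, h⟩ := IsDiscreteValuationRing.exists_units_eq_smul_zpow_of_irreducible hπ a.ne_zero
  refine ⟨(n, u), Units.ext ?_⟩
  rw [h]
  simp [unif, Units.smul_def, Algebra.smul_def, mul_comm]

section

variable {R : Type*} [CommRing R] [IsDomain R] [IsDiscreteValuationRing R]
  {F : Type*} [Field F] [Algebra R F] [IsFractionRing R F] {π : R} (hπ : Irreducible π)

/-- The valuation `n` of `a = π ^ n * u`. -/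
def ord (a : Fˣ) : ℤ := (exists_decomp hπ a).choose.1

/-- The unit part `u` of `a = π ^ n * u`. -/
def unitPart (a : Fˣ) : Rˣ := (exists_decomp hπ a).choose.2

theorem decomp (a : Fˣ) :
    a = unif F hπ ^ ord hπ a * Units.map (algebraMap R F) (unitPart hπ a) :=
  (exists_decomp hπ a).choose_spec

theorem map_units_injective : Function.Injective (Units.map (algebraMap R F : R →* F)) :=
  Units.map_injective (IsFractionRing.injective R F)

theorem zpow_eq_zero {n : ℤ} {u : Rˣ} (h : unif F hπ ^ n = Units.map (algebraMap R F : R →* F) u) :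
    n = 0 := by
  have key : ∀ (m : ℕ) (w : Rˣ), unif F hπ ^ m = Units.map (algebraMap R F : R →* F) w → m = 0 := by
    intro m w hw
    by_contra hm
    have h1 : algebraMap R F (π ^ m) = algebraMap R F w := by
      simpa [unif] using congrArg Units.val hw
    have h2 := IsFractionRing.injective R F h1
    exact hπ.not_isUnit ((isUnit_pow_iff hm).mp (h2 ▸ w.isUnit))
  rcases Int.eq_nat_or_neg n with ⟨m, rfl | rfl⟩
  · simpa using key m u (by simpa using h)
  · have := key m u⁻¹ (by rw [map_inv, ← h]; simp)
    simp [this]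

theorem decomp_unique (n : ℤ) (u : Rˣ) :
    ord hπ (unif F hπ ^ n * Units.map (algebraMap R F : R →* F) u) = n ∧
      unitPart hπ (unif F hπ ^ n * Units.map (algebraMap R F : R →* F) u) = u := by
  set a := unif F hπ ^ n * Units.map (algebraMap R F : R →* F) u with ha
  have h := decomp hπ a
  have h2 : unif F hπ ^ (ord hπ a - n) =
      Units.map (algebraMap R F : R →* F) (u * (unitPart hπ a)⁻¹) := by
    rw [map_mul, map_inv, zpow_sub, eq_mul_inv_iff_mul_eq, mul_right_comm, ← h, ha, mul_comm,
      inv_mul_cancel_left]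
  have h3 : ord hπ a = n := sub_eq_zero.mp (zpow_eq_zero hπ h2)
  refine ⟨h3, ?_⟩
  rw [h3, ha] at h
  exact (map_units_injective (mul_left_cancel h)).symm

theorem ord_mul (a b : Fˣ) : ord hπ (a * b) = ord hπ a + ord hπ b := by
  have h : a * b = unif F hπ ^ (ord hπ a + ord hπ b) *
      Units.map (algebraMap R F : R →* F) (unitPart hπ a * unitPart hπ b) := by
    conv_lhs => rw [decomp hπ a, decomp hπ b]
    rw [zpow_add, map_mul, mul_mul_mul_comm]
  rw [h, (decomp_unique hπ _ _).1]

theorem unitPart_mul (a b : Fˣ) : unitPart hπ (a * b) = unitPart hπ a * unitPart hπ b := by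
  have h : a * b = unif F hπ ^ (ord hπ a + ord hπ b) *
      Units.map (algebraMap R F : R →* F) (unitPart hπ a * unitPart hπ b) := by
    conv_lhs => rw [decomp hπ a, decomp hπ b]
    rw [zpow_add, map_mul, mul_mul_mul_comm]
  rw [h, (decomp_unique hπ _ _).2]

theorem ord_unit (u : Rˣ) : ord hπ (Units.map (algebraMap R F : R →* F) u) = 0 := by
  simpa using (decomp_unique (F := F) hπ 0 u).1

theorem unitPart_unit (u : Rˣ) : unitPart hπ (Units.map (algebraMap R F : R →* F) u) = u := by
  simpa using (decomp_unique (F := F) hπ 0 u).2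

theorem ord_unif : ord hπ (unif F hπ) = 1 := by
  simpa using (decomp_unique (F := F) hπ 1 1).1

theorem unitPart_unif : unitPart hπ (unif F hπ) = 1 := by
  simpa using (decomp_unique (F := F) hπ 1 1).2

/-- The class in the residue field of the unit part `u` of `a = π ^ n * u`. -/
def resUnit (a : Fˣ) : (ResidueField R)ˣ :=
  Units.map (residue R : R →* ResidueField R) (unitPart hπ a)

theorem resUnit_mul (a b : Fˣ) : resUnit hπ (a * b) = resUnit hπ a * resUnit hπ b := by
  simp [resUnit, unitPart_mul]

theorem decomp_val (a : Fˣ) :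
    (a : F) = algebraMap R F π ^ ord hπ a * algebraMap R F (unitPart hπ a) := by
  have := congrArg Units.val (decomp hπ a)
  simpa [unif] using this

/-- The possible valuations and residues of a pair `a`, `b` with `a + b = 1`. -/
theorem cases_add_eq_one (a b : Fˣ) (h : (b : F) = 1 - a) :
    (0 < ord hπ a ∧ ord hπ b = 0 ∧ resUnit hπ b = 1) ∨
    (ord hπ a = 0 ∧ 0 < ord hπ b ∧ resUnit hπ a = 1) ∨
    (ord hπ a = 0 ∧ ord hπ b = 0 ∧
      (resUnit hπ b : ResidueField R) = 1 - (resUnit hπ a : ResidueField R)) ∨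
    (ord hπ a < 0 ∧ ord hπ b = ord hπ a ∧ resUnit hπ b = -resUnit hπ a) := by
  have hπ0 : algebraMap R F π ≠ 0 := by simpa using hπ.ne_zero
  have hinj := IsFractionRing.injective R F
  have hres : residue R π = 0 := by
    rw [residue_eq_zero_iff, mem_maximalIdeal]
    exact hπ.not_isUnit
  have ha := decomp_val hπ a
  have hb := decomp_val hπ b
  set n := ord hπ a
  set m := ord hπ b
  set u := unitPart hπ a with hu
  set w := unitPart hπ b with hw
  have hua : resUnit hπ a = Units.map (residue R : R →* ResidueField R) u := rfl
  have hub : resUnit hπ b = Units.map (residue R : R →* ResidueField R) w := rfl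
  rw [ha, hb] at h
  have hunit : ∀ x : Rˣ, residue R (x : R) ≠ 0 := fun x =>
    ((Units.map (residue R : R →* ResidueField R) x)).ne_zero
  -- a nonzero power of the uniformizer dies in the residue field
  have hpow : ∀ k : ℕ, k ≠ 0 → residue R (π ^ k) = 0 := fun k hk => by
    rw [map_pow, hres, zero_pow hk]
  have pos : ∀ (k l : ℤ) (x y : Rˣ), 0 < k →
      algebraMap R F π ^ l * algebraMap R F y = 1 - algebraMap R F π ^ k * algebraMap R F x →
      l = 0 ∧ residue R (y : R) = 1 := by
    intro k l x y hk hxy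
    obtain ⟨k, rfl⟩ := Int.eq_ofNat_of_zero_le hk.le
    have hk0 : k ≠ 0 := by omega
    have h1 : IsUnit (1 - π ^ k * (x : R)) := by
      rw [← residue_ne_zero_iff_isUnit, map_sub, map_mul, hpow k hk0]
      simp
    obtain ⟨z, hz⟩ := h1
    have h2 : algebraMap R F π ^ l * algebraMap R F y = algebraMap R F z := by
      rw [hxy, hz]; simp
    have h3 : unif F hπ ^ l = Units.map (algebraMap R F : R →* F) (z * y⁻¹) := by
      rw [map_mul, map_inv, eq_mul_inv_iff_mul_eq]
      ext
      simpa [unif] using h2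
    have h4 := zpow_eq_zero hπ h3
    refine ⟨h4, ?_⟩
    rw [h4, zpow_zero, one_mul] at h2
    rw [hinj h2, hz, map_sub, map_mul, hpow k hk0]
    simp
  rcases lt_trichotomy n 0 with hn | hn | hn
  · refine Or.inr (Or.inr (Or.inr ?_))
    -- multiply by `π ^ (-n)`
    obtain ⟨k, hk⟩ := Int.eq_ofNat_of_zero_le (show 0 ≤ -n by omega)
    have hk0 : k ≠ 0 := by omega
    have hnk : n = -(k : ℤ) := by omega
    have h1 : IsUnit (π ^ k - (u : R)) := by
      rw [← residue_ne_zero_iff_isUnit, map_sub, hpow k hk0, zero_sub, neg_ne_zero]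
      exact hunit u
    obtain ⟨z, hz⟩ := h1
    have h2 : algebraMap R F π ^ (m + k) * algebraMap R F w = algebraMap R F z := by
      rw [hz, zpow_add₀ hπ0, mul_right_comm, h, hnk, sub_mul, mul_right_comm, ← zpow_add₀ hπ0]
      simp
    have h3 : unif F hπ ^ (m + k) = Units.map (algebraMap R F : R →* F) (z * w⁻¹) := by
      rw [map_mul, map_inv, eq_mul_inv_iff_mul_eq]
      ext
      simpa [unif] using h2
    have h4 := zpow_eq_zero hπ h3
    rw [h4, zpow_zero, one_mul] at h2
    refine ⟨hn, by omega, ?_⟩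
    rw [hua, hub]
    ext
    simp [hinj h2, hz, hpow k hk0]
  · rcases lt_trichotomy m 0 with hm | hm | hm
    · exfalso
      rw [hn, zpow_zero, one_mul] at h
      obtain ⟨k, hk⟩ := Int.eq_ofNat_of_zero_le (show 0 ≤ -m by omega)
      have hk0 : k ≠ 0 := by omega
      have h2 : algebraMap R F (π ^ k * (1 - u)) = algebraMap R F w := by
        rw [map_mul, map_sub, map_one, ← h, ← mul_assoc, map_pow, ← zpow_natCast, ← zpow_add₀ hπ0,
          show (k : ℤ) + m = 0 by omega, zpow_zero, one_mul]
      apply hunit w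
      rw [← hinj h2, map_mul, hpow k hk0, zero_mul]
    · refine Or.inr (Or.inr (Or.inl ⟨hn, hm, ?_⟩))
      rw [hn, hm, zpow_zero, one_mul, one_mul] at h
      have h2 : algebraMap R F w = algebraMap R F (1 - u) := by rw [h]; simp
      rw [hua, hub]
      simp [hinj h2]
    · refine Or.inr (Or.inl ⟨hn, hm, ?_⟩)
      have := pos m n w u hm (by rw [h]; ring)
      rw [hua]
      ext
      simp [this.2]
  · have := pos n m u w hn h
    refine Or.inl ⟨hn, this.1, ?_⟩
    rw [hub]
    ext
    simp [this.2]

end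

end MWVal

namespace KMW

open IsLocalRing MWVal

section residue

theorem nEps_comm {F : Type*} [Field F] (n : ℤ) {x : KMW F} (h : Commute (angle (-1)) x) :
    Commute (nEps n) x :=
  (Commute.smul_left ((Commute.one_left x).add_left h) _).add_left
    (Commute.smul_left (Commute.one_left x) _)

variable {R : Type*} [CommRing R] [IsDomain R] [IsDiscreteValuationRing R]
  {F : Type*} [Field F] [Algebra R F] [IsFractionRing R F] {π : R} (hπ : Irreducible π)

/-- The element `ε[(-1)^n ū]`, where `a = π ^ n * u` and `ε = -⟨-1⟩`. -/
def leftSpec (a : Fˣ) : KMW (ResidueField R) :=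
  -(angle (-1) * sym ((-1) ^ ord hπ a * resUnit hπ a))

/-- The residue `n_ε ⟨ū⟩` of `[a]`, where `a = π ^ n * u`. -/
def symRes (a : Fˣ) : KMW (ResidueField R) := nEps (ord hπ a) * angle (resUnit hπ a)

theorem leftSpec_mul_leftSpec (a b : Fˣ)
    (h : (sym ((-1) ^ ord hπ a * resUnit hπ a) * sym ((-1) ^ ord hπ b * resUnit hπ b) :
      KMW (ResidueField R)) = 0) : leftSpec hπ a * leftSpec hπ b = 0 := by
  rw [leftSpec, leftSpec, neg_mul_neg, mul_assoc, ← mul_assoc (sym _), ← angle_comm_sym,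
    mul_assoc (angle (-1)), h, mul_zero, mul_zero]

theorem eta_leftSpec (a : Fˣ) :
    eta * leftSpec hπ a = eta * sym ((-1) ^ ord hπ a * resUnit hπ a) := by
  rw [leftSpec, mul_neg, ← mul_assoc, ← angle_comm_eta, angle_neg_one_eta, neg_mul, neg_neg]

theorem leftSpec_eta (a : Fˣ) : leftSpec hπ a * eta = eta * leftSpec hπ a := by
  rw [leftSpec, neg_mul, mul_neg, mul_assoc, ← eta_comm, ← mul_assoc, ← mul_assoc, angle_comm_eta]

theorem symRes_eta (a : Fˣ) : symRes hπ a * eta = eta * symRes hπ a := by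
  rw [symRes, mul_assoc, angle_comm_eta, ← mul_assoc, (nEps_comm _ (angle_comm_eta _)).eq,
    mul_assoc]

theorem leftSpec_mul (a b : Fˣ) : leftSpec hπ (a * b) =
    leftSpec hπ a + leftSpec hπ b + eta * leftSpec hπ a * leftSpec hπ b := by
  rw [eta_leftSpec, eta_comm, mul_assoc, eta_leftSpec, ← mul_assoc, ← eta_comm]
  have h : (-1 : (ResidueField R)ˣ) ^ ord hπ (a * b) * resUnit hπ (a * b) =
      ((-1) ^ ord hπ a * resUnit hπ a) * ((-1) ^ ord hπ b * resUnit hπ b) := by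
    rw [ord_mul, resUnit_mul, zpow_add, mul_mul_mul_comm]
  rw [leftSpec, leftSpec, leftSpec, h, sym_mul, mul_add, mul_add, ← mul_assoc, ← mul_assoc,
    angle_neg_one_eta]
  noncomm_ring

theorem symRes_mul (a b : Fˣ) : symRes hπ (a * b) =
    symRes hπ a + symRes hπ b +
      eta * (leftSpec hπ a * symRes hπ b + symRes hπ a * sym (resUnit hπ b)) := by
  have h1 : eta * (leftSpec hπ a * symRes hπ b) =
      angle ((-1) ^ ord hπ a * resUnit hπ a) * symRes hπ b - symRes hπ b := by
    rw [← mul_assoc, eta_leftSpec, angle, add_mul, one_mul, add_sub_cancel_left]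
  have h2 : eta * (symRes hπ a * sym (resUnit hπ b)) =
      symRes hπ a * angle (resUnit hπ b) - symRes hπ a := by
    rw [← mul_assoc, ← symRes_eta, mul_assoc, angle, mul_add, mul_one, add_sub_cancel_left]
  have h3 : symRes hπ a * angle (resUnit hπ b) =
      nEps (ord hπ a) * angle (resUnit hπ (a * b)) := by
    rw [symRes, mul_assoc, ← angle_mul, resUnit_mul]
  have h4 : angle ((-1) ^ ord hπ a * resUnit hπ a) * symRes hπ b =
      angle ((-1) ^ ord hπ a) * nEps (ord hπ b) * angle (resUnit hπ (a * b)) := by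
    rw [symRes, angle_mul, ← mul_assoc, mul_assoc (angle _) (angle _) (nEps _),
      ← (nEps_comm _ (angle_comm_angle _ _)).eq, mul_assoc, mul_assoc, ← angle_mul, resUnit_mul,
      mul_assoc]
  rw [mul_add, h1, h2, h3, h4, symRes, ord_mul, nEps_add, add_mul]
  abel

theorem leftSpec_steinberg (a b : Fˣ) (h : (b : F) = 1 - a) :
    leftSpec hπ a * leftSpec hπ b = 0 := by
  apply leftSpec_mul_leftSpec
  rcases cases_add_eq_one hπ a b h with ⟨-, h1, h2⟩ | ⟨h1, -, h2⟩ | ⟨h1, h2, h3⟩ | ⟨-, h1, h2⟩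
  · rw [h1, h2, zpow_zero, mul_one, sym_one, mul_zero]
  · rw [h1, h2, zpow_zero, mul_one, sym_one, zero_mul]
  · rw [h1, h2, zpow_zero, one_mul, one_mul, steinberg _ _ h3]
  · rw [h1, h2, mul_neg, sym_sym_neg]

theorem sym_resUnit_steinberg (a b : Fˣ) (h : (b : F) = 1 - a) :
    (sym (resUnit hπ a) * sym (resUnit hπ b) : KMW (ResidueField R)) = 0 := by
  rcases cases_add_eq_one hπ a b h with ⟨-, h1, h2⟩ | ⟨h1, -, h2⟩ | ⟨h1, h2, h3⟩ | ⟨-, h1, h2⟩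
  · rw [h2, sym_one, mul_zero]
  · rw [h2, sym_one, zero_mul]
  · rw [steinberg _ _ h3]
  · rw [h2, sym_sym_neg]

theorem symRes_steinberg (a b : Fˣ) (h : (b : F) = 1 - a) :
    leftSpec hπ a * symRes hπ b + symRes hπ a * sym (resUnit hπ b) = 0 := by
  rcases cases_add_eq_one hπ a b h with ⟨-, h1, h2⟩ | ⟨h1, -, h2⟩ | ⟨h1, h2, h3⟩ | ⟨-, h1, h2⟩
  · simp [symRes, h1, h2, sym_one, nEps_zero]
  · simp [leftSpec, symRes, h1, h2, sym_one, nEps_zero]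
  · simp [symRes, h1, h2, nEps_zero]
  · set u := resUnit hπ a with hu
    have h3 : (angle u * sym (-u) : KMW (ResidueField R)) = sym (-u) := by
      simpa using angle_neg_sym (-u)
    have e1 : symRes hπ a * sym (resUnit hπ b) =
        nEps (ord hπ a) * (sym (-u) : KMW (ResidueField R)) := by
      rw [symRes, h2, mul_assoc, ← hu, h3]
    have e2 : leftSpec hπ a * symRes hπ b = nEps (ord hπ a) *
        -(angle (-1) * (angle (-u) * sym ((-1) ^ ord hπ a * u))) := by
      rw [symRes, leftSpec, h1, h2, neg_mul, mul_neg, mul_assoc (angle (-1)), ← mul_assoc (sym _),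
        ← (nEps_comm _ (angle_comm_sym _ _)).eq, mul_assoc, ← angle_comm_sym, ← mul_assoc,
        ← (nEps_comm _ (Commute.refl _)).eq, mul_assoc]
    rw [e1, e2, ← mul_add]
    rcases Int.even_or_odd' (ord hπ a) with ⟨k, hk | hk⟩
    · rw [hk, nEps_even, zpow_mul]
      simp only [zpow_ofNat, neg_one_sq, one_zpow, one_mul]
      rw [angle_neg_sym, mul_add, mul_neg, ← mul_assoc, smul_mul_assoc, smul_mul_assoc,
        smul_mul_assoc, hyp_sym_neg]
      have : (hyp * angle (-1) : KMW (ResidueField R)) = hyp := by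
        rw [hyp, add_mul, one_mul, ← angle_mul, neg_mul_neg, one_mul, angle_one, add_comm]
      rw [this, neg_add_cancel]
    · have hk' : (-1 : (ResidueField R)ˣ) ^ ord hπ a * u = -u := by
        rw [hk, zpow_add, zpow_mul]; simp
      rw [hk', angle_sym_self, ← mul_assoc (angle (-1)), ← angle_mul, neg_mul_neg, one_mul,
        angle_one, one_mul, neg_add_cancel, mul_zero]

theorem ord_neg_one : ord hπ (-1 : Fˣ) = 0 := by
  have := ord_unit (F := F) hπ (-1)
  rwa [show Units.map (algebraMap R F : R →* F) (-1) = -1 by ext; simp] at this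

theorem resUnit_neg_one : resUnit hπ (-1 : Fˣ) = -1 := by
  have := unitPart_unit (F := F) hπ (-1)
  rw [show Units.map (algebraMap R F : R →* F) (-1) = -1 by ext; simp] at this
  rw [resUnit, this]
  ext; simp

/-- For `a = π ^ n * u`, this ring homomorphism sends `[a]` to the upper triangular matrix with
diagonal entries `ε[(-1)^n ū]` and `[ū]`, and with the residue `n_ε ⟨ū⟩` of `[a]` in the corner; it
sends `η` to the scalar matrix `η`. The matrix product encodes the product rule for residues. -/
def resMatrix : KMW F →+* Matrix (Fin 2) (Fin 2) (KMW (ResidueField R)) :=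
  lift !![eta, 0; 0, eta] (fun a => !![leftSpec hπ a, symRes hπ a; 0, sym (resUnit hπ a)])
    (by
      intro a b h
      ext i j
      fin_cases i <;> fin_cases j <;>
        simp [leftSpec_steinberg hπ a b h, symRes_steinberg hπ a b h,
          sym_resUnit_steinberg hπ a b h])
    (by
      intro a b
      ext i j
      fin_cases i <;> fin_cases j
      · simpa [mul_assoc] using leftSpec_mul hπ a b
      · simpa [mul_assoc, mul_add] using symRes_mul hπ a b
      · simp
      · simpa [resUnit_mul] using sym_mul (resUnit hπ a) (resUnit hπ b))
    (by
      intro a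
      ext i j
      fin_cases i <;> fin_cases j <;>
        simp [leftSpec_eta, symRes_eta, eta_comm])
    (by
      have h1 : leftSpec hπ (-1 : Fˣ) = sym (-1) := by
        rw [leftSpec, ord_neg_one, resUnit_neg_one, zpow_zero, one_mul, sym_neg_one_angle, neg_neg]
      have h2 : symRes hπ (-1 : Fˣ) = 0 := by
        rw [symRes, ord_neg_one, nEps_zero, zero_mul]
      have h3 := eta_hyp (F := ResidueField R)
      have h4 : (2 : Matrix (Fin 2) (Fin 2) (KMW (ResidueField R))) = !![2, 0; 0, 2] := by
        ext i j
        fin_cases i <;> fin_cases j <;> simp [Matrix.ofNat_apply]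
      rw [h1, h2, resUnit_neg_one, h4]
      ext i j
      fin_cases i <;> fin_cases j <;> simp [h3])

/-- The residue homomorphism `∂^π : K_*^MW(F) → K_{*-1}^MW(k)` attached to a uniformizer `π` of a
discrete valuation on `F` with residue field `k`. -/
def residueHom : KMW F →+ KMW (ResidueField R) where
  toFun x := resMatrix hπ x 0 1
  map_zero' := by simp
  map_add' x y := by simp

theorem resMatrix_eta : resMatrix hπ (eta : KMW F) = !![eta, 0; 0, eta] := lift_eta _ _ _ _ _ _

theorem resMatrix_sym (a : Fˣ) : resMatrix hπ (sym a) =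
    !![leftSpec hπ a, symRes hπ a; 0, sym (resUnit hπ a)] := lift_sym _ _ _ _ _ _ a

/-- The residue homomorphism commutes with `η`. -/
theorem residueHom_eta (x : KMW F) : residueHom hπ (eta * x) = eta * residueHom hπ x := by
  simp [residueHom, resMatrix_eta, Matrix.mul_apply, Fin.sum_univ_two]

theorem resMatrix_units (l : List Rˣ) :
    resMatrix hπ ((l.map fun u => (sym (Units.map (algebraMap R F : R →* F) u) : KMW F)).prod) 0 1 = 0 ∧
    resMatrix hπ ((l.map fun u => (sym (Units.map (algebraMap R F : R →* F) u) : KMW F)).prod) 1 1 =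
      (l.map fun u => (sym (Units.map (residue R : R →* ResidueField R) u))).prod := by
  induction l with
  | nil => simp
  | cons u l ih =>
    simp [resMatrix_sym, Matrix.mul_apply, Fin.sum_univ_two, ih.1, ih.2, symRes, ord_unit,
      nEps_zero, resUnit, unitPart_unit]

/-- The residue homomorphism vanishes on `[u_1, …, u_n]` for `v`-adic units `u_i`. -/
theorem residueHom_units (l : List Rˣ) :
    residueHom hπ ((l.map fun u => (sym (Units.map (algebraMap R F : R →* F) u) : KMW F)).prod) = 0 :=
  (resMatrix_units hπ l).1

/-- The residue homomorphism sends `[π, u_1, …, u_n]` to `[ū_1, …, ū_n]` for `v`-adic units `u_i`. -/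
theorem residueHom_unif_units (l : List Rˣ) :
    residueHom hπ (sym (unif F hπ) *
      (l.map fun u => (sym (Units.map (algebraMap R F : R →* F) u) : KMW F)).prod) =
      (l.map fun u => (sym (Units.map (residue R : R →* ResidueField R) u))).prod := by
  simp [residueHom, resMatrix_sym, Matrix.mul_apply, Fin.sum_univ_two, (resMatrix_units hπ l).1,
    (resMatrix_units hπ l).2, symRes, ord_unif, nEps_one, resUnit, unitPart_unif, angle_one]

theorem leftSpec_mem (a : Fˣ) : leftSpec hπ a ∈ graded (ResidueField R) 1 :=
  neg_mem (by simpa using mul_mem (angle_mem _) (sym_mem _))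

theorem symRes_mem (a : Fˣ) : symRes hπ a ∈ graded (ResidueField R) 0 := by
  simpa [symRes] using mul_mem (nEps_mem (ord hπ a)) (angle_mem (resUnit hπ a))

theorem resMatrix_gen_mem (g : MWGen F) :
    resMatrix hπ (gen g) 0 0 ∈ graded (ResidueField R) g.deg ∧
    resMatrix hπ (gen g) 0 1 ∈ graded (ResidueField R) (g.deg - 1) ∧
    resMatrix hπ (gen g) 1 1 ∈ graded (ResidueField R) g.deg := by
  cases g with
  | eta =>
    have h : resMatrix hπ (gen .eta : KMW F) = !![eta, 0; 0, eta] := resMatrix_eta hπ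
    rw [h]
    simpa [MWGen.deg, zero_mem] using eta_mem
  | sym a =>
    have h : resMatrix hπ (gen (.sym a) : KMW F) = _ := resMatrix_sym hπ a
    rw [h]
    simpa [MWGen.deg] using ⟨leftSpec_mem hπ a, symRes_mem hπ a, sym_mem _⟩

theorem resMatrix_word_mem (l : List (MWGen F)) :
    resMatrix hπ ((l.map gen).prod) 0 1 ∈ graded (ResidueField R) ((l.map MWGen.deg).sum - 1) ∧
    resMatrix hπ ((l.map gen).prod) 1 1 ∈ graded (ResidueField R) (l.map MWGen.deg).sum := by
  induction l with
  | nil => simpa [zero_mem] using one_mem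
  | cons g l ih =>
    obtain ⟨h1, h2, h3⟩ := resMatrix_gen_mem hπ g
    have h4 : resMatrix hπ (gen g) 1 0 = 0 := by
      cases g with
      | eta =>
        have h : resMatrix hπ (gen .eta : KMW F) = !![eta, 0; 0, eta] := resMatrix_eta hπ
        rw [h]; simp
      | sym a =>
        have h : resMatrix hπ (gen (.sym a) : KMW F) = _ := resMatrix_sym hπ a
        rw [h]; simp
    simp only [List.map_cons, List.prod_cons, List.sum_cons, map_mul, Matrix.mul_apply,
      Fin.sum_univ_two, h4, zero_mul, zero_add]
    refine ⟨add_mem ?_ ?_, mul_mem h3 ih.2⟩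
    · rw [add_sub_assoc]
      exact mul_mem h1 ih.1
    · rw [add_sub_right_comm]
      exact mul_mem h2 ih.2

theorem residueHom_mem {n : ℤ} {x : KMW F} (hx : x ∈ graded F n) :
    residueHom hπ x ∈ graded (ResidueField R) (n - 1) := by
  induction hx using AddSubgroup.closure_induction with
  | mem x hx =>
    obtain ⟨l, rfl, rfl⟩ := hx
    exact (resMatrix_word_mem hπ l).1
  | zero => simp [zero_mem]
  | add y z _ _ h h' => rw [map_add]; exact add_mem h h'
  | neg y _ h => rw [map_neg]; exact neg_mem h

/-- The residue homomorphism in degree one, `∂^π : K_1^MW(F) → K_0^MW(k)`. -/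
def residueOne : graded F 1 →+ graded (ResidueField R) 0 where
  toFun x := ⟨residueHom hπ x, by simpa using residueHom_mem hπ x.2⟩
  map_zero' := by ext; simp
  map_add' x y := by ext; simp

end residue
end KMW

namespace KMW

open IsLocalRing MWVal

/-! ### Twisted Milnor–Witt K-theory in degree zero -/

/-- The nonzero vectors `V \ 0`. -/
def NonzeroVec (k V : Type*) [Field k] [AddCommGroup V] [Module k V] : Type _ := {v : V // v ≠ 0}

instance (k V : Type*) [Field k] [AddCommGroup V] [Module k V] :
    MulAction kˣ (NonzeroVec k V) where
  smul u v := ⟨u • v.1, (smul_ne_zero_iff_ne u).mpr v.2⟩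
  one_smul v := Subtype.ext (one_smul _ v.1)
  mul_smul u w v := Subtype.ext (mul_smul u w v.1)

/-- The action of `k^×` on `K_0^MW(k)` in which `u` acts as multiplication by `⟨u⟩`. -/
def angleRep (k : Type*) [Field k] : Representation ℤ kˣ (graded k 0) where
  toFun u := AddMonoidHom.toIntLinearMap
    { toFun x := ⟨angle u * x, by simpa using mul_mem (angle_mem u) x.2⟩
      map_zero' := by ext; simp
      map_add' x y := by ext; simp [mul_add] }
  map_one' := by
    ext x; simp [angle_one]
  map_mul' u w := by
    ext x; simp [angle_mul, mul_assoc]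

open scoped TensorProduct in
/-- The twisted group `GW(k, V) = K_0^MW(k, V) = K_0^MW(k) ⊗_{ℤ[k^×]} ℤ[V \ 0]`, where `u ∈ k^×` acts
on the left factor by `⟨u⟩` and on the right factor through multiplication of vectors. -/
abbrev TwistedGW (k V : Type*) [Field k] [AddCommGroup V] [Module k V] : Type _ :=
  (angleRep k).asModule ⊗[MonoidAlgebra ℤ kˣ]
    (Representation.ofMulAction ℤ kˣ (NonzeroVec k V)).asModule

/-- The homomorphism `x ↦ x ⊗ v` from `K_0^MW(k)` to `GW(k, V)`. -/
def twist (k : Type*) {V : Type*} [Field k] [AddCommGroup V] [Module k V] (v : NonzeroVec k V) :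
    graded k 0 →+ TwistedGW k V where
  toFun x := TensorProduct.tmul _ ((angleRep k).asModuleEquiv.symm x)
    ((Representation.ofMulAction ℤ kˣ (NonzeroVec k V)).asModuleEquiv.symm
      (MonoidAlgebra.single v 1))
  map_zero' := by simp
  map_add' x y := by rw [map_add, TensorProduct.add_tmul]

section tilde

variable {R : Type*} [CommRing R] [IsDomain R] [IsDiscreteValuationRing R]
  {F : Type*} [Field F] [Algebra R F] [IsFractionRing R F] {π : R} (hπ : Irreducible π)

/-- The class of a uniformizer in the cotangent space `𝔪 / 𝔪²`. -/
def unifClass : CotangentSpace R :=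
  (maximalIdeal R).toCotangent ⟨π, (mem_maximalIdeal π).mpr hπ.not_isUnit⟩

theorem unifClass_ne_zero : unifClass hπ ≠ 0 := by
  intro h
  rw [unifClass, Ideal.toCotangent_eq_zero] at h
  change π ∈ maximalIdeal R ^ 2 at h
  rw [hπ.maximalIdeal_eq, Ideal.span_singleton_pow, Ideal.mem_span_singleton] at h
  obtain ⟨c, hc⟩ := h
  refine hπ.not_isUnit (IsUnit.of_mul_eq_one c (mul_left_cancel₀ hπ.ne_zero ?_))
  rw [mul_one, ← mul_assoc, ← pow_two]
  exact hc.symm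

theorem finrank_cotangent : Module.finrank (ResidueField R) (CotangentSpace R) = 1 :=
  ((IsDiscreteValuationRing.TFAE R (IsDiscreteValuationRing.not_isField R)).out 0 5 :
    IsDiscreteValuationRing R ↔ _).mp inferInstance

/-- The linear form on `𝔪 / 𝔪²` dual to the class of the uniformizer `π`, as a nonzero vector of
`(𝔪 / 𝔪²)^∨`. -/
def unifDual : NonzeroVec (ResidueField R) (Module.Dual (ResidueField R) (CotangentSpace R)) :=
  ⟨(FiniteDimensional.basisSingleton Unit finrank_cotangent (unifClass hπ) (unifClass_ne_zero hπ)).coord (), by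
    intro h
    have h1 := congrArg (fun f => f (unifClass hπ)) h
    have h2 := (FiniteDimensional.basisSingleton Unit finrank_cotangent (unifClass hπ)
      (unifClass_ne_zero hπ)).repr_self ()
    rw [FiniteDimensional.basisSingleton_apply] at h2
    simp [Module.Basis.coord_apply, h2] at h1⟩

theorem unifDual_unifClass : (unifDual hπ).1 (unifClass hπ) = 1 := by
  have h2 := (FiniteDimensional.basisSingleton Unit finrank_cotangent (unifClass hπ)
    (unifClass_ne_zero hπ)).repr_self ()
  rw [FiniteDimensional.basisSingleton_apply] at h2
  simp [unifDual, Module.Basis.coord_apply, h2]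

variable (F) in
/-- The twisted residue `∂_v : K_1^MW(F) → GW(k, (𝔪 / 𝔪²)^∨)`, `x ↦ ∂^π(x) ⊗ π̄`. -/
def ordTilde : graded F 1 →+
    TwistedGW (ResidueField R) (Module.Dual (ResidueField R) (CotangentSpace R)) :=
  (twist (ResidueField R) (unifDual hπ)).comp (residueOne hπ)

end tilde

/-! ### The infinite real valuation -/

/-- The signature of a real quadratic form. -/
def signature {M : Type*} [AddCommGroup M] [Module ℝ M] (Q : QuadraticForm ℝ M) : ℤ :=
  (sigPos Q : ℤ) - sigNeg Q

/-- The quadratic form `⟨⟨x⟩⟩ = ⟨1⟩ ⊥ ⟨-x⟩`. -/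
def pfisterForm (x : ℝ) : QuadraticForm ℝ (Fin 2 → ℝ) :=
  QuadraticMap.weightedSumSquares ℝ ![1, -x]

theorem signature_pfisterForm {x : ℝ} (hx : x ≠ 0) :
    signature (pfisterForm x) = if 0 < x then 0 else 2 := by
  have h1 : sigPos (pfisterForm x) = if 0 < x then 1 else 2 := by
    rw [pfisterForm, QuadraticForm.sigPos_weightedSumSquares]
    split_ifs with h
    · rw [Set.ncard_eq_one]
      refine ⟨0, ?_⟩
      ext i; fin_cases i <;> simp [h.le]
    · have hx' : x < 0 := lt_of_le_of_ne (not_lt.mp h) hx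
      rw [show {i : Fin 2 | 0 < (![1, -x] : Fin 2 → ℝ) i} = Set.univ by
        ext i; fin_cases i <;> simp [hx']]
      simp [Set.ncard_univ]
  have h2 : sigNeg (pfisterForm x) = if 0 < x then 1 else 0 := by
    rw [pfisterForm, QuadraticForm.sigNeg_weightedSumSquares]
    split_ifs with h
    · rw [Set.ncard_eq_one]
      refine ⟨1, ?_⟩
      ext i; fin_cases i <;> simp [h]
    · rw [Set.ncard_eq_zero]
      ext i; fin_cases i <;> simp [not_lt.mp h]
  rw [signature, h1, h2]
  split_ifs <;> simp

theorem half_signature (x : ℝˣ) :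
    signature (pfisterForm x) / 2 = if 0 < (x : ℝ) then 0 else 1 := by
  rw [signature_pfisterForm x.ne_zero]
  split_ifs <;> simp

/-- The ring homomorphism `K_*^MW(ℝ) → ℤ` that sends `[x]` to half the signature of `⟨⟨x⟩⟩`, and `η`
to `-2`. -/
def signHom : KMW ℝ →+* ℤ :=
  lift (-2) (fun x => signature (pfisterForm x) / 2)
    (by
      intro a b h
      rw [half_signature, half_signature]
      split_ifs with ha hb hb <;> simp
      rw [h] at hb
      linarith)
    (by
      intro a b
      rw [half_signature, half_signature, half_signature, Units.val_mul]
      rcases lt_or_gt_of_ne a.ne_zero with ha | ha <;>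
      rcases lt_or_gt_of_ne b.ne_zero with hb | hb
      · simp [mul_pos_of_neg_of_neg ha hb, ha.not_gt, hb.not_gt]
      · simp [(mul_neg_of_neg_of_pos ha hb).not_gt, ha.not_gt, hb]
      · simp [(mul_neg_of_pos_of_neg ha hb).not_gt, hb.not_gt, ha]
      · simp [mul_pos ha hb, ha, hb])
    (by intro a; ring)
    (by
      rw [half_signature, if_neg (by simp)]
      norm_num)

theorem signHom_sym (x : ℝˣ) : signHom (sym x) = signature (pfisterForm x) / 2 :=
  lift_sym _ _ _ _ _ _ x

/-- The functoriality of Milnor–Witt K-theory. -/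
def map {F E : Type*} [Field F] [Field E] (f : F →+* E) : KMW F →+* KMW E :=
  lift eta (fun a => sym (Units.map (f : F →* E) a))
    (by intro a b h; exact steinberg _ _ (by simp [h]))
    (by intro a b; rw [map_mul, sym_mul])
    (by intro a; exact eta_comm _)
    (by
      rw [show Units.map (f : F →* E) (-1) = -1 by ext; simp]
      exact eta_hyp)

theorem map_sym {F E : Type*} [Field F] [Field E] (f : F →+* E) (a : Fˣ) :
    map f (sym a) = sym (Units.map (f : F →* E) a) := lift_sym _ _ _ _ _ _ a

/-! ### The map to Milnor K-theory in degree one -/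

section

variable {F : Type*} [Field F]

/-- Multiplication by `[a]` on `K_0^M(F) ⊕ K_1^M(F) = ℤ ⊕ F^×`, the truncation of Milnor K-theory
to degrees `0` and `1`: the map `(n, x) ↦ (0, a ^ n)`. -/
def symEnd (a : Fˣ) : Module.End ℤ (ℤ × Additive Fˣ) :=
  LinearMap.inr ℤ ℤ (Additive Fˣ) ∘ₗ LinearMap.toSpanSingleton ℤ (Additive Fˣ) (Additive.ofMul a) ∘ₗ
    LinearMap.fst ℤ ℤ (Additive Fˣ)

/-- The action of `K_*^MW(F)` on `K_0^M(F) ⊕ K_1^M(F) = ℤ ⊕ F^×` through the quotient by `η`. -/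
def toMilnor : KMW F →+* Module.End ℤ (ℤ × Additive Fˣ) :=
  lift 0 (symEnd (F := F))
    (by
      intro a b _
      refine LinearMap.ext fun x => ?_
      simp [symEnd])
    (by
      intro a b
      refine LinearMap.ext fun x => ?_
      simp [symEnd])
    (by intro a; rw [zero_mul, mul_zero]) (by rw [mul_zero])

variable (F) in
/-- The homomorphism `p : K_1^MW(F) → K_1^M(F) = F^×` that kills `η`; it sends `[a]` to `a`. -/
def toUnits : graded F 1 →+ Additive Fˣ where
  toFun x := (toMilnor x.1 (1, 0)).2
  map_zero' := by simp
  map_add' x y := by simp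

theorem toUnits_sym (a : Fˣ) : toUnits F ⟨sym a, sym_mem a⟩ = Additive.ofMul a := by
  change (toMilnor (sym a) (1, 0)).2 = _
  rw [toMilnor, lift_sym]
  simp [symEnd]

end

end KMW

/-! ### The Witt ring of a field of characteristic different from two -/

/-- A nondegenerate symmetric bilinear form of dimension `dim` over `F`, by its Gram matrix. -/
structure SymForm (F : Type*) [Field F] where
  dim : ℕ
  gram : Matrix (Fin dim) (Fin dim) F
  symm : gram.IsSymm
  nondeg : IsUnit gram.det

namespace SymForm

variable {F : Type*} [Field F]

/-- Isometry of Gram matrices: there is an invertible change of coordinates `P` with `Pᵀ A P = B`. -/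
def MatIsom {m n : Type*} [Fintype m] [Fintype n] [DecidableEq m] [DecidableEq n]
    (A : Matrix m m F) (B : Matrix n n F) : Prop :=
  ∃ (P : Matrix m n F) (Q : Matrix n m F), P * Q = 1 ∧ Q * P = 1 ∧ P.transpose * A * P = B

section MatIsom

variable {l m n m' n' : Type*} [Fintype l] [Fintype m] [Fintype n] [Fintype m'] [Fintype n']
  [DecidableEq l] [DecidableEq m] [DecidableEq n] [DecidableEq m'] [DecidableEq n']

theorem MatIsom.refl (A : Matrix m m F) : MatIsom A A := ⟨1, 1, by simp, by simp, by simp⟩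

theorem MatIsom.symm {A : Matrix m m F} {B : Matrix n n F} (h : MatIsom A B) : MatIsom B A := by
  obtain ⟨P, Q, h1, h2, rfl⟩ := h
  refine ⟨Q, P, h2, h1, ?_⟩
  have h3 : Q.transpose * P.transpose = 1 := by rw [← Matrix.transpose_mul, h1, Matrix.transpose_one]
  calc Q.transpose * (P.transpose * A * P) * Q
      = (Q.transpose * P.transpose) * A * (P * Q) := by simp only [Matrix.mul_assoc]
    _ = A := by rw [h3, h1, Matrix.one_mul, Matrix.mul_one]

theorem MatIsom.trans {A : Matrix l l F} {B : Matrix m m F} {C : Matrix n n F}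
    (h : MatIsom A B) (h' : MatIsom B C) : MatIsom A C := by
  obtain ⟨P, Q, h1, h2, rfl⟩ := h
  obtain ⟨P', Q', h1', h2', rfl⟩ := h'
  refine ⟨P * P', Q' * Q, ?_, ?_, ?_⟩
  · rw [Matrix.mul_assoc, ← Matrix.mul_assoc P', h1', Matrix.one_mul, h1]
  · rw [Matrix.mul_assoc, ← Matrix.mul_assoc Q, h2, Matrix.one_mul, h2']
  · simp only [Matrix.transpose_mul, Matrix.mul_assoc]

theorem MatIsom.of_reindex (e : m ≃ n) (A : Matrix m m F) : MatIsom A (Matrix.reindex e e A) := by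
  refine ⟨(1 : Matrix m m F).submatrix id e.symm, (1 : Matrix m m F).submatrix e.symm id, ?_, ?_, ?_⟩
  · rw [Matrix.submatrix_mul_equiv]; simp
  · rw [← Matrix.submatrix_mul _ _ _ _ _ Function.bijective_id]; simp
  · ext i j
    simp [Matrix.mul_apply, Matrix.one_apply]

theorem MatIsom.of_equiv (e : m ≃ n) {A : Matrix m m F} {B : Matrix n n F}
    (h : ∀ i j, B (e i) (e j) = A i j) : MatIsom A B := by
  convert MatIsom.of_reindex e A using 1
  ext i j
  simpa using h (e.symm i) (e.symm j)

open scoped Kronecker in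
theorem MatIsom.kronecker {A : Matrix m m F} {B : Matrix n n F} {A' : Matrix m' m' F}
    {B' : Matrix n' n' F} (h : MatIsom A B) (h' : MatIsom A' B') :
    MatIsom (A ⊗ₖ A') (B ⊗ₖ B') := by
  obtain ⟨P, Q, h1, h2, rfl⟩ := h
  obtain ⟨P', Q', h1', h2', rfl⟩ := h'
  refine ⟨P ⊗ₖ P', Q ⊗ₖ Q', ?_, ?_, ?_⟩
  · rw [← Matrix.mul_kronecker_mul, h1, h1', Matrix.one_kronecker_one]
  · rw [← Matrix.mul_kronecker_mul, h2, h2', Matrix.one_kronecker_one]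
  · rw [Matrix.mul_kronecker_mul, Matrix.mul_kronecker_mul, Matrix.kroneckerMap_transpose]

end MatIsom

/-- Isometry of symmetric bilinear forms. -/
instance setoid (F : Type*) [Field F] : Setoid (SymForm F) where
  r X Y := MatIsom X.gram Y.gram
  iseqv := ⟨fun _ => MatIsom.refl _, MatIsom.symm, MatIsom.trans⟩

open scoped Kronecker in
/-- The tensor product of two forms. -/
def tensor (X Y : SymForm F) : SymForm F where
  dim := X.dim * Y.dim
  gram := Matrix.reindex finProdFinEquiv finProdFinEquiv (X.gram ⊗ₖ Y.gram)
  symm := by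
    rw [Matrix.IsSymm, Matrix.transpose_reindex, ← Matrix.kroneckerMap_transpose, X.symm, Y.symm]
  nondeg := by
    rw [Matrix.det_reindex_self, Matrix.det_kronecker]
    exact (X.nondeg.pow _).mul (Y.nondeg.pow _)

/-- The orthogonal sum of two forms. -/
def oplus (X Y : SymForm F) : SymForm F where
  dim := X.dim + Y.dim
  gram := Matrix.reindex finSumFinEquiv finSumFinEquiv (Matrix.fromBlocks X.gram 0 0 Y.gram)
  symm := by
    rw [Matrix.IsSymm, Matrix.transpose_reindex, Matrix.fromBlocks_transpose, X.symm, Y.symm]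
    simp
  nondeg := by
    rw [Matrix.det_reindex_self, Matrix.det_fromBlocks_zero₂₁]
    exact X.nondeg.mul Y.nondeg

/-- The one-dimensional form `⟨a⟩`. -/
def rankOne (a : Fˣ) : SymForm F where
  dim := 1
  gram := !![(a : F)]
  symm := by ext i j; fin_cases i; fin_cases j; rfl
  nondeg := by simp

/-- The hyperbolic plane. -/
def hyperbolic (F : Type*) [Field F] : SymForm F where
  dim := 2
  gram := !![0, 1; 1, 0]
  symm := by ext i j; fin_cases i <;> fin_cases j <;> rfl
  nondeg := by simp

theorem dim_eq {X Y : SymForm F} (h : X ≈ Y) : X.dim = Y.dim := by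
  obtain ⟨P, Q, h1, h2, -⟩ := h
  simpa using Matrix.square_of_invertible P Q h1 h2

end SymForm

open SymForm in
/-- The set of isometry classes of nondegenerate symmetric bilinear forms over `F`. -/
def IsomClass (F : Type*) [Field F] : Type _ := Quotient (SymForm.setoid F)

namespace IsomClass

variable {F : Type*} [Field F]

/-- The isometry class of a form. -/
def mk (X : SymForm F) : IsomClass F := Quotient.mk _ X

/-- Isometry classes form a commutative monoid under the tensor product. -/
instance : CommMonoid (IsomClass F) where
  mul := Quotient.map₂ SymForm.tensor fun _ _ h _ _ h' =>
    ((SymForm.MatIsom.of_reindex _ _).symm.trans (h.kronecker h')).trans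
      (SymForm.MatIsom.of_reindex _ _)
  one := mk (SymForm.rankOne 1)
  mul_assoc := by
    rintro ⟨X⟩ ⟨Y⟩ ⟨Z⟩
    refine Quotient.sound (SymForm.MatIsom.of_equiv
      (finProdFinEquiv.symm.trans <| (finProdFinEquiv.symm.prodCongr (Equiv.refl _)).trans <|
        (Equiv.prodAssoc _ _ _).trans <| ((Equiv.refl _).prodCongr finProdFinEquiv).trans
          finProdFinEquiv) ?_)
    intro i j
    simp [SymForm.tensor, mul_assoc]
  one_mul := by
    rintro ⟨X⟩
    refine Quotient.sound (SymForm.MatIsom.of_equiv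
      (finProdFinEquiv.symm.trans <| Equiv.uniqueProd (Fin X.dim) (Fin 1)) ?_)
    intro i j
    simp [SymForm.tensor, SymForm.rankOne]
  mul_one := by
    rintro ⟨X⟩
    refine Quotient.sound (SymForm.MatIsom.of_equiv
      (finProdFinEquiv.symm.trans <| Equiv.prodUnique (Fin X.dim) (Fin 1)) ?_)
    intro i j
    simp [SymForm.tensor, SymForm.rankOne]
  mul_comm := by
    rintro ⟨X⟩ ⟨Y⟩
    refine Quotient.sound (SymForm.MatIsom.of_equiv
      (finProdFinEquiv.symm.trans <| (Equiv.prodComm _ _).trans finProdFinEquiv) ?_)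
    intro i j
    simp [SymForm.tensor, mul_comm]

theorem mk_mul (X Y : SymForm F) : mk X * mk Y = mk (X.tensor Y) := rfl

/-- The dimension of an isometry class. -/
def dim : IsomClass F →* ℕ where
  toFun := Quotient.lift SymForm.dim fun _ _ h => SymForm.dim_eq h
  map_one' := rfl
  map_mul' := by rintro ⟨X⟩ ⟨Y⟩; rfl

theorem dim_mk (X : SymForm F) : dim (mk X) = X.dim := rfl

end IsomClass

/-- The relations of the Witt ring: orthogonal sums are sums, and the hyperbolic plane is zero. -/
def wittRelations (F : Type*) [Field F] : Set (MonoidAlgebra ℤ (IsomClass F)) :=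
  {x | ∃ X Y : SymForm F, x = MonoidAlgebra.of ℤ _ (IsomClass.mk (X.oplus Y)) -
      MonoidAlgebra.of ℤ _ (IsomClass.mk X) - MonoidAlgebra.of ℤ _ (IsomClass.mk Y)} ∪
    {MonoidAlgebra.of ℤ _ (IsomClass.mk (SymForm.hyperbolic F))}

/-- The Witt ring `W(F)` of a field of characteristic different from two: the Grothendieck ring of
isometry classes of nondegenerate symmetric bilinear forms under orthogonal sum and tensor product,
modulo the ideal generated by the hyperbolic plane. -/
abbrev WittRing (F : Type*) [Field F] : Type _ :=
  MonoidAlgebra ℤ (IsomClass F) ⧸ Ideal.span (wittRelations F)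

namespace WittRing

variable {F : Type*} [Field F]

/-- The class of a form in the Witt ring. -/
def ofForm (X : SymForm F) : WittRing F :=
  Ideal.Quotient.mk _ (MonoidAlgebra.of ℤ _ (IsomClass.mk X))

/-- The dimension modulo two. -/
def dimModTwo (F : Type*) [Field F] : WittRing F →+* ZMod 2 :=
  Ideal.Quotient.lift _
    (MonoidAlgebra.lift ℤ (ZMod 2) (IsomClass F)
      ((Nat.castRingHom (ZMod 2) : ℕ →* ZMod 2).comp IsomClass.dim)).toRingHom
    (by
      intro x hx
      rw [← RingHom.mem_ker]
      revert x
      change Ideal.span (wittRelations F) ≤ _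
      rw [Ideal.span_le]
      rintro x (⟨X, Y, rfl⟩ | rfl)
      · simp [IsomClass.dim_mk, SymForm.oplus]
      · have : ((2 : ℕ) : ZMod 2) = 0 := rfl
        simpa [IsomClass.dim_mk, SymForm.hyperbolic] using this)

theorem dimModTwo_ofForm (X : SymForm F) : dimModTwo F (ofForm X) = X.dim := by
  simp [dimModTwo, ofForm, IsomClass.dim_mk]

/-- The fundamental ideal `I(F)`, the ideal of classes of even-dimensional forms. -/
def fundamentalIdeal (F : Type*) [Field F] : Ideal (WittRing F) := RingHom.ker (dimModTwo F)

/-- The class of the Pfister form `⟨⟨a⟩⟩ = ⟨1⟩ - ⟨a⟩`. -/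
def pfister (a : Fˣ) : WittRing F := ofForm (SymForm.rankOne 1) - ofForm (SymForm.rankOne a)

theorem pfister_mem (a : Fˣ) : pfister a ∈ fundamentalIdeal F := by
  rw [fundamentalIdeal, RingHom.mem_ker, pfister, map_sub, dimModTwo_ofForm, dimModTwo_ofForm]
  simp [SymForm.rankOne]

/-- The Pfister form `⟨⟨a, b⟩⟩ = ⟨⟨a⟩⟩⟨⟨b⟩⟩`, as an element of `I²(F)`. -/
def pfisterTwo (a b : Fˣ) : (fundamentalIdeal F ^ 2 : Ideal (WittRing F)) :=
  ⟨pfister a * pfister b, by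
    rw [pow_two]; exact Ideal.mul_mem_mul (pfister_mem a) (pfister_mem b)⟩

end WittRing

/-! ### The local fields of a number field -/

namespace MWPlace

open NumberField IsDedekindDomain KMW

variable {F : Type*} [Field F] [NumberField F]

/-- The map `K_1^MW(F_v) ≅ K_1^MW(ℝ) → ℤ`, `[x] ↦ ½ σ⟨⟨x⟩⟩`, of a real place. -/
def ordTildeReal (w : InfinitePlace F) (hw : w.IsReal) : graded w.Completion 1 →+ ℤ :=
  (signHom.toAddMonoidHom.comp
    (KMW.map (InfinitePlace.Completion.extensionEmbeddingOfIsReal hw)).toAddMonoidHom).comp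
    (graded w.Completion 1).subtype

/-- The zero map of a complex place. -/
def ordTildeComplex (w : InfinitePlace F) (_ : w.IsComplex) : graded w.Completion 1 →+ ℤ := 0

/-- The residue map `∂_v : K_1^MW(F_v) → GW(k(v), (𝔪_v / 𝔪_v²)^∨)` of a finite place, computed with a
uniformizer `π`. -/
def ordTildeFinite (v : HeightOneSpectrum (𝓞 F)) {π : v.adicCompletionIntegers F}
    (hπ : Irreducible π) :
    graded (v.adicCompletion F) 1 →+
      TwistedGW (IsLocalRing.ResidueField (v.adicCompletionIntegers F))
        (Module.Dual (IsLocalRing.ResidueField (v.adicCompletionIntegers F))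
          (IsLocalRing.CotangentSpace (v.adicCompletionIntegers F))) :=
  ordTilde (v.adicCompletion F) hπ

/-- The group `K_1^MW(O_v)` of a real place. -/
def K1Real (w : InfinitePlace F) (hw : w.IsReal) : AddSubgroup (graded w.Completion 1) :=
  (ordTildeReal w hw).ker

/-- The group `K_1^MW(O_v)` of a complex place. -/
def K1Complex (w : InfinitePlace F) (hw : w.IsComplex) : AddSubgroup (graded w.Completion 1) :=
  (ordTildeComplex w hw).ker

/-- The group `K_1^MW(O_v)` of a finite place. -/
def K1Finite (v : HeightOneSpectrum (𝓞 F)) {π : v.adicCompletionIntegers F} (hπ : Irreducible π) :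
    AddSubgroup (graded (v.adicCompletion F) 1) :=
  (ordTildeFinite v hπ).ker

/-- A finite place is dyadic if it lies above `2`. -/
def IsDyadic (v : HeightOneSpectrum (𝓞 F)) : Prop := (2 : 𝓞 F) ∈ v.asIdeal

end MWPlace

end

/-! Everything rests on the exact sequence 0 → ηK_2^MW → K_1^MW → F^× → 0. The symbols [a] generate
K_1^MW (`graded_one_eq`), and a ↦ [a] is additive modulo the subgroup `etaSub` generated by the
η[a][b], so `etaSub` is exactly the kernel of p (`mem_etaSub_iff`). Each case then reduces to the
behaviour of the order map on `etaSub`.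

At a finite place the rank of ∂x is the valuation of p(x) (`rank_residueHom`), so p sends
K_1^MW(O_v) to units. It is onto because ∂[u] = 0 for units u, and its kernel is `etaSub` ∩ ker ∂.
The twist plays no role: the nonzero vectors of a line span a free Z[k^×]-module of rank one
(`twist_injective`).

Away from 2, ∂ is injective on `etaSub`. A binary form over the finite residue field represents 1,
which together with Hensel and Steinberg gives η[u][w] = 0 for units. So every element of `etaSub`
is a single η[π][w] with residue η[w̄]. If that vanishes, w̄ is a square, hence so is w, and η[w] =
0 (`eq_zero_of_residueHom_eq_zero`).

Above 2, every residue unit is a square and η[b²] = 0, so ∂ kills `etaSub` altogether. It remains to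
identify `etaSub` with I²(F) (`etaSubEquiv`). The map η ↦ 1, [a] ↦ ⟨a⟩ - 1 sends η[a][b] to ⟨⟨a,b⟩⟩
and is onto I². For injectivity, the additive presentation of W(F) by one-dimensional forms
(`liftAdd`) gives a map back, ⟨a⟩ ↦ ([a], 1), into (K_*^MW ⊕ Z) modulo `wittKernel`, whose elements
are the (hy + n[-1], 2n) with y in K_1^MW. It shows that an element x of `etaSub` with zero image is
some hy, and then p(y)² = 1 forces hy = 0.

Over R, `etaSub` is generated by η[-1][-1], whose sign invariant is -2. Over C, every unit is a
square and `etaSub` is zero. -/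

noncomputable section

namespace KMW

/-! ### Structure of K_1^MW: generators, the subgroup ηK_2^MW and the kernel of p. -/

section structure_lemmas

variable {F : Type*} [Field F]

theorem induction_on {p : KMW F → Prop} (x : KMW F) (int : ∀ n : ℤ, p n) (gen : ∀ g, p (gen g))
    (add : ∀ x y, p x → p y → p (x + y)) (mul : ∀ x y, p x → p y → p (x * y)) : p x := by
  obtain ⟨y, rfl⟩ := RingQuot.mkRingHom_surjective (MWRel F) x
  change p (mk F y)
  induction y using FreeAlgebra.induction with
  | grade0 n =>
    have : mk F (algebraMap ℤ _ n) = (n : KMW F) := by simp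
    rw [this]; exact int n
  | grade1 g => exact gen g
  | mul a b ha hb => rw [map_mul]; exact mul _ _ ha hb
  | add a b ha hb => rw [map_add]; exact add _ _ ha hb

theorem commute_eta (x : KMW F) : Commute eta x := by
  induction x using induction_on with
  | int n => exact Int.commute_cast _ _
  | gen g =>
    cases g with
    | eta => exact Commute.refl _
    | sym a => exact eta_comm a
  | add x y hx hy => exact hx.add_right hy
  | mul x y hx hy => exact hx.mul_right hy

theorem sym_mul_self (a : Fˣ) : (sym (a * a) : KMW F) = hyp * sym a := by
  rw [sym_mul', angle_sym_self, hyp, add_mul, one_mul]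

theorem hyp_mul_eta : (hyp * eta : KMW F) = 0 := by
  rw [hyp, add_mul, one_mul, angle_neg_one_eta, add_neg_cancel]

theorem eta_mul_hyp : (eta * hyp : KMW F) = 0 := by
  rw [(commute_eta _).eq, hyp_mul_eta]

theorem hyp_mul_sym_neg_one : (hyp * sym (-1 : Fˣ) : KMW F) = 0 := by
  rw [hyp, add_mul, one_mul, sym_neg_one_angle, add_neg_cancel]

theorem eta_sym_mul_self (a : Fˣ) : (eta * sym (a * a) : KMW F) = 0 := by
  rw [sym_mul_self, ← mul_assoc, eta_mul_hyp, zero_mul]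

/-- Since [c²] = h[c] and ηh = 0, square factors become invisible after multiplication by η. -/
theorem eta_sym_mul_sq (a c : Fˣ) : (eta * sym (a * (c * c)) : KMW F) = eta * sym a := by
  have h : (eta * (angle a * sym (c * c)) : KMW F) = 0 := by
    rw [← mul_assoc, ← angle_comm_eta, mul_assoc, eta_sym_mul_self, mul_zero]
  rw [sym_mul', mul_add, h, add_zero]

theorem eta_sym_sym_mul_sq (a b c d : Fˣ) :
    (eta * sym (a * (c * c)) * sym (b * (d * d)) : KMW F) = eta * sym a * sym b := by
  rw [eta_sym_mul_sq, eta_comm, mul_assoc, eta_sym_mul_sq, ← mul_assoc, ← eta_comm]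

theorem eta_sym_sym_of_sq_left (a b c d : Fˣ) (h : (sym (a * (c * c)) * sym (b * (d * d)) : KMW F) = 0) :
    (eta * sym a * sym b : KMW F) = 0 := by
  rw [← eta_sym_sym_mul_sq a b c d, mul_assoc, h, mul_zero]

theorem eta_sym_sym_self (a : Fˣ) : (eta * sym a * sym a : KMW F) = eta * sym a * sym (-1) := by
  have h := angle_sym_self a
  rw [angle, angle, add_mul, add_mul, one_mul] at h
  rw [add_left_cancel h, eta_sym_symm]

theorem eta_sym_mul_sym (a b c : Fˣ) : (eta * sym (a * b) * sym c : KMW F) =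
    eta * sym a * sym c + eta * sym b * sym c + eta * sym a * (eta * sym b * sym c) := by
  have h : (eta * sym a * (eta * sym b * sym c) : KMW F) =
      eta * (eta * sym a * sym b) * sym c := by
    simp only [mul_assoc]
    rw [← mul_assoc (sym a) eta, ← eta_comm, mul_assoc]
  rw [sym_mul, mul_add, mul_add, add_mul, add_mul, h]

/-- The subgroup `η K_2^MW(F)` of `K_1^MW(F)`, generated by the elements `η[a][b]`. -/
def etaSub (F : Type*) [Field F] : AddSubgroup (KMW F) :=
  AddSubgroup.closure {x | ∃ a b : Fˣ, x = eta * sym a * sym b}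

theorem eta_sym_sym_mem (a b : Fˣ) : eta * sym a * sym b ∈ etaSub F :=
  AddSubgroup.subset_closure ⟨a, b, rfl⟩

theorem etaSub_le : etaSub F ≤ graded F 1 := by
  rw [etaSub, AddSubgroup.closure_le]
  rintro _ ⟨a, b, rfl⟩
  simpa using mul_mem (mul_mem eta_mem (sym_mem a)) (sym_mem b)

/-- η is central, so all its occurrences in a word can be collected on the left. -/
theorem exists_word_eq (l : List (MWGen F)) : ∃ (m : ℕ) (s : List Fˣ),
    (l.map gen).prod = eta ^ m * (s.map sym).prod ∧
      (l.map MWGen.deg).sum = (s.length : ℤ) - m := by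
  induction l with
  | nil => exact ⟨0, [], by simp, by simp⟩
  | cons g l ih =>
    obtain ⟨m, s, h1, h2⟩ := ih
    cases g with
    | eta =>
      refine ⟨m + 1, s, ?_, ?_⟩
      · rw [List.map_cons, List.prod_cons, h1, pow_succ', mul_assoc]; rfl
      · simp [h2, MWGen.deg]; ring
    | sym a =>
      refine ⟨m, a :: s, ?_, ?_⟩
      · rw [List.map_cons, List.prod_cons, h1, ← mul_assoc, List.map_cons, List.prod_cons,
          ← mul_assoc, ((commute_eta _).pow_left m).eq]; rfl
      · simp [h2, MWGen.deg]; ring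

theorem eta_pow_mul_prod_mem (m : ℕ) (s : List Fˣ) (h : s.length = m + 1) :
    (eta ^ m * (s.map sym).prod : KMW F) ∈ AddSubgroup.closure (Set.range sym) := by
  induction m generalizing s with
  | zero =>
    obtain ⟨a, rfl⟩ := List.length_eq_one_iff.mp h
    simpa using AddSubgroup.subset_closure (Set.mem_range_self a)
  | succ m ih =>
    match s, h with
    | a :: b :: t, h =>
      -- The relation η[a][b] = [ab] - [a] - [b] trades one η and one symbol factor for a sum of
      -- shorter words.
      have key : (eta ^ (m + 1) * ((a :: b :: t).map sym).prod : KMW F) =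
          eta ^ m * (((a * b) :: t).map sym).prod - eta ^ m * ((a :: t).map sym).prod -
            eta ^ m * ((b :: t).map sym).prod := by
        simp only [List.map_cons, List.prod_cons]
        rw [sym_mul]
        simp only [mul_add, add_mul, pow_succ, mul_assoc]
        abel
      simp only [List.length_cons] at h
      rw [key]
      exact sub_mem (sub_mem (ih _ (by simp; omega)) (ih _ (by simp; omega)))
        (ih _ (by simp; omega))

theorem graded_one_eq : graded F 1 = AddSubgroup.closure (Set.range (sym : Fˣ → KMW F)) := by
  apply le_antisymm
  · rw [graded, AddSubgroup.closure_le]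
    rintro _ ⟨l, hl, rfl⟩
    obtain ⟨m, s, h1, h2⟩ := exists_word_eq l
    rw [h1]
    exact eta_pow_mul_prod_mem m s (by omega)
  · rw [AddSubgroup.closure_le]
    rintro _ ⟨a, rfl⟩
    exact sym_mem a

/-- Extension of `toUnits` to all degrees. -/
def unitsHom (F : Type*) [Field F] : KMW F →+ Additive Fˣ where
  toFun x := (toMilnor x (1, 0)).2
  map_zero' := by simp
  map_add' x y := by simp

theorem toUnits_eq (x : graded F 1) : toUnits F x = unitsHom F x := rfl

theorem unitsHom_sym (a : Fˣ) : unitsHom F (sym a) = Additive.ofMul a := toUnits_sym a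

theorem unitsHom_eta_mul (x : KMW F) : unitsHom F (eta * x) = 0 := by
  change (toMilnor (eta * x) (1, 0)).2 = _
  have : toMilnor (eta : KMW F) = 0 := lift_eta _ _ _ _ _ _
  rw [map_mul, this, zero_mul]
  rfl

theorem unitsHom_of_mem_etaSub {x : KMW F} (hx : x ∈ etaSub F) : unitsHom F x = 0 := by
  induction hx using AddSubgroup.closure_induction with
  | mem x hx =>
    obtain ⟨a, b, rfl⟩ := hx
    rw [mul_assoc, unitsHom_eta_mul]
  | zero => simp
  | add y z _ _ h h' => rw [map_add, h, h', add_zero]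
  | neg y _ h => rw [map_neg, h, neg_zero]

/-- Modulo ηK_2 the symbol is additive, so x is congruent to the single symbol [p(x)]. -/
theorem sub_sym_mem_etaSub {x : KMW F} (hx : x ∈ graded F 1) :
    x - sym (unitsHom F x).toMul ∈ etaSub F := by
  rw [graded_one_eq] at hx
  induction hx using AddSubgroup.closure_induction with
  | mem x hx =>
    obtain ⟨a, rfl⟩ := hx
    rw [unitsHom_sym, toMul_ofMul, sub_self]
    exact zero_mem _
  | zero => simp [sym_one, zero_mem]
  | add y z _ _ h h' =>
    rw [map_add, toMul_add, sym_mul]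
    convert sub_mem (add_mem h h')
      (eta_sym_sym_mem (unitsHom F y).toMul (unitsHom F z).toMul) using 1
    abel
  | neg y _ h =>
    rw [map_neg, toMul_neg]
    set c := (unitsHom F y).toMul
    -- Expanding [1] = 0 shows that [c⁻¹] is -[c] up to η[c][c⁻¹].
    have h1 : (sym (c * c⁻¹) : KMW F) = 0 := by rw [mul_inv_cancel, sym_one]
    rw [sym_mul, add_assoc] at h1
    convert sub_mem (eta_sym_sym_mem c c⁻¹) h using 1
    rw [← sub_eq_zero, ← neg_eq_zero, ← h1]
    abel

theorem mem_etaSub_iff {x : KMW F} (hx : x ∈ graded F 1) : x ∈ etaSub F ↔ unitsHom F x = 0 := by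
  refine ⟨unitsHom_of_mem_etaSub, fun h => ?_⟩
  simpa [h, sym_one] using sub_sym_mem_etaSub hx

theorem exists_eq_sym_add {x : KMW F} (hx : x ∈ graded F 1) :
    ∃ y ∈ etaSub F, x = sym (unitsHom F x).toMul + y :=
  ⟨_, sub_sym_mem_etaSub hx, by abel⟩

theorem hyp_mul_of_mem_etaSub {x : KMW F} (hx : x ∈ etaSub F) : hyp * x = 0 := by
  induction hx using AddSubgroup.closure_induction with
  | mem x hx =>
    obtain ⟨a, b, rfl⟩ := hx
    rw [← mul_assoc, ← mul_assoc, hyp_mul_eta, zero_mul, zero_mul]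
  | zero => simp
  | add y z _ _ h h' => rw [mul_add, h, h', add_zero]
  | neg y _ h => rw [mul_neg, h, neg_zero]

/-- Because hη = 0, the product hy equals h[c] = [c²] with c = p(y). Applying p gives c² = 1, so c =
±1, and h[1] = h[-1] = 0. This is the last step in the injectivity of ηK_2 → I². -/
theorem hyp_mul_eq_zero {y : KMW F} (hy : y ∈ graded F 1) (h : hyp * y ∈ etaSub F) :
    hyp * y = 0 := by
  obtain ⟨z, hz, hyz⟩ := exists_eq_sym_add hy
  set c := (unitsHom F y).toMul
  have h1 : hyp * y = hyp * sym c := by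
    rw [hyz, mul_add, hyp_mul_of_mem_etaSub hz, add_zero]
  have h2 := unitsHom_of_mem_etaSub h
  rw [h1, ← sym_mul_self, unitsHom_sym, ofMul_eq_zero] at h2
  rw [h1]
  have h3 : (c : F) * c = 1 := by simpa using congrArg Units.val h2
  rcases mul_self_eq_one_iff.mp h3 with h3 | h3
  · rw [Units.val_eq_one.mp h3, sym_one, mul_zero]
  · rw [show c = -1 from Units.ext (by simpa using h3), hyp_mul_sym_neg_one]

end structure_lemmas

end KMW

/-! ### Invariance of additive Witt data under change of orthogonal basis. -/

section orthogonal_families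

variable {F V A : Type*} [Field F] [AddCommGroup V] [Module F V] [AddCommGroup A]

/-- A family of pairwise orthogonal anisotropic vectors. -/
def IsOrthFamily {ι : Type*} (B : LinearMap.BilinForm F V) (e : ι → V) : Prop :=
  (∀ i j, i ≠ j → B (e i) (e j) = 0) ∧ ∀ i, B (e i) (e i) ≠ 0

/-- The defining relations of the additive group of the Witt ring, without the hyperbolic plane. -/
structure IsWittAdditive (ψ : F → A) : Prop where
  sq : ∀ a b : F, a ≠ 0 → b ≠ 0 → ψ (a * (b * b)) = ψ a
  add : ∀ a b : F, a ≠ 0 → b ≠ 0 → a + b ≠ 0 → ψ a + ψ b = ψ (a + b) + ψ (a * b * (a + b))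

variable {B : LinearMap.BilinForm F V} {ψ : F → A}

theorem IsWittAdditive.add_eq (hψ : IsWittAdditive ψ) {a b x y : F} (ha : a ≠ 0) (hb : b ≠ 0)
    (hx : x ≠ 0) (hy : y ≠ 0) (h : a * (x * x) + b * (y * y) ≠ 0) :
    ψ a + ψ b = ψ (a * (x * x) + b * (y * y)) + ψ (a * b * (a * (x * x) + b * (y * y))) := by
  rw [← hψ.sq a x ha hx, ← hψ.sq b y hb hy, hψ.add _ _ (mul_ne_zero ha (mul_ne_zero hx hx)) (mul_ne_zero hb (mul_ne_zero hy hy)) h,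
    ← hψ.sq (a * b * (a * (x * x) + b * (y * y))) (x * y)
      (mul_ne_zero (mul_ne_zero ha hb) h) (mul_ne_zero hx hy)]
  congr 2
  ring

/-- If all pairs cancelled, three indices would give 2 q_i = 0, and exactly two indices would make
the total sum vanish. This supplies an anisotropic vector in a coordinate plane. -/
theorem exists_pair_ne_zero (h2 : (2 : F) ≠ 0) {ι : Type*} (s : Finset ι) (q : ι → F)
    (hq : ∀ i ∈ s, q i ≠ 0) (hsum : ∑ i ∈ s, q i ≠ 0) (hs : 1 < s.card) :
    ∃ i ∈ s, ∃ j ∈ s, i ≠ j ∧ q i + q j ≠ 0 := by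
  classical
  by_contra! H
  obtain ⟨i, hi, j, hj, hij⟩ := Finset.one_lt_card.mp hs
  by_cases h : ∃ k ∈ s, k ≠ i ∧ k ≠ j
  · obtain ⟨k, hk, hki, hkj⟩ := h
    have h1 := H i hi j hj hij
    have h3 := H i hi k hk hki.symm
    have h4 := H j hj k hk hkj.symm
    have h5 : 2 * q i = 0 := by linear_combination h1 + h3 - h4
    exact (mul_ne_zero h2 (hq i hi)) h5
  · push Not at h
    have : s = {i, j} := by
      ext k
      simp only [Finset.mem_insert, Finset.mem_singleton]
      refine ⟨fun hk => ?_, ?_⟩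
      · by_cases hki : k = i
        · exact Or.inl hki
        · exact Or.inr (h k hk hki)
      · rintro (rfl | rfl) <;> assumption
    rw [this, Finset.sum_pair hij] at hsum
    exact hsum (H i hi j hj hij)

theorem sum_eq_pair_add {ι M : Type*} [Fintype ι] [DecidableEq ι] [AddCommMonoid M] {i j : ι}
    (hij : i ≠ j) (f : ι → M) :
    ∑ k, f k = f i + f j + ∑ k ∈ (Finset.univ.erase i).erase j, f k := by
  rw [add_assoc, Finset.add_sum_erase _ _ (Finset.mem_erase.mpr ⟨hij.symm, Finset.mem_univ j⟩),
    Finset.add_sum_erase _ _ (Finset.mem_univ i)]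

theorem IsOrthFamily.apply_sum_self {ι : Type*} [Fintype ι] {e : ι → V} (he : IsOrthFamily B e)
    (x : ι → F) : B (∑ i, x i • e i) (∑ i, x i • e i) = ∑ i, B (e i) (e i) * (x i * x i) := by
  simp only [map_sum, LinearMap.sum_apply, map_smul, LinearMap.smul_apply, smul_eq_mul]
  refine Finset.sum_congr rfl fun i _ => ?_
  rw [Finset.sum_eq_single i (fun j _ hj => by rw [he.1 j i hj]; simp) (by simp)]
  ring

-- An anisotropic vector can be brought into an orthogonal family by moves that touch only two
-- members at a time, and each such move preserves the sum of ψ by the binary relation. The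
-- induction is on the number of nonzero coordinates of the vector: two of them are merged into one.
open Classical in
theorem IsOrthFamily.exists_mem_replace (h2 : (2 : F) ≠ 0) (hB : B.IsSymm)
    (hψ : IsWittAdditive ψ) {ι : Type*} [Fintype ι] (n : ℕ) :
    ∀ (e : ι → V), IsOrthFamily B e → ∀ x : ι → F,
      (Finset.univ.filter (fun i => x i ≠ 0)).card = n →
      B (∑ i, x i • e i) (∑ i, x i • e i) ≠ 0 →
      ∃ e' : ι → V, IsOrthFamily B e' ∧
        Submodule.span F (Set.range e') = Submodule.span F (Set.range e) ∧
        ∑ i, ψ (B (e' i) (e' i)) = ∑ i, ψ (B (e i) (e i)) ∧ ∃ i, e' i = ∑ i, x i • e i := by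
  induction n using Nat.strong_induction_on with
  | _ n ih =>
  intro e he x hn hw
  set s := Finset.univ.filter (fun i => x i ≠ 0) with hs
  have hmem : ∀ i, i ∈ s ↔ x i ≠ 0 := fun i => by simp [hs]
  have hsum : ∑ i, x i • e i = ∑ i ∈ s, x i • e i := by
    refine (Finset.sum_subset (Finset.subset_univ _) fun i _ hi => ?_).symm
    rw [hmem, not_not] at hi
    rw [hi, zero_smul]
  have hQ : ∑ i ∈ s, B (e i) (e i) * (x i * x i) ≠ 0 := by
    rw [he.apply_sum_self] at hw
    rwa [Finset.sum_subset (Finset.subset_univ s) fun i _ hi => ?_]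
    rw [hmem, not_not] at hi
    rw [hi]; ring
  have hsub : ∀ k, e k ∈ Submodule.span F (Set.range e) :=
    fun k => Submodule.subset_span ⟨k, rfl⟩
  rcases Nat.lt_or_ge 1 s.card with hcard | hcard
  · obtain ⟨i, hi, j, hj, hij, hne⟩ := exists_pair_ne_zero h2 s
      (fun i => B (e i) (e i) * (x i * x i))
      (fun i hi => mul_ne_zero (he.2 i) (mul_self_ne_zero.mpr ((hmem i).mp hi))) hQ hcard
    set a := B (e i) (e i) with ha
    set b := B (e j) (e j) with hb
    rw [hmem] at hi hj
    have ha0 : a ≠ 0 := he.2 i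
    have hb0 : b ≠ 0 := he.2 j
    set p : V := x i • e i + x j • e j with hp
    -- Orthogonal to p in the plane of e_i and e_j, with B(q,q) = ab·B(p,p); this is the second
    -- value in the binary relation for ψ.
    set q : V := (x j * b) • e i - (x i * a) • e j with hq
    have hpp : B p p = a * (x i * x i) + b * (x j * x j) := by
      simp [hp, he.1 i j hij, he.1 j i hij.symm, ← ha, ← hb]; ring
    have hpq : B p q = 0 := by
      simp [hp, hq, he.1 i j hij, he.1 j i hij.symm, ← ha, ← hb]; ring
    have hqq : B q q = a * b * (a * (x i * x i) + b * (x j * x j)) := by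
      simp [hq, he.1 i j hij, he.1 j i hij.symm, ← ha, ← hb]; ring
    set e₁ : ι → V := Function.update (Function.update e i p) j q with he₁
    have e₁j : e₁ j = q := by simp [he₁]
    have e₁i : e₁ i = p := by simp [he₁, hij]
    have e₁k : ∀ k, k ≠ i → k ≠ j → e₁ k = e k := fun k h1 h2 => by simp [he₁, h1, h2]
    have hkp : ∀ k, k ≠ i → k ≠ j → B (e k) p = 0 := fun k h1 h2 => by
      simp [hp, he.1 k i h1, he.1 k j h2]
    have hkq : ∀ k, k ≠ i → k ≠ j → B (e k) q = 0 := fun k h1 h2 => by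
      simp [hq, he.1 k i h1, he.1 k j h2]
    have horth : IsOrthFamily B e₁ := by
      constructor
      · intro k l hkl
        rcases eq_or_ne k i with rfl | hki
        · rcases eq_or_ne l j with rfl | hlj
          · rw [e₁i, e₁j, hpq]
          · rw [e₁i, e₁k l hkl.symm hlj, hB.eq, hkp l hkl.symm hlj]
        · rcases eq_or_ne k j with rfl | hkj
          · rcases eq_or_ne l i with rfl | hli
            · rw [e₁i, e₁j, hB.eq, hpq]
            · rw [e₁j, e₁k l hli hkl.symm, hB.eq, hkq l hli hkl.symm]
          · rcases eq_or_ne l i with rfl | hli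
            · rw [e₁i, e₁k k hki hkj, hkp k hki hkj]
            · rcases eq_or_ne l j with rfl | hlj
              · rw [e₁j, e₁k k hki hkj, hkq k hki hkj]
              · rw [e₁k k hki hkj, e₁k l hli hlj, he.1 k l hkl]
      · intro k
        rcases eq_or_ne k i with rfl | hki
        · rw [e₁i, hpp]; exact hne
        · rcases eq_or_ne k j with rfl | hkj
          · rw [e₁j, hqq]; exact mul_ne_zero (mul_ne_zero ha0 hb0) hne
          · rw [e₁k k hki hkj]; exact he.2 k
    have hspan : Submodule.span F (Set.range e₁) = Submodule.span F (Set.range e) := by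
      apply le_antisymm
      · rw [Submodule.span_le]
        rintro _ ⟨k, rfl⟩
        rcases eq_or_ne k i with rfl | hki
        · rw [e₁i]
          exact add_mem (Submodule.smul_mem _ _ (hsub _)) (Submodule.smul_mem _ _ (hsub _))
        · rcases eq_or_ne k j with rfl | hkj
          · rw [e₁j]
            exact sub_mem (Submodule.smul_mem _ _ (hsub _)) (Submodule.smul_mem _ _ (hsub _))
          · rw [e₁k k hki hkj]; exact hsub k
      · have hsub₁ : ∀ k, e₁ k ∈ Submodule.span F (Set.range e₁) :=
          fun k => Submodule.subset_span ⟨k, rfl⟩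
        have hpm := hsub₁ i
        have hqm := hsub₁ j
        rw [e₁i] at hpm
        rw [e₁j] at hqm
        rw [Submodule.span_le]
        rintro _ ⟨k, rfl⟩
        rcases eq_or_ne k i with rfl | hki
        -- The inverse change of basis in the plane; B(p,p) is the denominator and is nonzero by the
        -- choice of the pair.
        · have : e k = (a * (x k * x k) + b * (x j * x j))⁻¹ • ((x k * a) • p + x j • q) := by
            rw [eq_inv_smul_iff₀ hne, hp, hq]; module
          rw [this]
          exact Submodule.smul_mem _ _ (add_mem (Submodule.smul_mem _ _ hpm)
            (Submodule.smul_mem _ _ hqm))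
        · rcases eq_or_ne k j with rfl | hkj
          · have : e k = (a * (x i * x i) + b * (x k * x k))⁻¹ • ((x k * b) • p - x i • q) := by
              rw [eq_inv_smul_iff₀ hne, hp, hq]; module
            rw [this]
            exact Submodule.smul_mem _ _ (sub_mem (Submodule.smul_mem _ _ hpm)
              (Submodule.smul_mem _ _ hqm))
          · rw [← e₁k k hki hkj]; exact hsub₁ k
    have hrest : ∀ k ∈ (Finset.univ.erase i).erase j, k ≠ i ∧ k ≠ j := fun k hk => by
      simp only [Finset.mem_erase] at hk
      exact ⟨hk.2.1, hk.1⟩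
    have hψsum : ∑ k, ψ (B (e₁ k) (e₁ k)) = ∑ k, ψ (B (e k) (e k)) := by
      rw [sum_eq_pair_add hij fun k => ψ (B (e₁ k) (e₁ k)),
        sum_eq_pair_add hij fun k => ψ (B (e k) (e k)), e₁i, e₁j, hpp, hqq,
        ← hψ.add_eq ha0 hb0 hi hj hne]
      congr 1
      refine Finset.sum_congr rfl fun k hk => ?_
      rw [e₁k k (hrest k hk).1 (hrest k hk).2]
    -- In the new family the vector has coordinate 1 on p and 0 on q, so j leaves the support.
    set y : ι → F := Function.update (Function.update x i 1) j 0 with hy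
    have yj : y j = 0 := by simp [hy]
    have yi : y i = 1 := by simp [hy, hij]
    have yk : ∀ k, k ≠ i → k ≠ j → y k = x k := fun k h1 h2 => by simp [hy, h1, h2]
    have hysum : ∑ k, y k • e₁ k = ∑ k, x k • e k := by
      rw [sum_eq_pair_add hij fun k => y k • e₁ k, sum_eq_pair_add hij fun k => x k • e k, yi, yj, e₁i, one_smul, zero_smul,
        add_zero, hp]
      congr 1
      refine Finset.sum_congr rfl fun k hk => ?_
      rw [e₁k k (hrest k hk).1 (hrest k hk).2, yk k (hrest k hk).1 (hrest k hk).2]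
    have hlt : (Finset.univ.filter (fun k => y k ≠ 0)).card < n := by
      rw [← hn]
      apply Finset.card_lt_card
      rw [Finset.ssubset_iff_of_subset]
      · exact ⟨j, (hmem j).mpr hj, by simp [yj]⟩
      · intro k hk
        rw [hmem]
        simp only [Finset.mem_filter, Finset.mem_univ, true_and] at hk
        rcases eq_or_ne k i with rfl | hki
        · exact hi
        · rcases eq_or_ne k j with rfl | hkj
          · exact absurd yj hk
          · rwa [yk k hki hkj] at hk
    obtain ⟨e', h1, h3, h4, h5⟩ := ih _ hlt e₁ horth y rfl (by rw [hysum]; exact hw)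
    exact ⟨e', h1, h3.trans hspan, h4.trans hψsum, by rwa [hysum] at h5⟩
  · have hs1 : s.card = 1 := by
      have : s.card ≠ 0 := fun h => by
        rw [Finset.card_eq_zero] at h
        rw [h] at hQ
        simp at hQ
      omega
    obtain ⟨i, hi⟩ := Finset.card_eq_one.mp hs1
    have hxi : x i ≠ 0 := (hmem i).mp (by simp [hi])
    rw [hi, Finset.sum_singleton] at hsum
    -- With a single nonzero coordinate, it suffices to rescale one member; values change by
    -- squares, which ψ ignores.
    have hsm : ∀ k, ∃ c : F, c ≠ 0 ∧ Function.update e i (x i • e i) k = c • e k := by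
      intro k
      rcases eq_or_ne k i with rfl | hk
      · exact ⟨x k, hxi, by simp⟩
      · exact ⟨1, one_ne_zero, by simp [hk]⟩
    choose c hc0 hc using hsm
    refine ⟨fun k => c k • e k, ⟨fun k l hkl => ?_, fun k => ?_⟩, ?_, ?_, i, ?_⟩
    · simp [he.1 k l hkl]
    · simp [he.2 k, hc0 k]
    · apply le_antisymm <;> rw [Submodule.span_le] <;> rintro _ ⟨k, rfl⟩
      · exact Submodule.smul_mem _ _ (hsub k)
      · have : e k = (c k)⁻¹ • (c k • e k) := by rw [inv_smul_smul₀ (hc0 k)]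
        rw [SetLike.mem_coe, this]
        exact Submodule.smul_mem _ _ (Submodule.subset_span ⟨k, rfl⟩)
    · refine Finset.sum_congr rfl fun k _ => ?_
      rw [← hψ.sq (B (e k) (e k)) (c k) (he.2 k) (hc0 k)]
      congr 1
      simp
      ring
    · rw [hsum]
      simpa using (hc i).symm

/-- The span of the tail is the orthogonal complement of e_0 in the whole span. It therefore depends
only on that span and on e_0, which stands in for Witt cancellation in the induction on dimension.
-/
theorem IsOrthFamily.mem_span_tail_iff {n : ℕ} {e : Fin (n + 1) → V} (he : IsOrthFamily B e)
    (v : V) : v ∈ Submodule.span F (Set.range (Fin.tail e)) ↔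
      v ∈ Submodule.span F (Set.range e) ∧ B (e 0) v = 0 := by
  have htail : ∀ z ∈ Submodule.span F (Set.range (Fin.tail e)), B (e 0) z = 0 := by
    intro z hz
    induction hz using Submodule.span_induction with
    | mem z hz =>
      obtain ⟨k, rfl⟩ := hz
      exact he.1 0 k.succ (Fin.succ_ne_zero k).symm
    | zero => simp
    | add y z _ _ h h' => rw [map_add, h, h', add_zero]
    | smul a z _ h => rw [map_smul, h, smul_zero]
  have hrange : Set.range e = insert (e 0) (Set.range (Fin.tail e)) := by
    conv_lhs => rw [← Fin.cons_self_tail e]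
    rw [Fin.range_cons]
  constructor
  · exact fun h => ⟨Submodule.span_mono (by rw [hrange]; exact Set.subset_insert _ _) h, htail v h⟩
  · rintro ⟨h, h0⟩
    rw [hrange, Submodule.mem_span_insert] at h
    obtain ⟨a, z, hz, rfl⟩ := h
    rw [map_add, htail z hz, map_smul, smul_eq_mul, add_zero] at h0
    rw [(mul_eq_zero.mp h0).resolve_right (he.2 0), zero_smul, zero_add]
    exact hz

theorem IsOrthFamily.comp {ι κ : Type*} {e : ι → V} (he : IsOrthFamily B e) (f : κ → ι)
    (hf : Function.Injective f) : IsOrthFamily B (e ∘ f) :=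
  ⟨fun _ _ h => he.1 _ _ (hf.ne h), fun _ => he.2 _⟩

/-- The vector f_0 is anisotropic, so e can be altered without changing the sum until it contains
f_0. Both tails then span the complement of f_0, and induction applies. -/
theorem IsOrthFamily.sum_eq (h2 : (2 : F) ≠ 0) (hB : B.IsSymm) (hψ : IsWittAdditive ψ) {n : ℕ} :
    ∀ {e f : Fin n → V}, IsOrthFamily B e → IsOrthFamily B f →
      Submodule.span F (Set.range e) = Submodule.span F (Set.range f) →
      ∑ i, ψ (B (e i) (e i)) = ∑ i, ψ (B (f i) (f i)) := by
  induction n with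
  | zero => intros; simp
  | succ n ih =>
    intro e f he hf hspan
    have hf0 : f 0 ∈ Submodule.span F (Set.range e) := by
      rw [hspan]; exact Submodule.subset_span ⟨0, rfl⟩
    rw [Submodule.mem_span_range_iff_exists_fun] at hf0
    obtain ⟨x, hx⟩ := hf0
    obtain ⟨e', h1, h3, h4, i, h5⟩ := IsOrthFamily.exists_mem_replace h2 hB hψ _ e he x rfl
      (by rw [hx]; exact hf.2 0)
    set g := e' ∘ Equiv.swap 0 i with hg
    have hg1 : IsOrthFamily B g := h1.comp _ (Equiv.injective _)
    have hg2 : Submodule.span F (Set.range g) = Submodule.span F (Set.range f) := by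
      rw [hg, EquivLike.range_comp, h3, hspan]
    -- The transposition only moves the shared vector to index 0, so that the two tails can be
    -- compared.
    have hg0 : g 0 = f 0 := by simp [hg, h5, hx]
    have hg3 : ∑ i, ψ (B (g i) (g i)) = ∑ i, ψ (B (e i) (e i)) := by
      rw [← h4]
      exact Equiv.sum_comp (Equiv.swap 0 i) fun i => ψ (B (e' i) (e' i))
    rw [← hg3, Fin.sum_univ_succ, Fin.sum_univ_succ, hg0]
    congr 1
    refine ih (hg1.comp Fin.succ (Fin.succ_injective n)) (hf.comp Fin.succ (Fin.succ_injective n)) ?_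
    ext v
    refine (hg1.mem_span_tail_iff v).trans (Iff.trans ?_ (hf.mem_span_tail_iff v).symm)
    rw [hg2, hg0]

end orthogonal_families

/-! ### Diagonalization and the invariant it defines on forms. -/

namespace SymForm

variable {F A : Type*} [Field F] [AddCommGroup A] {ψ : F → A}

section MatIsom

variable {m n m' n' : Type*} [Fintype m] [Fintype n] [Fintype m'] [Fintype n']
  [DecidableEq m] [DecidableEq n] [DecidableEq m'] [DecidableEq n']

/-- An isometry of diagonal forms amounts to two orthogonal bases of one space, the standard basis
and the columns of P, so the invariance for orthogonal families applies. -/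
theorem MatIsom.diagonal_sum_eq (h2 : (2 : F) ≠ 0) (hψ : IsWittAdditive ψ) {d : m → F} {d' : n → F}
    (hd : ∀ i, d i ≠ 0) (hd' : ∀ i, d' i ≠ 0)
    (h : MatIsom (Matrix.diagonal d) (Matrix.diagonal d')) :
    ∑ i, ψ (d i) = ∑ i, ψ (d' i) := by
  obtain ⟨P, Q, h1, h3, h4⟩ := h
  have hcard : Fintype.card m = Fintype.card n := Matrix.square_of_invertible P Q h1 h3
  set a := Fintype.equivFin m
  set b := (Fintype.equivFin n).trans (finCongr hcard.symm)
  set B := Matrix.toBilin' (Matrix.diagonal d)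
  set f : n → m → F := fun k i => P i k
  have hB : B.IsSymm := ⟨fun x y => by
    simp only [B, Matrix.toBilin'_apply', Matrix.mulVec_diagonal, dotProduct]
    exact Finset.sum_congr rfl fun i _ => by ring⟩
  have hBe : ∀ i j, B (Pi.single i 1) (Pi.single j 1) = Matrix.diagonal d i j := fun i j =>
    Matrix.toBilin'_single _ i j
  have hBf : ∀ i j, B (f i) (f j) = Matrix.diagonal d' i j := fun i j => by
    rw [← h4, Matrix.mul_assoc, Matrix.toBilin'_apply']
    rfl
  have he : IsOrthFamily B fun i => (Pi.single i 1 : m → F) :=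
    ⟨fun i j hij => by rw [hBe, Matrix.diagonal_apply_ne _ hij],
      fun i => by rw [hBe, Matrix.diagonal_apply_eq]; exact hd i⟩
  have hf : IsOrthFamily B f :=
    ⟨fun i j hij => by rw [hBf, Matrix.diagonal_apply_ne _ hij],
      fun i => by rw [hBf, Matrix.diagonal_apply_eq]; exact hd' i⟩
  have hes : Submodule.span F (Set.range fun i => (Pi.single i 1 : m → F)) = ⊤ := by
    convert (Pi.basisFun F m).span_eq
    simp
  have hfs : Submodule.span F (Set.range f) = ⊤ := by
    rw [eq_top_iff]
    intro v _
    rw [Submodule.mem_span_range_iff_exists_fun]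
    refine ⟨Q.mulVec v, ?_⟩
    calc ∑ i, Q.mulVec v i • f i = P.mulVec (Q.mulVec v) := by
          ext k
          simp [f, Matrix.mulVec, dotProduct, mul_comm]
      _ = v := by rw [Matrix.mulVec_mulVec, h1, Matrix.one_mulVec]
  have key := IsOrthFamily.sum_eq h2 hB hψ (he.comp a.symm a.symm.injective)
    (hf.comp b.symm b.symm.injective) (by
      rw [EquivLike.range_comp (f := fun i => (Pi.single i 1 : m → F)), EquivLike.range_comp, hes, hfs])
  calc ∑ i, ψ (d i) = ∑ i, ψ (d (a.symm i)) := (Equiv.sum_comp a.symm fun i => ψ (d i)).symm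
    _ = ∑ i, ψ (d' (b.symm i)) := by simpa [hBe, hBf] using key
    _ = ∑ i, ψ (d' i) := Equiv.sum_comp b.symm fun i => ψ (d' i)

theorem exists_diagonal (h2 : (2 : F) ≠ 0) {A : Matrix m m F} (hA : A.IsSymm)
    (hdet : IsUnit A.det) :
    ∃ (k : ℕ) (d : Fin k → F), (∀ i, d i ≠ 0) ∧ MatIsom A (Matrix.diagonal d) := by
  have := invertibleOfNonzero h2
  have hB : (Matrix.toBilin' A).IsSymm := ⟨fun x y => by
    rw [Matrix.toBilin'_apply', Matrix.toBilin'_apply', dotProduct_comm, ← Matrix.vecMul_transpose,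
      hA.eq, Matrix.dotProduct_mulVec]⟩
  obtain ⟨v, hv⟩ := LinearMap.BilinForm.exists_orthogonal_basis (LinearMap.BilinForm.isSymm_iff.mp hB)
  have hnd : (Matrix.toBilin' A).Nondegenerate :=
    (Matrix.nondegenerate_of_det_ne_zero hdet.ne_zero).toBilin'
  refine ⟨_, fun i => Matrix.toBilin' A (v i) (v i),
    LinearMap.BilinForm.iIsOrtho.not_isOrtho_basis_self_of_nondegenerate hv hnd,
    (Pi.basisFun F m).toMatrix v, v.toMatrix (Pi.basisFun F m),
    Module.Basis.toMatrix_mul_toMatrix_flip _ _, Module.Basis.toMatrix_mul_toMatrix_flip _ _, ?_⟩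
  ext i j
  have : ((((Pi.basisFun F m).toMatrix v).transpose * A * (Pi.basisFun F m).toMatrix v) i j) =
      Matrix.toBilin' A (v i) (v j) := by
    rw [Matrix.mul_assoc, Matrix.toBilin'_apply']
    rfl
  rw [this]
  rcases eq_or_ne i j with rfl | hij
  · rw [Matrix.diagonal_apply_eq]
  · rw [Matrix.diagonal_apply_ne _ hij]
    exact hv hij

theorem MatIsom.fromBlocks {A : Matrix m m F} {B : Matrix n n F} {A' : Matrix m' m' F}
    {B' : Matrix n' n' F} (h : MatIsom A B) (h' : MatIsom A' B') :
    MatIsom (Matrix.fromBlocks A 0 0 A') (Matrix.fromBlocks B 0 0 B') := by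
  obtain ⟨P, Q, h1, h2, rfl⟩ := h
  obtain ⟨P', Q', h1', h2', rfl⟩ := h'
  refine ⟨Matrix.fromBlocks P 0 0 P', Matrix.fromBlocks Q 0 0 Q', ?_, ?_, ?_⟩ <;>
  simp [Matrix.fromBlocks_multiply, Matrix.fromBlocks_transpose, *]

end MatIsom

variable (ψ) in
open Classical in
/-- The sum of the values of `ψ` on the entries of a diagonalization. -/
def diagSum (X : SymForm F) : A :=
  if h : ∃ (k : ℕ) (d : Fin k → F), (∀ i, d i ≠ 0) ∧ MatIsom X.gram (Matrix.diagonal d) then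
    ∑ i, ψ (h.choose_spec.choose i) else 0

theorem diagSum_eq (h2 : (2 : F) ≠ 0) (hψ : IsWittAdditive ψ) {n : Type*} [Fintype n]
    [DecidableEq n] {X : SymForm F} {d : n → F} (hd : ∀ i, d i ≠ 0)
    (h : MatIsom X.gram (Matrix.diagonal d)) : diagSum ψ X = ∑ i, ψ (d i) := by
  have hX := exists_diagonal h2 X.symm X.nondeg
  rw [diagSum, dif_pos hX]
  obtain ⟨h1, h3⟩ := hX.choose_spec.choose_spec
  exact (h3.symm.trans h).diagonal_sum_eq h2 hψ h1 hd

theorem diagSum_congr (h2 : (2 : F) ≠ 0) (hψ : IsWittAdditive ψ) {X Y : SymForm F} (h : X ≈ Y) :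
    diagSum ψ X = diagSum ψ Y := by
  obtain ⟨k, d, hd, hY⟩ := exists_diagonal h2 Y.symm Y.nondeg
  rw [diagSum_eq h2 hψ hd hY, diagSum_eq h2 hψ hd (MatIsom.trans h hY)]

theorem matIsom_oplus_diagonal {m n : Type*} [Fintype m] [Fintype n] [DecidableEq m]
    [DecidableEq n] {X Y : SymForm F} {d : m → F} {d' : n → F}
    (h : MatIsom X.gram (Matrix.diagonal d)) (h' : MatIsom Y.gram (Matrix.diagonal d')) :
    MatIsom (X.oplus Y).gram (Matrix.diagonal (Sum.elim d d')) := by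
  have := (MatIsom.of_reindex finSumFinEquiv (Matrix.fromBlocks X.gram 0 0 Y.gram)).symm.trans
    (h.fromBlocks h')
  rwa [Matrix.fromBlocks_diagonal] at this

theorem matIsom_tensor_diagonal {m n : Type*} [Fintype m] [Fintype n] [DecidableEq m]
    [DecidableEq n] {X Y : SymForm F} {d : m → F} {d' : n → F}
    (h : MatIsom X.gram (Matrix.diagonal d)) (h' : MatIsom Y.gram (Matrix.diagonal d')) :
    MatIsom (X.tensor Y).gram (Matrix.diagonal fun p : m × n => d p.1 * d' p.2) := by
  have := (MatIsom.of_reindex finProdFinEquiv (Matrix.kronecker X.gram Y.gram)).symm.trans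
    (h.kronecker h')
  rwa [Matrix.diagonal_kronecker_diagonal] at this

theorem hyperbolic_matIsom (h2 : (2 : F) ≠ 0) :
    MatIsom (hyperbolic F).gram (Matrix.diagonal ![1, -1]) := by
  change MatIsom (!![0, 1; 1, 0] : Matrix (Fin 2) (Fin 2) F) _
  -- The columns (1, 1/2) and (1, -1/2) are orthogonal for the form 2xy, with values 1 and -1.
  refine ⟨!![1, 1; 2⁻¹, -2⁻¹], !![2⁻¹, 1; 2⁻¹, -1], ?_, ?_, ?_⟩
  · ext i j; fin_cases i <;> fin_cases j <;> simp [Matrix.mul_apply] <;> field_simp <;> norm_num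
  · ext i j; fin_cases i <;> fin_cases j <;> simp [Matrix.mul_apply] <;> field_simp <;> norm_num
  · ext i j
    fin_cases i <;> fin_cases j <;> simp [Matrix.mul_apply] <;> field_simp <;> norm_num

theorem diagSum_tensor_hyperbolic (h2 : (2 : F) ≠ 0) (hψ : IsWittAdditive ψ)
    (hneg : ∀ a, a ≠ 0 → ψ a + ψ (-a) = 0) (X : SymForm F) :
    diagSum ψ (X.tensor (hyperbolic F)) = 0 := by
  obtain ⟨k, d, hd, hX⟩ := exists_diagonal h2 X.symm X.nondeg
  rw [diagSum_eq h2 hψ (d := fun p : Fin k × Fin 2 => d p.1 * ![1, -1] p.2)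
    (by rintro ⟨i, j⟩; fin_cases j <;> simp [hd])
    (matIsom_tensor_diagonal hX (hyperbolic_matIsom h2)), Fintype.sum_prod_type]
  simp [hneg _ (hd _)]

theorem diagSum_tensor_oplus (h2 : (2 : F) ≠ 0) (hψ : IsWittAdditive ψ) (X Y Z : SymForm F) :
    diagSum ψ (X.tensor (Y.oplus Z)) = diagSum ψ (X.tensor Y) + diagSum ψ (X.tensor Z) := by
  obtain ⟨k, d, hd, hX⟩ := exists_diagonal h2 X.symm X.nondeg
  obtain ⟨l, d', hd', hY⟩ := exists_diagonal h2 Y.symm Y.nondeg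
  obtain ⟨l', d'', hd'', hZ⟩ := exists_diagonal h2 Z.symm Z.nondeg
  rw [diagSum_eq h2 hψ (by rintro ⟨i, j⟩; simp [hd, hd']) (matIsom_tensor_diagonal hX hY),
    diagSum_eq h2 hψ (by rintro ⟨i, j⟩; simp [hd, hd'']) (matIsom_tensor_diagonal hX hZ),
    diagSum_eq h2 hψ (by rintro ⟨i, j | j⟩ <;> simp [hd, hd', hd''])
      (matIsom_tensor_diagonal hX (matIsom_oplus_diagonal hY hZ)), Fintype.sum_prod_type,
      Fintype.sum_prod_type, Fintype.sum_prod_type, ← Finset.sum_add_distrib]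
  simp

theorem diagSum_rankOne (h2 : (2 : F) ≠ 0) (hψ : IsWittAdditive ψ) (a : Fˣ) :
    diagSum ψ (rankOne a) = ψ a := by
  have h : MatIsom (rankOne a).gram (Matrix.diagonal fun _ : Fin 1 => (a : F)) := by
    have : (Matrix.diagonal fun _ : Fin 1 => (a : F)) = !![(a : F)] := by
      ext i j
      fin_cases i; fin_cases j; simp
    rw [this]
    exact MatIsom.refl _
  rw [diagSum_eq h2 hψ (fun _ => a.ne_zero) h]
  simp

end SymForm

/-! ### Presentation of the additive group of the Witt ring. -/

namespace WittRing

variable {F A : Type*} [Field F] [AddCommGroup A] {ψ : F → A}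

open SymForm

/-- The additive extension of `diagSum` to the monoid algebra of isometry classes. -/
def diagSumHom (h2 : (2 : F) ≠ 0) (hψ : IsWittAdditive ψ) :
    MonoidAlgebra ℤ (IsomClass F) →+ A :=
  (Finsupp.liftAddHom fun c => zmultiplesHom A
    (Quotient.lift (diagSum ψ) (fun _ _ h => diagSum_congr h2 hψ h) c)).comp
    MonoidAlgebra.coeffAddEquiv.toAddMonoidHom

theorem diagSumHom_of (h2 : (2 : F) ≠ 0) (hψ : IsWittAdditive ψ) (X : SymForm F) :
    diagSumHom h2 hψ (MonoidAlgebra.of ℤ _ (IsomClass.mk X)) = diagSum ψ X := by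
  change (MonoidAlgebra.single (IsomClass.mk X) (1 : ℤ)).coeff.sum _ = _
  rw [MonoidAlgebra.coeff_single, Finsupp.sum_single_index (by simp)]
  simp [IsomClass.mk]

theorem diagSumHom_eq_zero (h2 : (2 : F) ≠ 0) (hψ : IsWittAdditive ψ)
    (hneg : ∀ a, a ≠ 0 → ψ a + ψ (-a) = 0) {x : MonoidAlgebra ℤ (IsomClass F)}
    (hx : x ∈ Ideal.span (wittRelations F)) : diagSumHom h2 hψ x = 0 := by
  -- `diagSumHom` is only additive, so vanishing on an ideal has to be proved for all multiples of
  -- the relations. By linearity r may be taken to be the class of a form, and the tensor formulas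
  -- for `diagSum` conclude.
  suffices ∀ r, diagSumHom h2 hψ (r * x) = 0 by simpa using this 1
  induction hx using Submodule.span_induction with
  | zero => simp
  | add y z _ _ h h' => intro r; rw [mul_add, map_add, h, h', add_zero]
  | smul a y _ h => intro r; rw [smul_eq_mul, ← mul_assoc, h]
  | mem x hx =>
    intro r
    induction r using MonoidAlgebra.induction_on with
    | of c =>
      induction c using Quotient.inductionOn with
      | _ X =>
      change diagSumHom h2 hψ (MonoidAlgebra.of ℤ _ (IsomClass.mk X) * x) = 0
      rcases hx with ⟨Y, Z, rfl⟩ | rfl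
      · rw [mul_sub, mul_sub, ← map_mul, ← map_mul, ← map_mul, IsomClass.mk_mul, IsomClass.mk_mul,
          IsomClass.mk_mul, map_sub, map_sub, diagSumHom_of, diagSumHom_of, diagSumHom_of,
          diagSum_tensor_oplus h2 hψ]
        abel
      · rw [← map_mul, IsomClass.mk_mul, diagSumHom_of, diagSum_tensor_hyperbolic h2 hψ hneg]
    | add y z h h' => rw [add_mul, map_add, h, h', add_zero]
    | smul n y h => rw [smul_mul_assoc, map_zsmul, h, smul_zero]

/-- The presentation of the additive group of the Witt ring. -/
def liftAdd (h2 : (2 : F) ≠ 0) (hψ : IsWittAdditive ψ)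
    (hneg : ∀ a, a ≠ 0 → ψ a + ψ (-a) = 0) : WittRing F →+ A :=
  QuotientAddGroup.lift (Submodule.toAddSubgroup (Ideal.span (wittRelations F)))
    (diagSumHom h2 hψ) fun _ hx => diagSumHom_eq_zero h2 hψ hneg hx

theorem liftAdd_rankOne (h2 : (2 : F) ≠ 0) (hψ : IsWittAdditive ψ)
    (hneg : ∀ a, a ≠ 0 → ψ a + ψ (-a) = 0) (a : Fˣ) :
    liftAdd h2 hψ hneg (ofForm (rankOne a)) = ψ a :=
  (diagSumHom_of h2 hψ _).trans (diagSum_rankOne h2 hψ a)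

end WittRing

/-! ### Explicit isometries of diagonal forms. -/

namespace SymForm

variable {F : Type*} [Field F]

theorem MatIsom.diagonal_of_equiv {m n : Type*} [Fintype m] [Fintype n] [DecidableEq m]
    [DecidableEq n] (e : m ≃ n) {d : m → F} {d' : n → F} (h : ∀ i, d' (e i) = d i) :
    MatIsom (Matrix.diagonal d) (Matrix.diagonal d') :=
  MatIsom.of_equiv e fun i j => by simp [Matrix.diagonal_apply, h]

/-- The diagonal form `⟨d_1, …, d_n⟩`. -/
def diag {n : ℕ} (d : Fin n → Fˣ) : SymForm F where
  dim := n
  gram := Matrix.diagonal fun i => (d i : F)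
  symm := Matrix.isSymm_diagonal _
  nondeg := by
    rw [Matrix.det_diagonal, isUnit_iff_ne_zero]
    exact Finset.prod_ne_zero_iff.mpr fun i _ => (d i).ne_zero

theorem exists_diag (h2 : (2 : F) ≠ 0) (X : SymForm F) :
    ∃ (n : ℕ) (d : Fin n → Fˣ), X ≈ diag d := by
  obtain ⟨n, d, hd, h⟩ := exists_diagonal h2 X.symm X.nondeg
  exact ⟨n, fun i => Units.mk0 (d i) (hd i), h⟩

theorem rankOne_gram (a : Fˣ) : (rankOne a).gram = Matrix.diagonal fun _ : Fin 1 => (a : F) := by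
  change !![(a : F)] = _
  ext i j
  fin_cases i; fin_cases j; simp

theorem oplus_rankOne_diag {n : ℕ} (d : Fin (n + 1) → Fˣ) :
    (diag fun i : Fin n => d i.castSucc).oplus (rankOne (d (Fin.last n))) ≈ diag d := by
  refine MatIsom.trans (matIsom_oplus_diagonal (MatIsom.refl _)
    (by rw [rankOne_gram]; exact MatIsom.refl _)) (MatIsom.diagonal_of_equiv finSumFinEquiv ?_)
  rintro (i | i)
  · simp; rfl
  · fin_cases i
    simp; rfl

theorem oplus_rankOne_rankOne (a b : Fˣ) :
    MatIsom ((rankOne a).oplus (rankOne b)).gram (Matrix.diagonal ![(a : F), (b : F)]) := by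
  refine MatIsom.trans (matIsom_oplus_diagonal (d := fun _ : Fin 1 => (a : F))
    (d' := fun _ : Fin 1 => (b : F)) ?_ ?_) (MatIsom.diagonal_of_equiv finSumFinEquiv ?_)
  · rw [rankOne_gram]; exact MatIsom.refl _
  · rw [rankOne_gram]; exact MatIsom.refl _
  · rintro (i | i) <;> fin_cases i <;> rfl

theorem oplus_rankOne_of_add_eq_one (a b : Fˣ) (h : (b : F) = 1 - a) :
    (rankOne a).oplus (rankOne b) ≈ (rankOne 1).oplus (rankOne (a * b)) := by
  refine MatIsom.trans (oplus_rankOne_rankOne a b)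
    (MatIsom.trans ?_ (oplus_rankOne_rankOne 1 (a * b)).symm)
  -- The vector (1, 1) has value a + b = 1, and (b, -a) is orthogonal to it with value ab(a + b) =
  -- ab.
  refine ⟨!![1, (b : F); 1, -a], !![(a : F), b; 1, -1], ?_, ?_, ?_⟩ <;>
  · ext i j
    fin_cases i <;> fin_cases j <;> simp [Matrix.mul_apply, h] <;> ring

end SymForm

/-! ### Relations and additive generators in W, I and I². -/

namespace WittRing

variable {F : Type*} [Field F]

open SymForm

theorem ofForm_congr {X Y : SymForm F} (h : X ≈ Y) : ofForm X = ofForm Y := by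
  rw [ofForm, ofForm, IsomClass.mk, IsomClass.mk, Quotient.sound h]

theorem ofForm_oplus (X Y : SymForm F) : ofForm (X.oplus Y) = ofForm X + ofForm Y := by
  rw [← sub_eq_zero, ← sub_sub, ofForm, ofForm, ofForm, ← map_sub, ← map_sub,
    Ideal.Quotient.eq_zero_iff_mem]
  exact Ideal.subset_span (Or.inl ⟨X, Y, rfl⟩)

theorem ofForm_hyperbolic : ofForm (hyperbolic F) = 0 := by
  rw [ofForm, Ideal.Quotient.eq_zero_iff_mem]
  exact Ideal.subset_span (Or.inr rfl)

theorem ofForm_tensor (X Y : SymForm F) : ofForm (X.tensor Y) = ofForm X * ofForm Y := by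
  rw [ofForm, ofForm, ofForm, ← map_mul, ← map_mul, IsomClass.mk_mul]

theorem ofForm_rankOne_one : ofForm (rankOne (1 : Fˣ)) = 1 := by
  have : IsomClass.mk (rankOne (1 : Fˣ)) = 1 := rfl
  rw [ofForm, this, map_one, map_one]

theorem ofForm_rankOne_mul (a b : Fˣ) :
    ofForm (rankOne (a * b)) = ofForm (rankOne a) * ofForm (rankOne b) := by
  rw [← ofForm_tensor]
  refine ofForm_congr (MatIsom.symm (MatIsom.trans (matIsom_tensor_diagonal
    (d := fun _ : Fin 1 => (a : F)) (d' := fun _ : Fin 1 => (b : F)) ?_ ?_) ?_))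
  · rw [rankOne_gram]; exact MatIsom.refl _
  · rw [rankOne_gram]; exact MatIsom.refl _
  · rw [rankOne_gram]
    exact MatIsom.diagonal_of_equiv (Equiv.prodUnique (Fin 1) (Fin 1)) fun i => by simp

theorem ofForm_rankOne_neg_one (h2 : (2 : F) ≠ 0) : ofForm (rankOne (-1 : Fˣ)) = -1 := by
  rw [eq_neg_iff_add_eq_zero, add_comm, ← ofForm_rankOne_one, ← ofForm_oplus, ← ofForm_hyperbolic]
  refine ofForm_congr (MatIsom.trans (oplus_rankOne_rankOne 1 (-1)) (MatIsom.symm ?_))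
  simpa using hyperbolic_matIsom h2

theorem ofForm_steinberg (a b : Fˣ) (h : (b : F) = 1 - a) :
    ofForm (rankOne a) + ofForm (rankOne b) = 1 + ofForm (rankOne a) * ofForm (rankOne b) := by
  rw [← ofForm_oplus, ofForm_congr (oplus_rankOne_of_add_eq_one a b h), ofForm_oplus,
    ofForm_rankOne_one, ofForm_rankOne_mul]

theorem ofForm_diag_mem {n : ℕ} (d : Fin n → Fˣ) :
    ofForm (diag d) ∈ AddSubgroup.closure (Set.range fun a : Fˣ => ofForm (rankOne a)) := by
  induction n with
  | zero =>
    -- The empty form is its own double, so its class z satisfies z + z = z.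
    have h : (diag d).oplus (diag d) ≈ diag d :=
      MatIsom.of_equiv (finCongr (Nat.add_zero 0)) fun i => Fin.elim0 i
    have h1 := ofForm_congr h
    rw [ofForm_oplus, add_eq_left] at h1
    rw [h1]
    exact zero_mem _
  | succ n ih =>
    rw [← ofForm_congr (oplus_rankOne_diag d), ofForm_oplus]
    exact add_mem (ih _) (AddSubgroup.subset_closure ⟨_, rfl⟩)

theorem mem_closure_rankOne (h2 : (2 : F) ≠ 0) (x : WittRing F) :
    x ∈ AddSubgroup.closure (Set.range fun a : Fˣ => ofForm (rankOne a)) := by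
  obtain ⟨y, rfl⟩ := Ideal.Quotient.mk_surjective x
  induction y using MonoidAlgebra.induction_on with
  | of c =>
    induction c using Quotient.inductionOn with
    | _ X =>
    obtain ⟨n, d, h⟩ := exists_diag h2 X
    change ofForm X ∈ _
    rw [ofForm_congr h]
    exact ofForm_diag_mem d
  | add y z h h' => rw [map_add]; exact add_mem h h'
  | smul n y h => rw [map_zsmul]; exact zsmul_mem h n

theorem exists_sub_int_mem (h2 : (2 : F) ≠ 0) (x : WittRing F) :
    ∃ n : ℤ, x - n ∈ AddSubgroup.closure (Set.range (pfister : Fˣ → WittRing F)) := by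
  have hx := mem_closure_rankOne h2 x
  induction hx using AddSubgroup.closure_induction with
  | mem x hx =>
    obtain ⟨a, rfl⟩ := hx
    refine ⟨1, ?_⟩
    have : ofForm (rankOne a) - ((1 : ℤ) : WittRing F) = -pfister a := by
      rw [pfister, ofForm_rankOne_one]; simp
    rw [this]
    exact neg_mem (AddSubgroup.subset_closure ⟨a, rfl⟩)
  | zero => exact ⟨0, by simp [zero_mem]⟩
  | add y z _ _ h h' =>
    obtain ⟨n, hn⟩ := h
    obtain ⟨m, hm⟩ := h'
    refine ⟨n + m, ?_⟩
    convert add_mem hn hm using 1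
    push_cast
    ring
  | neg y _ h =>
    obtain ⟨n, hn⟩ := h
    refine ⟨-n, ?_⟩
    convert neg_mem hn using 1
    push_cast
    ring

/-- Every class is an integer plus a combination of forms ⟨⟨a⟩⟩. In I the integer is even, and 2 =
⟨⟨-1⟩⟩ because ⟨-1⟩ = -1 in W. -/
theorem mem_closure_pfister (h2 : (2 : F) ≠ 0) {x : WittRing F} (hx : x ∈ fundamentalIdeal F) :
    x ∈ AddSubgroup.closure (Set.range (pfister : Fˣ → WittRing F)) := by
  obtain ⟨n, hn⟩ := exists_sub_int_mem h2 x
  have hle : AddSubgroup.closure (Set.range (pfister : Fˣ → WittRing F)) ≤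
      (fundamentalIdeal F).toAddSubgroup := by
    rw [AddSubgroup.closure_le]
    rintro _ ⟨a, rfl⟩
    exact pfister_mem a
  have h : (n : WittRing F) ∈ fundamentalIdeal F := by
    simpa using sub_mem hx (hle hn)
  rw [fundamentalIdeal, RingHom.mem_ker, map_intCast, ZMod.intCast_zmod_eq_zero_iff_dvd] at h
  obtain ⟨k, rfl⟩ := h
  have h1 : (((2 : ℕ) : ℤ) * k : ℤ) = (k • pfister (-1 : Fˣ) : WittRing F) := by
    rw [pfister, ofForm_rankOne_one, ofForm_rankOne_neg_one h2, zsmul_eq_mul]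
    push_cast
    ring
  rw [h1] at hn
  simpa using add_mem hn (zsmul_mem (AddSubgroup.subset_closure (Set.mem_range_self (-1))) k)

theorem mem_closure_pfister_mul_pfister (h2 : (2 : F) ≠ 0) {x : WittRing F}
    (hx : x ∈ fundamentalIdeal F ^ 2) :
    x ∈ AddSubgroup.closure {z : WittRing F | ∃ a b : Fˣ, z = pfister a * pfister b} := by
  rw [pow_two] at hx
  induction hx using Submodule.mul_induction_on' with
  | mem_mul_mem y hy z hz =>
    have h1 : ∀ a : Fˣ, AddSubgroup.closure (Set.range (pfister : Fˣ → WittRing F)) ≤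
        (AddSubgroup.closure {z : WittRing F | ∃ a b : Fˣ, z = pfister a * pfister b}).comap
          (AddMonoidHom.mulLeft (pfister a)) := fun a => by
      rw [AddSubgroup.closure_le]
      rintro _ ⟨b, rfl⟩
      exact AddSubgroup.subset_closure ⟨a, b, rfl⟩
    have h3 : AddSubgroup.closure (Set.range (pfister : Fˣ → WittRing F)) ≤
        (AddSubgroup.closure {z : WittRing F | ∃ a b : Fˣ, z = pfister a * pfister b}).comap
          (AddMonoidHom.mulRight z) := by
      rw [AddSubgroup.closure_le]
      rintro _ ⟨a, rfl⟩
      exact h1 a (mem_closure_pfister h2 hz)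
    exact h3 (mem_closure_pfister h2 hy)
  | add y _ z _ h h' => exact add_mem h h'

end WittRing

/-! ### The isomorphism between ηK_2^MW and I². -/

namespace KMW

open WittRing SymForm

variable {F : Type*} [Field F]

/-- The ring homomorphism `K_*^MW(F) → W(F)` that sends `η` to `1` and `[a]` to `⟨a⟩ - 1`. -/
def toWitt (h2 : (2 : F) ≠ 0) : KMW F →+* WittRing F :=
  lift 1 (fun a => ofForm (rankOne a) - 1)
    (fun a b h => by linear_combination -ofForm_steinberg a b h)
    (fun a b => by rw [ofForm_rankOne_mul]; ring)
    (fun a => by ring)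
    (by rw [ofForm_rankOne_neg_one h2]; ring)

theorem toWitt_eta (h2 : (2 : F) ≠ 0) : toWitt h2 eta = 1 := lift_eta _ _ _ _ _ _

theorem toWitt_sym (h2 : (2 : F) ≠ 0) (a : Fˣ) :
    toWitt h2 (sym a) = ofForm (rankOne a) - 1 := lift_sym _ _ _ _ _ _ a

theorem toWitt_eta_sym_sym (h2 : (2 : F) ≠ 0) (a b : Fˣ) :
    toWitt h2 (eta * sym a * sym b) = pfister a * pfister b := by
  rw [map_mul, map_mul, toWitt_eta, toWitt_sym, toWitt_sym, pfister, pfister, ofForm_rankOne_one]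
  ring

/-- The subgroup of `K_1^MW(F) ⊕ ℤ` generated by `h K_1^MW(F)` and `([-1], 2)`. -/
def wittKernel (F : Type*) [Field F] : AddSubgroup (KMW F × ℤ) where
  carrier := {p | ∃ y ∈ graded F 1, ∃ n : ℤ, p = (hyp * y + n • sym (-1), 2 * n)}
  zero_mem' := ⟨0, zero_mem _, 0, Prod.ext (by simp) (by simp)⟩
  add_mem' := by
    rintro _ _ ⟨y, hy, n, rfl⟩ ⟨z, hz, m, rfl⟩
    exact ⟨y + z, add_mem hy hz, n + m, Prod.ext (by simp [mul_add, add_smul]; abel) (by simp; ring)⟩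
  neg_mem' := by
    rintro _ ⟨y, hy, n, rfl⟩
    exact ⟨-y, neg_mem hy, -n, Prod.ext (by simp; abel) (by simp)⟩

theorem hyp_commute_angle (a : Fˣ) : (angle a * hyp : KMW F) = hyp * angle a := by
  rw [hyp, mul_add, add_mul, angle_comm_angle, mul_one, one_mul]

open Classical in
/-- The class of `([a], 1)` modulo `wittKernel`. -/
def symClass (a : F) : (KMW F × ℤ) ⧸ wittKernel F :=
  if h : a ≠ 0 then QuotientAddGroup.mk (sym (Units.mk0 a h), 1) else 0

theorem symClass_units (a : Fˣ) :
    symClass (a : F) = (QuotientAddGroup.mk (sym a, 1) : (KMW F × ℤ) ⧸ wittKernel F) := by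
  rw [symClass, dif_pos a.ne_zero, Units.mk0_val]

/-- The difference [ab²] - [a] = ⟨a⟩[b²] = h⟨a⟩[b] is h times an element of degree one; this
accounts for the part hK_1 of `wittKernel`. -/
theorem mk_sym_mul_sq (a b : Fˣ) : (QuotientAddGroup.mk (sym (a * (b * b)), 1) :
    (KMW F × ℤ) ⧸ wittKernel F) = QuotientAddGroup.mk (sym a, 1) := by
  rw [eq_comm, QuotientAddGroup.eq]
  refine ⟨angle a * sym b, by simpa using mul_mem (angle_mem a) (sym_mem b), 0, Prod.ext ?_ (by simp)⟩
  simp only [Prod.fst_add, Prod.fst_neg, zero_smul, add_zero]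
  rw [sym_mul' a, sym_mul_self, ← mul_assoc, ← mul_assoc, hyp_commute_angle, neg_add_cancel_left]

theorem isWittAdditive_symClass : IsWittAdditive (symClass : F → (KMW F × ℤ) ⧸ wittKernel F) where
  sq a b ha hb := by
    lift a to Fˣ using isUnit_iff_ne_zero.mpr ha
    lift b to Fˣ using isUnit_iff_ne_zero.mpr hb
    rw [← Units.val_mul, ← Units.val_mul, symClass_units, symClass_units, mk_sym_mul_sq]
  add a b ha hb hab := by
    lift a to Fˣ using isUnit_iff_ne_zero.mpr ha
    lift b to Fˣ using isUnit_iff_ne_zero.mpr hb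
    -- Dividing by c = a + b reduces to s + t = 1. Steinberg then gives [cs] + [ct] = [c] + [cst],
    -- and ab(a + b) = cst·c² lies in the square class of cst.
    obtain ⟨c, hc⟩ := isUnit_iff_ne_zero.mpr hab
    obtain ⟨s, rfl⟩ : ∃ s, a = c * s := ⟨c⁻¹ * a, by simp⟩
    obtain ⟨t, rfl⟩ : ∃ t, b = c * t := ⟨c⁻¹ * b, by simp⟩
    have hst : (t : F) = 1 - s := by
      apply mul_left_cancel₀ c.ne_zero
      push_cast at hc
      linear_combination -hc
    have h1 : (sym (c * s) + sym (c * t) : KMW F) = sym c + sym (c * (s * t)) := by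
      rw [sym_mul' c s, sym_mul' c t, sym_mul' c (s * t), sym_mul s t, mul_assoc eta,
        steinberg s t hst, mul_zero, add_zero, mul_add]
      abel
    have h3 : c * s * (c * t) * c = c * (s * t) * (c * c) := by
      simp only [mul_comm, mul_left_comm]
    rw [← hc, ← Units.val_mul, ← Units.val_mul, symClass_units, symClass_units, symClass_units,
      symClass_units, h3, mk_sym_mul_sq, ← QuotientAddGroup.mk_add, ← QuotientAddGroup.mk_add,
      Prod.mk_add_mk, Prod.mk_add_mk, h1]

/-- Since [a][-a] = 0, the sum [a] + [-a] is [-a²] = [-1] + h[a]. This accounts for the generator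
([-1], 2) of `wittKernel`. -/
theorem symClass_add_neg (a : F) (ha : a ≠ 0) : symClass a + symClass (-a) = 0 := by
  lift a to Fˣ using isUnit_iff_ne_zero.mpr ha
  have h : (sym a + sym (-a) : KMW F) = sym (-1) + angle (-1) * (hyp * sym a) := by
    rw [← sym_mul_self, ← sym_mul', show -1 * (a * a) = a * -a by simp, sym_mul, mul_assoc eta,
      sym_sym_neg, mul_zero, add_zero]
  rw [← Units.val_neg, symClass_units, symClass_units, ← QuotientAddGroup.mk_add,
    QuotientAddGroup.eq_zero_iff]
  refine ⟨sym a, sym_mem a, 1, Prod.ext ?_ (by simp)⟩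
  simp only [Prod.fst_add, one_smul]
  rw [h, ← mul_assoc, angle_hyp, add_comm]

/-- On a generator, ⟨a⟩ - ⟨1⟩ goes to ([a], 1) - ([1], 1) = ([a], 0). So an element of K_1 is
recovered from its Witt class modulo `wittKernel`. -/
theorem liftAdd_toWitt (h2 : (2 : F) ≠ 0) {x : KMW F} (hx : x ∈ graded F 1) :
    liftAdd h2 isWittAdditive_symClass symClass_add_neg (toWitt h2 x) =
      (QuotientAddGroup.mk (x, 0) : (KMW F × ℤ) ⧸ wittKernel F) := by
  rw [graded_one_eq] at hx
  induction hx using AddSubgroup.closure_induction with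
  | mem x hx =>
    obtain ⟨a, rfl⟩ := hx
    rw [toWitt_sym, ← ofForm_rankOne_one, map_sub, liftAdd_rankOne, liftAdd_rankOne,
      symClass_units, symClass_units, sym_one, ← QuotientAddGroup.mk_sub, Prod.mk_sub_mk, sub_zero,
      sub_self]
  | zero => rw [map_zero, map_zero]; rfl
  | add y z _ _ h h' =>
    rw [map_add, map_add, h, h', ← QuotientAddGroup.mk_add, Prod.mk_add_mk, add_zero]
  | neg y _ h => rw [map_neg, map_neg, h, ← QuotientAddGroup.mk_neg, Prod.neg_mk, neg_zero]

/-- The pair (x, 0) lies in `wittKernel`. The integer coordinate forces n = 0, so x = hy, and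
`hyp_mul_eq_zero` finishes. -/
theorem eq_zero_of_toWitt_eq_zero (h2 : (2 : F) ≠ 0) {x : KMW F} (hx : x ∈ etaSub F)
    (h : toWitt h2 x = 0) : x = 0 := by
  have h1 := liftAdd_toWitt h2 (etaSub_le hx)
  rw [h, map_zero, eq_comm, QuotientAddGroup.eq_zero_iff] at h1
  obtain ⟨y, hy, n, hn⟩ := h1
  have hn0 : n = 0 := by
    have := congrArg Prod.snd hn
    simpa using this
  have hxy : x = hyp * y := by simpa [hn0] using congrArg Prod.fst hn
  rw [hxy] at hx ⊢
  exact hyp_mul_eq_zero hy hx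

theorem map_toWitt_etaSub (h2 : (2 : F) ≠ 0) :
    (etaSub F).map (toWitt h2).toAddMonoidHom = (fundamentalIdeal F ^ 2).toAddSubgroup := by
  apply le_antisymm
  · rw [etaSub, AddMonoidHom.map_closure, AddSubgroup.closure_le]
    rintro _ ⟨_, ⟨a, b, rfl⟩, rfl⟩
    change toWitt h2 _ ∈ fundamentalIdeal F ^ 2
    rw [toWitt_eta_sym_sym, pow_two]
    exact Ideal.mul_mem_mul (pfister_mem a) (pfister_mem b)
  · intro x hx
    have := mem_closure_pfister_mul_pfister h2 hx
    refine (AddSubgroup.closure_le _).mpr ?_ this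
    rintro _ ⟨a, b, rfl⟩
    exact ⟨_, eta_sym_sym_mem a b, toWitt_eta_sym_sym h2 a b⟩

/-- The homomorphism `η K_2^MW(F) → I²(F)`. -/
def etaSubToWitt (h2 : (2 : F) ≠ 0) :
    etaSub F →+ (fundamentalIdeal F ^ 2 : Ideal (WittRing F)) where
  toFun x := ⟨toWitt h2 x, by
    change toWitt h2 x ∈ (fundamentalIdeal F ^ 2).toAddSubgroup
    rw [← map_toWitt_etaSub h2]; exact ⟨x, x.2, rfl⟩⟩
  map_zero' := Subtype.ext (by simp)
  map_add' x y := Subtype.ext (by simp)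

/-- The isomorphism `η K_2^MW(F) ≅ I²(F)`. -/
def etaSubEquiv (h2 : (2 : F) ≠ 0) :
    etaSub F ≃+ (fundamentalIdeal F ^ 2 : Ideal (WittRing F)) :=
  AddEquiv.ofBijective (etaSubToWitt h2) (by
    constructor
    · rw [injective_iff_map_eq_zero]
      intro x hx
      exact Subtype.ext (eq_zero_of_toWitt_eq_zero h2 x.2 (congrArg Subtype.val hx))
    · rintro ⟨x, hx⟩
      have hx' : x ∈ (fundamentalIdeal F ^ 2).toAddSubgroup := hx
      rw [← map_toWitt_etaSub h2] at hx'
      obtain ⟨y, hy, rfl⟩ := hx'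
      exact ⟨⟨y, hy⟩, rfl⟩)

theorem etaSubEquiv_symm_pfisterTwo (h2 : (2 : F) ≠ 0) (a b : Fˣ) :
    ((etaSubEquiv h2).symm (pfisterTwo a b) : KMW F) = eta * sym a * sym b := by
  have : (etaSubEquiv h2).symm (pfisterTwo a b) = ⟨_, eta_sym_sym_mem a b⟩ := by
    rw [AddEquiv.symm_apply_eq]
    refine Subtype.ext ?_
    change pfister a * pfister b = toWitt h2 (eta * sym a * sym b)
    rw [toWitt_eta_sym_sym]
  rw [this]

end KMW

namespace KMW

open IsLocalRing MWVal

/-! ### Harmlessness of the twist by a line. -/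

section twist

variable {k V : Type*} [Field k] [AddCommGroup V] [Module k V]

/-- The nonzero vectors of a line form a torsor under `k^×`. -/
def NonzeroVec.unitsEquiv (hV : Module.finrank k V = 1) (v : NonzeroVec k V) :
    kˣ ≃ NonzeroVec k V :=
  Equiv.ofBijective (fun u => u • v) (by
    constructor
    · intro u w h
      have h1 : (u : k) • v.1 = (w : k) • v.1 := congrArg Subtype.val h
      exact Units.ext (smul_left_injective k v.2 h1)
    · intro w
      obtain ⟨c, hc⟩ := (finrank_eq_one_iff_of_nonzero' v.1 v.2).mp hV w.1
      have hc0 : c ≠ 0 := fun h => w.2 (by rw [← hc, h, zero_smul])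
      exact ⟨Units.mk0 c hc0, Subtype.ext hc⟩)

/-- The generator `v` of the permutation module of the nonzero vectors. -/
def NonzeroVec.toModule (v : NonzeroVec k V) :
    (Representation.ofMulAction ℤ kˣ (NonzeroVec k V)).asModule :=
  (Representation.ofMulAction ℤ kˣ (NonzeroVec k V)).asModuleEquiv.symm (MonoidAlgebra.single v 1)

theorem NonzeroVec.asModuleEquiv_smul (hV : Module.finrank k V = 1) (v : NonzeroVec k V)
    (r : MonoidAlgebra ℤ kˣ) :
    (Representation.ofMulAction ℤ kˣ (NonzeroVec k V)).asModuleEquiv (r • v.toModule) =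
      MonoidAlgebra.ofCoeff (Finsupp.equivMapDomain (unitsEquiv hV v) r.coeff) := by
  rw [Representation.asModuleEquiv_map_smul, toModule, LinearEquiv.apply_symm_apply]
  induction r using MonoidAlgebra.induction_linear with
  | zero => ext; simp
  | add f g hf hg =>
    rw [map_add, LinearMap.add_apply, hf, hg]
    ext
    simp
  | single g n =>
    rw [Representation.asAlgebraHom_single, LinearMap.smul_apply,
      Representation.ofMulAction_single, MonoidAlgebra.coeff_single,
      Finsupp.equivMapDomain_single]
    simp
    rfl

/-- The permutation module of the nonzero vectors of a line is free of rank one. -/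
def NonzeroVec.moduleEquiv (hV : Module.finrank k V = 1) (v : NonzeroVec k V) :
    MonoidAlgebra ℤ kˣ ≃ₗ[MonoidAlgebra ℤ kˣ]
      (Representation.ofMulAction ℤ kˣ (NonzeroVec k V)).asModule :=
  LinearEquiv.ofBijective (LinearMap.toSpanSingleton _ _ v.toModule) (by
    -- In coordinates r ↦ r·v is the relabelling u ↦ u·v of a basis, which is a bijection because
    -- the nonzero vectors form a torsor.
    have h : (Representation.ofMulAction ℤ kˣ (NonzeroVec k V)).asModuleEquiv ∘
        (LinearMap.toSpanSingleton (MonoidAlgebra ℤ kˣ) _ v.toModule) =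
        MonoidAlgebra.coeffEquiv.symm ∘ Finsupp.equivCongrLeft (unitsEquiv hV v) ∘
          MonoidAlgebra.coeffEquiv :=
      funext fun r => asModuleEquiv_smul hV v r
    rw [← EquivLike.comp_bijective _
      (Representation.ofMulAction ℤ kˣ (NonzeroVec k V)).asModuleEquiv, h]
    exact (Equiv.bijective _).comp ((Equiv.bijective _).comp (Equiv.bijective _)))

/-- The right factor is free of rank one on v, so x ↦ x ⊗ v is the identification M ≅ M ⊗ A followed
by an isomorphism. -/
theorem twist_injective (hV : Module.finrank k V = 1) (v : NonzeroVec k V) :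
    Function.Injective (twist k v) := by
  intro x y h
  have key : ∀ z : graded k 0, twist k v z =
      (NonzeroVec.moduleEquiv hV v).lTensor _ ((TensorProduct.rid _ _).symm
        ((angleRep k).asModuleEquiv.symm z)) := by
    intro z
    rw [TensorProduct.rid_symm_apply, LinearEquiv.lTensor_tmul]
    change _ = TensorProduct.tmul _ _ ((1 : MonoidAlgebra ℤ kˣ) • v.toModule)
    rw [one_smul]
    rfl
  rw [key, key] at h
  exact (angleRep k).asModuleEquiv.symm.injective
    ((TensorProduct.rid _ _).symm.injective ((LinearEquiv.lTensor _ _).injective h))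

end twist

/-! ### Invariants of K_0^MW: the rank and the quadratic residue symbol. -/

section detection

variable {k : Type*} [Field k]

/-- The rank homomorphism, which kills `η` and all symbols. -/
def rank (k : Type*) [Field k] : KMW k →+* ℤ :=
  lift 0 0 (by simp) (by simp) (by simp) (by simp)

theorem rank_eta_mul (x : KMW k) : rank k (eta * x) = 0 := by
  rw [map_mul, rank, lift_eta, zero_mul]

theorem rank_angle (a : kˣ) : rank k (angle a) = 1 := by
  rw [angle, map_add, rank_eta_mul, map_one, add_zero]

theorem rank_nEps (n : ℤ) : rank k (nEps n) = n := by
  rw [nEps, hyp, map_add, map_zsmul, map_zsmul, map_add, rank_angle, map_one]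
  simp
  omega

open Classical in
/-- Multiplicativity of the quadratic residue symbol of a finite field. -/
theorem ite_isSquare_mul [Finite k] {A : Type*} [AddCommGroup A] (t : A) (ht : t + t = 0)
    (a b : kˣ) : (if IsSquare ((a * b : kˣ) : k) then 0 else t) =
      (if IsSquare (a : k) then 0 else t) + if IsSquare (b : k) then 0 else t := by
  have := Fintype.ofFinite k
  have h := map_mul (quadraticChar k) (a : k) b
  have hc : ∀ c : kˣ, (IsSquare (c : k) ∧ quadraticChar k c = 1) ∨
      (¬ IsSquare (c : k) ∧ quadraticChar k c = -1) := fun c => by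
    by_cases hc : IsSquare (c : k)
    · exact Or.inl ⟨hc, (quadraticChar_one_iff_isSquare c.ne_zero).mpr hc⟩
    · exact Or.inr ⟨hc, quadraticChar_neg_one_iff_not_isSquare.mpr hc⟩
  rw [← Units.val_mul] at h
  rcases hc a with ⟨ha, ha'⟩ | ⟨ha, ha'⟩ <;> rcases hc b with ⟨hb, hb'⟩ | ⟨hb, hb'⟩ <;>
  rcases hc (a * b) with ⟨hab, hab'⟩ | ⟨hab, hab'⟩ <;>
  rw [ha', hb', hab'] at h <;> norm_num at h <;> simp only [ha, hb, hab] <;> simp [ht]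

/-- A target ring for the quadratic residue invariant, realized as iterated dual numbers over F_2: e
will be the image of η and t that of a nonsquare symbol. -/
theorem exists_nilpotent_pair : ∃ (A : Type) (_ : CommRing A) (e t : A),
    e * e = 0 ∧ t * t = 0 ∧ (2 : A) = 0 ∧ e * t ≠ 0 := by
  refine ⟨DualNumber (DualNumber (ZMod 2)), inferInstance, DualNumber.eps,
    TrivSqZeroExt.inl DualNumber.eps, DualNumber.eps_mul_eps, ?_, ?_, ?_⟩
  · rw [← TrivSqZeroExt.inl_mul, DualNumber.eps_mul_eps, TrivSqZeroExt.inl_zero]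
  · have h : (2 : ZMod 2) = 0 := rfl
    have h1 : (2 : DualNumber (DualNumber (ZMod 2))) =
        algebraMap (ZMod 2) (DualNumber (DualNumber (ZMod 2))) 2 := map_ofNat _ 2 |>.symm
    rw [h1, h, map_zero]
  · intro h
    have h2 := congrArg TrivSqZeroExt.snd (congrArg TrivSqZeroExt.snd h)
    simp at h2

open Classical in
/-- In degree zero, the quadratic residue symbol of a finite field is an invariant. -/
theorem isSquare_of_eta_sym_eq_zero [Finite k] {a : kˣ} (h : (eta * sym a : KMW k) = 0) :
    IsSquare (a : k) := by
  by_contra ha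
  obtain ⟨A, _, e, t, he, ht, h2, het⟩ := exists_nilpotent_pair
  have htt : t + t = 0 := by rw [← two_mul, h2, zero_mul]
  -- As t² = 0, both the Steinberg relation and the correction term in [ab] are automatic, and
  -- additivity is the multiplicativity of the quadratic character. The last relation uses 2 = 0 and
  -- e² = 0.
  let f : KMW k →+* A := lift e (fun a => if IsSquare (a : k) then 0 else t)
    (fun a b _ => by split_ifs <;> simp [ht])
    (fun a b => by
      rw [ite_isSquare_mul t htt]
      split_ifs <;> simp [mul_assoc, ht])
    (fun a => mul_comm _ _)
    (by rw [h2, zero_add, mul_right_comm, he, zero_mul])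
  have h1 := congrArg f h
  rw [map_mul, lift_eta, lift_sym, map_zero, if_neg ha] at h1
  exact het h1

end detection

/-! ### The residue map on K_1^MW and the map p on its kernel. -/

section residue

variable {R : Type*} [CommRing R] [IsDomain R] [IsDiscreteValuationRing R]
  {F : Type*} [Field F] [Algebra R F] [IsFractionRing R F] {π : R} (hπ : Irreducible π)

theorem residueHom_sym (a : Fˣ) : residueHom hπ (sym a) = symRes hπ a := by
  simp [residueHom, resMatrix_sym]

theorem residueHom_sym_sym (a b : Fˣ) : residueHom hπ (sym a * sym b) =
    leftSpec hπ a * symRes hπ b + symRes hπ a * sym (resUnit hπ b) := by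
  simp [residueHom, resMatrix_sym, Matrix.mul_apply, Fin.sum_univ_two]

/-- The residue commutes with η and the rank kills η, so both sides depend only on p(x); on a symbol
[c] the rank of n_ε⟨ū⟩ is n. -/
theorem rank_residueHom {x : KMW F} (hx : x ∈ graded F 1) :
    rank (ResidueField R) (residueHom hπ x) = ord hπ (unitsHom F x).toMul := by
  have h : ∀ y ∈ etaSub F, rank (ResidueField R) (residueHom hπ y) = 0 := by
    intro y hy
    induction hy using AddSubgroup.closure_induction with
    | mem y hy =>
      obtain ⟨a, b, rfl⟩ := hy
      rw [mul_assoc, residueHom_eta, rank_eta_mul]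
    | zero => simp
    | add y z _ _ h h' => rw [map_add, map_add, h, h', add_zero]
    | neg y _ h => rw [map_neg, map_neg, h, neg_zero]
  obtain ⟨y, hy, hxy⟩ := exists_eq_sym_add hx
  set c := (unitsHom F x).toMul
  rw [hxy, map_add, map_add, h y hy, add_zero, residueHom_sym, symRes, map_mul, rank_angle,
    rank_nEps, mul_one]

theorem ordTilde_eq_zero_iff (x : graded F 1) :
    ordTilde F hπ x = 0 ↔ residueHom hπ (x : KMW F) = 0 := by
  have h : ordTilde F hπ x = twist (ResidueField R) (unifDual hπ) (residueOne hπ x) := rfl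
  have hV : Module.finrank (ResidueField R)
      (Module.Dual (ResidueField R) (CotangentSpace R)) = 1 := by
    rw [Subspace.dual_finrank_eq, finrank_cotangent]
  rw [h, map_eq_zero_iff _ (twist_injective hV _)]
  exact Subtype.ext_iff

/-- The unit part as a homomorphism. -/
def unitPartHom (F : Type*) [Field F] [Algebra R F] [IsFractionRing R F] : Fˣ →* Rˣ :=
  MonoidHom.mk' (unitPart hπ) (unitPart_mul hπ)

/-- The homomorphism `p : K_1^MW(O_v) → O_v^×`. -/
def toIntegerUnits (F : Type*) [Field F] [Algebra R F] [IsFractionRing R F] :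
    (ordTilde F hπ).ker →+ Additive Rˣ :=
  ((unitPartHom hπ F).toAdditive.comp (toUnits F)).comp (ordTilde F hπ).ker.subtype

/-- A zero residue has rank zero, so p(x) has valuation zero and equals its unit part. -/
theorem map_toIntegerUnits (x : (ordTilde F hπ).ker) :
    Units.map (algebraMap R F : R →* F) (toIntegerUnits hπ F x).toMul =
      (toUnits F x).toMul := by
  have h := (ordTilde_eq_zero_iff hπ x.1).mp x.2
  have h1 := rank_residueHom hπ x.1.2
  rw [h, map_zero] at h1
  have h2 := decomp hπ (toUnits F x).toMul
  rw [toUnits_eq, ← h1, zpow_zero, one_mul] at h2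
  exact h2.symm

theorem toIntegerUnits_surjective : Function.Surjective (toIntegerUnits hπ F) := by
  intro u
  have h : ordTilde F hπ ⟨sym (Units.map (algebraMap R F : R →* F) u.toMul), sym_mem _⟩ = 0 := by
    rw [ordTilde_eq_zero_iff, residueHom_sym, symRes, ord_unit, nEps_zero, zero_mul]
  refine ⟨⟨_, h⟩, ?_⟩
  change Additive.ofMul (unitPart hπ (toUnits F ⟨sym _, sym_mem _⟩).toMul) = u
  rw [toUnits_sym, toMul_ofMul, unitPart_unit]
  rfl

theorem mem_etaSub_of_toIntegerUnits_eq_zero {x : (ordTilde F hπ).ker}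
    (hx : toIntegerUnits hπ F x = 0) : (x : KMW F) ∈ etaSub F := by
  have h := map_toIntegerUnits hπ x
  rw [hx, toMul_zero, map_one] at h
  rw [mem_etaSub_iff x.1.2, ← toUnits_eq]
  exact toMul_eq_one.mp h.symm

/-- The kernel of p on K_1^MW(O_v) is the part of ηK_2 with zero residue, which the hypothesis makes
trivial. -/
theorem exists_equiv_units
    (h : ∀ x ∈ etaSub F, residueHom hπ x = 0 → x = 0) :
    ∃ e : (ordTilde F hπ).ker ≃+ Additive Rˣ, ∀ x : (ordTilde F hπ).ker,
      Units.map (algebraMap R F : R →* F) (e x).toMul = (toUnits F x).toMul := by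
  refine ⟨AddEquiv.ofBijective (toIntegerUnits hπ F) ⟨?_, toIntegerUnits_surjective hπ⟩,
    map_toIntegerUnits hπ⟩
  rw [injective_iff_map_eq_zero]
  intro x hx
  exact Subtype.ext (Subtype.ext (h x (mem_etaSub_of_toIntegerUnits_eq_zero hπ hx)
    ((ordTilde_eq_zero_iff hπ x.1).mp x.2)))

/-- The opposite extreme: all of ηK_2 has zero residue and is therefore the full kernel of p, and it
is transported to I² by `etaSubEquiv`. -/
theorem exists_exact_units (h2 : (2 : F) ≠ 0) (h : ∀ x ∈ etaSub F, residueHom hπ x = 0) :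
    ∃ (j : (WittRing.fundamentalIdeal F ^ 2 : Ideal (WittRing F)) →+ (ordTilde F hπ).ker)
      (q : (ordTilde F hπ).ker →+ Additive Rˣ),
      Function.Injective j ∧ Function.Exact j q ∧ Function.Surjective q ∧
      (∀ a b : Fˣ, ((j (WittRing.pfisterTwo a b) : graded F 1) : KMW F) = eta * sym a * sym b) ∧
      ∀ x : (ordTilde F hπ).ker,
        Units.map (algebraMap R F : R →* F) (q x).toMul = (toUnits F x).toMul := by
  set i : etaSub F →+ (ordTilde F hπ).ker := (AddSubgroup.inclusion etaSub_le).codRestrict _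
    (fun x => (ordTilde_eq_zero_iff hπ _).mpr (h x x.2)) with hi
  have hi_val : ∀ x, ((i x : graded F 1) : KMW F) = x := fun _ => rfl
  refine ⟨i.comp (etaSubEquiv h2).symm.toAddMonoidHom, toIntegerUnits hπ F, ?_, ?_,
    toIntegerUnits_surjective hπ, ?_, map_toIntegerUnits hπ⟩
  · intro x y hxy
    apply (etaSubEquiv h2).symm.injective
    exact Subtype.ext (congrArg (fun z : (ordTilde F hπ).ker => ((z : graded F 1) : KMW F)) hxy)
  · intro x
    constructor
    · intro hx
      refine ⟨etaSubEquiv h2 ⟨x, mem_etaSub_of_toIntegerUnits_eq_zero hπ hx⟩, ?_⟩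
      apply Subtype.ext
      apply Subtype.ext
      simp [hi_val]
    · rintro ⟨z, rfl⟩
      have h1 := map_toIntegerUnits hπ (i ((etaSubEquiv h2).symm z))
      rw [toUnits_eq, hi_val, unitsHom_of_mem_etaSub ((etaSubEquiv h2).symm z).2, toMul_zero] at h1
      exact toMul_eq_one.mp (map_units_injective (F := F) (h1.trans (map_one _).symm))
  · intro a b
    exact etaSubEquiv_symm_pfisterTwo h2 a b

/-- In the product rule for ∂([a][b]) each term contains a symbol of the residue field, and η[b²] =
0 kills it after multiplication by η. -/
theorem residueHom_etaSub_of_isSquare (hsq : ∀ a : (ResidueField R)ˣ, IsSquare a) {x : KMW F}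
    (hx : x ∈ etaSub F) : residueHom hπ x = 0 := by
  have h : ∀ a : (ResidueField R)ˣ, (eta * sym a : KMW (ResidueField R)) = 0 := by
    intro a
    obtain ⟨b, rfl⟩ := hsq a
    exact eta_sym_mul_self b
  induction hx using AddSubgroup.closure_induction with
  | mem x hx =>
    obtain ⟨a, b, rfl⟩ := hx
    rw [mul_assoc, residueHom_eta, residueHom_sym_sym, mul_add, ← mul_assoc, eta_leftSpec, h,
      zero_mul, zero_add, ← mul_assoc, ← symRes_eta, mul_assoc, h, mul_zero]
  | zero => simp
  | add y z _ _ h h' => rw [map_add, h, h', add_zero]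
  | neg y _ h => rw [map_neg, h, neg_zero]

end residue

end KMW

namespace KMW

open IsLocalRing MWVal

/-! ### Nondyadic local fields: injectivity of the residue on ηK_2^MW. -/

section eta_identities

variable {F : Type*} [Field F]

theorem eta_sym_mul_eta_sym_sym (a b c : Fˣ) :
    (eta * sym a * (eta * sym b * sym c) : KMW F) = eta * (eta * sym a * sym b * sym c) := by
  simp only [mul_assoc]
  rw [← mul_assoc (sym a) eta, ← eta_comm, mul_assoc]

theorem eta_sym_mul_eq_add {a b c : Fˣ} (h : (eta * sym b * sym c : KMW F) = 0) :
    (eta * sym (a * b) * sym c : KMW F) = eta * sym a * sym c := by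
  rw [eta_sym_mul_sym, h, mul_zero, add_zero, add_zero]

theorem eta_sym_self_mul (a b : Fˣ) (h : (eta * sym (-1) * sym b : KMW F) = 0) :
    (eta * sym a * (eta * sym a * sym b) : KMW F) = 0 := by
  rw [eta_sym_mul_eta_sym_sym, eta_sym_sym_self, ← eta_sym_mul_eta_sym_sym, h, mul_zero]

end eta_identities

section local_field

variable {R : Type*} [CommRing R] [IsDomain R] [IsDiscreteValuationRing R]
  {F : Type*} [Field F] [Algebra R F] [IsFractionRing R F] {π : R} (hπ : Irreducible π)

/-- Hensel's lemma for X² - u: the derivative 2x is a unit at a lift x of the residual square root.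
-/
theorem isSquare_of_isSquare_residue [HenselianLocalRing R] (h2 : (2 : ResidueField R) ≠ 0)
    {u : Rˣ} (hu : IsSquare (residue R u)) : ∃ c : Rˣ, u = c * c := by
  obtain ⟨y, hy⟩ := hu
  obtain ⟨x, rfl⟩ := residue_surjective y
  have hx : residue R x ≠ 0 := by
    intro h
    rw [h, mul_zero] at hy
    exact (residue_ne_zero_iff_isUnit (u : R)).mpr u.isUnit hy
  obtain ⟨z, hz, -⟩ := HenselianLocalRing.is_henselian
    (Polynomial.X ^ 2 - Polynomial.C (u : R)) (Polynomial.monic_X_pow_sub_C _ two_ne_zero) x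
    (by
      rw [← residue_eq_zero_iff]
      simp [hy, pow_two])
    (by
      have : (Polynomial.X ^ 2 - Polynomial.C (u : R)).derivative.eval x = 2 * x := by
        simp [one_add_one_eq_two]
      rw [← residue_ne_zero_iff_isUnit, this, map_mul, map_ofNat]
      exact mul_ne_zero h2 hx)
  rw [Polynomial.IsRoot, Polynomial.eval_sub, Polynomial.eval_pow, Polynomial.eval_X,
    Polynomial.eval_C, sub_eq_zero, pow_two] at hz
  have hzu : IsUnit z := isUnit_of_mul_isUnit_left (hz ▸ u.isUnit)
  exact ⟨hzu.unit, Units.ext hz.symm⟩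

theorem exists_mul_sq_add_mul_sq_eq_one {k : Type*} [Field k] [Finite k] (h2 : (2 : k) ≠ 0)
    {a b : k} (ha : a ≠ 0) (hb : b ≠ 0) : ∃ x y : k, a * (x * x) + b * (y * y) = 1 := by
  have := Fintype.ofFinite k
  have hodd : Fintype.card k % 2 = 1 := by
    apply FiniteField.odd_card_of_char_ne_two
    intro h
    have := ringChar.of_eq h
    exact h2 (CharTwo.two_eq_zero)
  obtain ⟨x, y, h⟩ := FiniteField.exists_root_sum_quadratic
    (f := Polynomial.C a * Polynomial.X ^ 2) (g := Polynomial.C b * Polynomial.X ^ 2 - 1)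
    (Polynomial.degree_C_mul_X_pow 2 ha) (by
      rw [Polynomial.degree_sub_eq_left_of_degree_lt] <;>
      simp [Polynomial.degree_C_mul_X_pow 2 hb]) hodd
  refine ⟨x, y, ?_⟩
  simp at h
  linear_combination h

theorem eta_sym_unit_of_isSquare_residue [HenselianLocalRing R] (h2 : (2 : ResidueField R) ≠ 0)
    {u : Rˣ} (hu : IsSquare (residue R u)) :
    (eta * sym (Units.map (algebraMap R F : R →* F) u) : KMW F) = 0 := by
  obtain ⟨c, rfl⟩ := isSquare_of_isSquare_residue h2 hu
  rw [map_mul, eta_sym_mul_self]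

/-- Over the finite residue field the form ūx² + w̄y² represents 1. If both coordinates are nonzero,
this lifts to uX² + wc² = 1, so [uX²][wc²] = 0 by Steinberg, and η absorbs the squares. If one
coordinate is zero, ū or w̄ is already a square. -/
theorem eta_sym_unit_sym_unit [HenselianLocalRing R] [Finite (ResidueField R)]
    (h2 : (2 : ResidueField R) ≠ 0) (u w : Rˣ) :
    (eta * sym (Units.map (algebraMap R F : R →* F) u) *
      sym (Units.map (algebraMap R F : R →* F) w) : KMW F) = 0 := by
  have hres : ∀ v : Rˣ, residue R v ≠ 0 := fun v => (residue_ne_zero_iff_isUnit (v : R)).mpr v.isUnit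
  obtain ⟨x, y, hxy⟩ := exists_mul_sq_add_mul_sq_eq_one h2 (hres u) (hres w)
  by_cases hx : x = 0
  · rw [eta_sym_symm, eta_sym_unit_of_isSquare_residue h2 ⟨y⁻¹, ?_⟩, zero_mul]
    have hy : y ≠ 0 := by
      rintro rfl
      simp [hx] at hxy
    field_simp
    simpa [hx, pow_two] using hxy
  by_cases hy : y = 0
  · rw [eta_sym_unit_of_isSquare_residue h2 ⟨x⁻¹, ?_⟩, zero_mul]
    field_simp
    simpa [hy, pow_two] using hxy
  obtain ⟨X, rfl⟩ := residue_surjective x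
  have hX : IsUnit X := (residue_ne_zero_iff_isUnit X).mp hx
  have hz : IsUnit (1 - u * (X * X)) := by
    rw [← residue_ne_zero_iff_isUnit, map_sub, map_one, map_mul, map_mul, ← hxy,
      add_sub_cancel_left]
    exact mul_ne_zero (hres w) (mul_ne_zero hy hy)
  obtain ⟨z, hz⟩ := hz
  -- The unit z = 1 - uX² has residue w̄y², so z/w reduces to y² and is a square.
  obtain ⟨c, hc⟩ := isSquare_of_isSquare_residue (u := z * w⁻¹) h2 ⟨y, by
    have h1 : (z * w⁻¹ : Rˣ) * (w : R) = 1 - u * (X * X) := by rw [← hz]; simp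
    have h3 := congrArg (residue R) h1
    rw [map_mul, map_sub, map_one, map_mul, map_mul, ← hxy, add_sub_cancel_left] at h3
    apply mul_right_cancel₀ (hres w)
    rw [h3, mul_comm]⟩
  have hzc : z = w * (c * c) := by rw [← hc, mul_comm, inv_mul_cancel_right]
  apply eta_sym_sym_of_sq_left _ _ (Units.map (algebraMap R F : R →* F) hX.unit)
    (Units.map (algebraMap R F : R →* F) c)
  apply steinberg
  rw [← map_mul, ← map_mul, ← map_mul, ← map_mul, ← hzc]
  simp [hz]

/-- The element `η[π][w]` for a unit `w`. -/
def etaUnif (F : Type*) [Field F] [Algebra R F] [IsFractionRing R F] (w : Rˣ) : KMW F :=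
  eta * sym (unif F hπ) * sym (Units.map (algebraMap R F : R →* F) w)

theorem etaUnif_eq (w : Rˣ) : etaUnif hπ F w =
    eta * sym (Units.map (algebraMap R F : R →* F) w) * sym (unif F hπ) :=
  eta_sym_symm _ _

theorem etaUnif_one : etaUnif hπ F 1 = 0 := by
  rw [etaUnif, map_one, sym_one, mul_zero]

theorem exists_eq_mul_sq (a : Fˣ) : ∃ (u : Rˣ) (c : Fˣ),
    a = Units.map (algebraMap R F : R →* F) u * (c * c) ∨
      a = unif F hπ * Units.map (algebraMap R F : R →* F) u * (c * c) := by
  refine ⟨unitPart hπ a, unif F hπ ^ (ord hπ a / 2), ?_⟩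
  have h := decomp hπ a
  rw [← zpow_add]
  rcases Int.even_or_odd' (ord hπ a) with ⟨k, hk | hk⟩
  · left
    conv_lhs => rw [h]
    rw [mul_comm]
    congr 2
    omega
  · right
    conv_lhs => rw [h]
    rw [mul_comm (unif F hπ), mul_assoc, ← zpow_one_add, mul_comm]
    congr 2
    omega

section

variable [HenselianLocalRing R] [Finite (ResidueField R)] (h2 : (2 : ResidueField R) ≠ 0)

include h2

theorem etaUnif_mul (u w : Rˣ) : etaUnif hπ F (u * w) = etaUnif hπ F u + etaUnif hπ F w := by
  rw [etaUnif_eq, etaUnif_eq, etaUnif_eq, map_mul, eta_sym_mul_sym, eta_sym_mul_eta_sym_sym,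
    eta_sym_unit_sym_unit h2, zero_mul, mul_zero, add_zero]

theorem eta_sym_unif_mul_unit (u w : Rˣ) :
    (eta * sym (unif F hπ * Units.map (algebraMap R F : R →* F) u) *
      sym (Units.map (algebraMap R F : R →* F) w) : KMW F) = etaUnif hπ F w :=
  eta_sym_mul_eq_add (eta_sym_unit_sym_unit h2 u w)

/-- The product contains η[π][π] = η[π][-1], and -1 is a unit, so a factor η[-1][u] = 0 appears. -/
theorem eta_sym_unif_mul_etaUnif (u : Rˣ) :
    eta * sym (unif F hπ) * etaUnif hπ F u = 0 := by
  apply eta_sym_self_mul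
  have := eta_sym_unit_sym_unit (F := F) h2 (-1) u
  rwa [show Units.map (algebraMap R F : R →* F) (-1) = -1 by ext; simp] at this

theorem eta_sym_unif_mul_unif_mul (u w : Rˣ) :
    (eta * sym (unif F hπ * Units.map (algebraMap R F : R →* F) u) *
      sym (unif F hπ * Units.map (algebraMap R F : R →* F) w) : KMW F) =
        etaUnif hπ F (-1 * w * u) := by
  have h1 : (eta * sym (Units.map (algebraMap R F : R →* F) u) *
      sym (unif F hπ * Units.map (algebraMap R F : R →* F) w) : KMW F) = etaUnif hπ F u := by
    rw [eta_sym_symm, eta_sym_unif_mul_unit hπ h2]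
  have h3 : (eta * sym (unif F hπ) * sym (unif F hπ) : KMW F) = etaUnif hπ F (-1) := by
    rw [eta_sym_sym_self, etaUnif, show Units.map (algebraMap R F : R →* F) (-1) = -1 by ext; simp]
  rw [eta_sym_mul_sym, h1, eta_sym_unif_mul_etaUnif hπ h2, add_zero, eta_sym_symm (unif F hπ),
    eta_sym_mul_sym, h3, ← etaUnif_eq, eta_sym_unif_mul_etaUnif hπ h2, add_zero,
    ← etaUnif_mul hπ h2, ← etaUnif_mul hπ h2]

/-- Up to squares every element of F^× is u or πu. The four resulting products are all of the form
η[π][w], and these form a group because η[π][w] is additive in w. -/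
theorem exists_eq_etaUnif {x : KMW F} (hx : x ∈ etaSub F) : ∃ w : Rˣ, x = etaUnif hπ F w := by
  induction hx using AddSubgroup.closure_induction with
  | mem x hx =>
    obtain ⟨a, b, rfl⟩ := hx
    obtain ⟨u, c, rfl | rfl⟩ := exists_eq_mul_sq hπ a <;>
    obtain ⟨w, d, rfl | rfl⟩ := exists_eq_mul_sq hπ b <;>
    rw [eta_sym_sym_mul_sq]
    · exact ⟨1, by rw [eta_sym_unit_sym_unit h2, etaUnif_one]⟩
    · exact ⟨u, by rw [eta_sym_symm, eta_sym_unif_mul_unit hπ h2]⟩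
    · exact ⟨w, eta_sym_unif_mul_unit hπ h2 u w⟩
    · exact ⟨_, eta_sym_unif_mul_unif_mul hπ h2 u w⟩
  | zero => exact ⟨1, (etaUnif_one hπ).symm⟩
  | add y z _ _ h h' =>
    obtain ⟨u, rfl⟩ := h
    obtain ⟨w, rfl⟩ := h'
    exact ⟨u * w, (etaUnif_mul hπ h2 u w).symm⟩
  | neg y _ h =>
    obtain ⟨u, rfl⟩ := h
    refine ⟨u⁻¹, neg_eq_of_add_eq_zero_right ?_⟩
    rw [← etaUnif_mul hπ h2, mul_inv_cancel, etaUnif_one]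

/-- The residue of η[π][w] is η[w̄]. If it vanishes, w̄ is a square, so w is a square by Hensel and
η[w] = 0. -/
theorem eq_zero_of_residueHom_eq_zero {x : KMW F} (hx : x ∈ etaSub F)
    (h : residueHom hπ x = 0) : x = 0 := by
  obtain ⟨w, rfl⟩ := exists_eq_etaUnif hπ h2 hx
  have h1 := residueHom_unif_units (F := F) hπ [w]
  simp only [List.map_cons, List.map_nil, List.prod_cons, List.prod_nil, mul_one] at h1
  rw [etaUnif, mul_assoc, residueHom_eta, h1] at h
  rw [etaUnif_eq, eta_sym_unit_of_isSquare_residue h2 (isSquare_of_eta_sym_eq_zero h), zero_mul]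

end

end local_field

end KMW

namespace MWPlace

open NumberField IsDedekindDomain IsLocalRing

/-! ### Completions of a number field: finite residue fields and Hensel's lemma. -/

section completions

variable {F : Type*} [Field F] [NumberField F] (v : HeightOneSpectrum (𝓞 F))

/-- Density of F gives an approximation a, which is v-integral by the ultrametric inequality, and a
is in turn approximated by a global integer. -/
theorem exists_valued_sub_lt_one (x : v.adicCompletionIntegers F) :
    ∃ r : 𝓞 F, Valued.v ((algebraMap (𝓞 F) F r : v.adicCompletion F) - x) < 1 := by
  have hopen : IsOpen {y : v.adicCompletion F | Valued.v (y - x) < 1} := by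
    rw [isOpen_iff_mem_nhds]
    intro y hy
    rw [Valued.mem_nhds]
    refine ⟨1, fun z hz => ?_⟩
    have hz' : Valued.v (z - y) < 1 := by simpa using hz
    have := Valuation.map_add_lt (Valued.v : Valuation (v.adicCompletion F) _) hz' hy
    rwa [sub_add_sub_cancel] at this
  obtain ⟨a, ha⟩ := (HeightOneSpectrum.denseRange_algebraMap F v).exists_mem_open hopen
    ⟨x, by simp⟩
  have hav : Valued.v (algebraMap F (v.adicCompletion F) a) ≤ 1 := by
    have := Valuation.map_add_le (Valued.v : Valuation (v.adicCompletion F) _)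
      (le_of_lt ha) ((HeightOneSpectrum.mem_adicCompletionIntegers _ _ _).mp x.2)
    rwa [sub_add_cancel] at this
  have hav' : v.valuation F a ≤ 1 := by
    rw [← HeightOneSpectrum.valuedAdicCompletion_eq_valuation']; exact hav
  obtain ⟨r, hr⟩ := v.exists_valuation_sub_lt_of_integer hav' 1
  refine ⟨r, ?_⟩
  rw [← HeightOneSpectrum.valuedAdicCompletion_eq_valuation'] at hr
  have := Valuation.map_add_lt (Valued.v : Valuation (v.adicCompletion F) _) (g := 1) (y := algebraMap F (v.adicCompletion F) a - x)
    (x := algebraMap F (v.adicCompletion F) (algebraMap (𝓞 F) F r) - algebraMap F (v.adicCompletion F) a)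
    (by rw [← map_sub]; exact hr) ha
  rwa [sub_add_sub_cancel] at this

theorem residue_algebraMap_surjective : Function.Surjective
    ((residue (v.adicCompletionIntegers F)).comp (algebraMap (𝓞 F) (v.adicCompletionIntegers F))) := by
  intro y
  obtain ⟨x, rfl⟩ := residue_surjective y
  obtain ⟨r, hr⟩ := exists_valued_sub_lt_one v x
  refine ⟨r, ?_⟩
  rw [RingHom.comp_apply, ← sub_eq_zero, ← map_sub, residue_eq_zero_iff]
  exact (Valuation.mem_maximalIdeal_iff _ _).mpr hr

theorem residue_algebraMap_eq_zero_iff (r : 𝓞 F) :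
    residue (v.adicCompletionIntegers F) (algebraMap (𝓞 F) (v.adicCompletionIntegers F) r) = 0 ↔
      r ∈ v.asIdeal := by
  rw [residue_eq_zero_iff, ← v.valuation_lt_one_iff_mem (K := F),
    ← HeightOneSpectrum.valuedAdicCompletion_eq_valuation']
  exact Valuation.mem_maximalIdeal_iff _ _

/-- It is a quotient of the finite ring 𝓞_F/v, by the preceding approximation. -/
instance : Finite (ResidueField (v.adicCompletionIntegers F)) := by
  have : Finite (𝓞 F ⧸ v.asIdeal) := Ideal.finiteQuotientOfFreeOfNeBot _ v.ne_bot
  refine Finite.of_surjective (Ideal.Quotient.lift v.asIdeal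
    ((residue (v.adicCompletionIntegers F)).comp
      (algebraMap (𝓞 F) (v.adicCompletionIntegers F)))
    fun r hr => (residue_algebraMap_eq_zero_iff v r).mpr hr) ?_
  exact Ideal.Quotient.lift_surjective_of_surjective _ _ (residue_algebraMap_surjective v)

theorem two_eq_zero_iff_isDyadic :
    (2 : ResidueField (v.adicCompletionIntegers F)) = 0 ↔ IsDyadic v := by
  rw [IsDyadic, ← residue_algebraMap_eq_zero_iff, map_ofNat, map_ofNat]

instance : CompactSpace (v.adicCompletionIntegers F) := by
  have h1 : IsDiscreteValuationRing (Valued.integer (v.adicCompletion F)) :=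
    inferInstanceAs (IsDiscreteValuationRing (v.adicCompletionIntegers F))
  have h2 : Finite (Valued.ResidueField (v.adicCompletion F)) :=
    inferInstanceAs (Finite (ResidueField (v.adicCompletionIntegers F)))
  have h3 : CompleteSpace (Valued.integer (v.adicCompletion F)) :=
    (Valued.isClosed_integer (v.adicCompletion F)).completeSpace_coe
  exact Valued.integer.compactSpace_iff_completeSpace_and_isDiscreteValuationRing_and_finite_residueField.mpr ⟨h3, h1, h2⟩

-- Compactness replaces a limit argument: a Cauchy sequence gives nested nonempty closed cosets f(n)
-- + 𝔪^n, and any common point is a limit.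
open scoped Pointwise in
instance : IsAdicComplete (maximalIdeal (v.adicCompletionIntegers F))
    (v.adicCompletionIntegers F) where
  prec' f hf := by
    set m := maximalIdeal (v.adicCompletionIntegers F)
    let S n : Set (v.adicCompletionIntegers F) :=
      f n +ᵥ ((m ^ n : Ideal (v.adicCompletionIntegers F)) : Set (v.adicCompletionIntegers F))
    have hS n : S (n + 1) ⊆ S n := by
      apply (Set.vadd_set_subset_vadd_set_iff.mpr (Ideal.pow_le_pow_right n.le_succ)).trans
      simpa [S] using (hf n.le_succ).symm
    have h n : IsClosed (S n) := (IsNoetherianRing.isClosed_ideal (m ^ n)).vadd (f n)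
    obtain ⟨L, hL⟩ := (h 0).isCompact.nonempty_iInter_of_sequence_nonempty_isCompact_isClosed S hS
      (by simp [S]) h
    refine ⟨L, fun n ↦ ?_⟩
    obtain ⟨y, hy, rfl⟩ := Set.mem_iInter.mp hL n
    simpa [SModEq.sub_mem] using hy

instance : HenselianLocalRing (v.adicCompletionIntegers F) where
  is_henselian f hf a h1 h2 :=
    HenselianRing.is_henselian f hf a h1 (h2.map (Ideal.Quotient.mk _))

end completions

end MWPlace

namespace KMW

/-! ### Archimedean places. -/

section archimedean

theorem map_eta {F E : Type*} [Field F] [Field E] (f : F →+* E) : map f eta = eta :=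
  lift_eta _ _ _ _ _ _

theorem signHom_eta : signHom eta = -2 := lift_eta _ _ _ _ _ _

variable {F : Type*} [Field F]

theorem etaSub_eq_bot_of_isSquare (h : ∀ a : Fˣ, IsSquare a) : etaSub F = ⊥ := by
  rw [eq_bot_iff, etaSub, AddSubgroup.closure_le]
  rintro _ ⟨a, b, rfl⟩
  obtain ⟨c, rfl⟩ := h a
  rw [eta_sym_mul_self, zero_mul]
  rfl

theorem toUnits_bijective_of_isSquare (h : ∀ a : Fˣ, IsSquare a) :
    Function.Bijective (toUnits F) := by
  constructor
  · rw [injective_iff_map_eq_zero]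
    intro x hx
    have := (mem_etaSub_iff x.2).mpr hx
    rw [etaSub_eq_bot_of_isSquare h] at this
    exact Subtype.ext this
  · exact fun a => ⟨⟨sym a.toMul, sym_mem _⟩, toUnits_sym _⟩

/-- Only the square classes of 1 and -1 matter under η, and the class of 1 contributes zero. -/
theorem exists_zsmul_of_mem_etaSub (h : ∀ a : Fˣ, IsSquare a ∨ IsSquare (-a)) {x : KMW F}
    (hx : x ∈ etaSub F) : ∃ n : ℤ, x = n • (eta * sym (-1) * sym (-1)) := by
  suffices etaSub F ≤ AddSubgroup.zmultiples (eta * sym (-1) * sym (-1)) by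
    obtain ⟨n, hn⟩ := this hx
    exact ⟨n, hn.symm⟩
  rw [etaSub, AddSubgroup.closure_le]
  rintro _ ⟨a, b, rfl⟩
  rcases h a with ⟨c, rfl⟩ | ⟨c, hc⟩
  · rw [eta_sym_mul_self, zero_mul]
    exact zero_mem _
  rcases h b with ⟨d, rfl⟩ | ⟨d, hd⟩
  · rw [eta_sym_symm a, eta_sym_mul_self, zero_mul]
    exact zero_mem _
  rw [show a = -1 * (c * c) by rw [← hc]; simp, show b = -1 * (d * d) by rw [← hd]; simp,
    eta_sym_sym_mul_sq]
  exact AddSubgroup.mem_zmultiples _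

theorem isSquare_or_isSquare_neg_of_real {f : F →+* ℝ} (hf : Function.Bijective f) (a : Fˣ) :
    IsSquare a ∨ IsSquare (-a) := by
  have key : ∀ b : Fˣ, 0 ≤ f b → IsSquare b := by
    intro b hb
    obtain ⟨c, hc⟩ := hf.2 (√(f b))
    have hcb : (b : F) = c * c := hf.1 (by rw [map_mul, hc, Real.mul_self_sqrt hb])
    have hc0 : c ≠ 0 := by
      rintro rfl
      exact b.ne_zero (by simp at hcb)
    exact ⟨Units.mk0 c hc0, Units.ext hcb⟩
  rcases le_total 0 (f a) with h | h
  · exact Or.inl (key a h)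
  · exact Or.inr (key (-a) (by simpa using h))

theorem signHom_map_sym (f : F →+* ℝ) (a : Fˣ) :
    signHom (map f (sym a)) = if 0 < f a then 0 else 1 := by
  rw [map_sym, signHom_sym, half_signature]
  rfl

theorem signHom_map_zsmul (f : F →+* ℝ) (n : ℤ) :
    signHom (map f (n • (eta * sym (-1) * sym (-1)))) = -2 * n := by
  have h : ¬ 0 < f ((-1 : Fˣ) : F) := by norm_num
  simp only [map_zsmul, map_mul, signHom_map_sym, map_eta, signHom_eta, if_neg h, smul_eq_mul]
  ring

theorem pos_of_signHom_eq_zero {f : F →+* ℝ} (hf : Function.Bijective f) {x : KMW F}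
    (hx : x ∈ graded F 1) (h : signHom (map f x) = 0) :
    0 < f ((unitsHom F x).toMul : Fˣ) := by
  obtain ⟨y, hy, hxy⟩ := exists_eq_sym_add hx
  obtain ⟨n, rfl⟩ := exists_zsmul_of_mem_etaSub (isSquare_or_isSquare_neg_of_real hf) hy
  rw [hxy, map_add, map_add, signHom_map_sym, signHom_map_zsmul] at h
  -- Parity decides: the ηK_2 part contributes -2n, which cannot cancel the value 1 of a negative
  -- symbol.
  split_ifs at h with hpos
  · exact hpos
  · omega

/-- The cyclic generator η[-1][-1] has the nonzero invariant -2, so the sign map is injective on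
ηK_2. -/
theorem eq_zero_of_signHom_eq_zero {f : F →+* ℝ} (hf : Function.Bijective f) {x : KMW F}
    (hx : x ∈ etaSub F) (h : signHom (map f x) = 0) : x = 0 := by
  obtain ⟨n, rfl⟩ := exists_zsmul_of_mem_etaSub (isSquare_or_isSquare_neg_of_real hf) hx
  rw [signHom_map_zsmul] at h
  rw [show n = 0 by omega, zero_smul]

theorem exists_equiv_posSubgroup {f : F →+* ℝ} (hf : Function.Bijective f)
    (K : AddSubgroup (graded F 1)) (hK : ∀ x, x ∈ K ↔ signHom (map f x) = 0) :
    ∃ e : K ≃+ Additive (Units.posSubgroup ℝ),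
      ∀ x : K, ((e x).toMul : ℝˣ) = Units.map (f : F →* ℝ) (toUnits F x).toMul := by
  let g : K →+ Additive (Units.posSubgroup ℝ) :=
    { toFun := fun x => Additive.ofMul ⟨Units.map (f : F →* ℝ) (toUnits F x).toMul,
        pos_of_signHom_eq_zero hf x.1.2 ((hK _).mp x.2)⟩
      map_zero' := by
        apply Additive.toMul.injective
        ext
        simp
      map_add' := fun x y => by
        apply Additive.toMul.injective
        ext
        simp }
  have hg : ∀ x : K, ((g x).toMul : ℝˣ) = Units.map (f : F →* ℝ) (toUnits F x).toMul :=
    fun x => rfl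
  have hbij : Function.Bijective g := by
    constructor
    · rw [injective_iff_map_eq_zero]
      intro x hx
      have h1 : Units.map (f : F →* ℝ) (toUnits F x).toMul = 1 := by rw [← hg, hx]; rfl
      have h2 : unitsHom F (x : graded F 1) = 0 :=
        Additive.toMul.injective (Units.map_injective f.injective (h1.trans (map_one _).symm))
      exact Subtype.ext (Subtype.ext (eq_zero_of_signHom_eq_zero hf
        ((mem_etaSub_iff x.1.2).mpr h2) ((hK _).mp x.2)))
    · intro u
      obtain ⟨c, hc⟩ := hf.2 (u.toMul : ℝˣ)
      have hc0 : c ≠ 0 := by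
        rintro rfl
        exact (u.toMul : ℝˣ).ne_zero (by rw [← hc, map_zero])
      refine ⟨⟨⟨sym (Units.mk0 c hc0), sym_mem _⟩, (hK _).mpr ?_⟩, ?_⟩
      · rw [signHom_map_sym, if_pos]
        rw [Units.val_mk0, hc]
        exact u.toMul.2
      · apply Additive.toMul.injective
        ext
        rw [hg, toUnits_sym]
        simpa using hc
  exact ⟨AddEquiv.ofBijective g hbij, hg⟩

theorem exists_equiv_complex {f : F →+* ℂ} (hf : Function.Bijective f)
    (K : AddSubgroup (graded F 1)) (hK : ∀ x, x ∈ K) :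
    ∃ e : K ≃+ Additive ℂˣ,
      ∀ x : K, (e x).toMul = Units.map (f : F →* ℂ) (toUnits F x).toMul := by
  have hsq : ∀ a : Fˣ, IsSquare a := by
    intro a
    obtain ⟨z, hz⟩ := IsAlgClosed.exists_pow_nat_eq (f a) two_pos
    obtain ⟨c, rfl⟩ := hf.2 z
    have hca : (a : F) = c * c := hf.1 (by rw [map_mul, ← sq, hz])
    have hc0 : c ≠ 0 := by
      rintro rfl
      exact a.ne_zero (by simp at hca)
    exact ⟨Units.mk0 c hc0, Units.ext hca⟩
  have hK' : Function.Bijective K.subtype := ⟨Subtype.val_injective, fun x => ⟨⟨x, hK x⟩, rfl⟩⟩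
  exact ⟨((AddEquiv.ofBijective K.subtype hK').trans
    (AddEquiv.ofBijective (toUnits F) (toUnits_bijective_of_isSquare hsq))).trans
    (MulEquiv.toAdditive (Units.mapEquiv (RingEquiv.ofBijective f hf).toMulEquiv)),
    fun x => Units.ext rfl⟩

end archimedean

end KMW

/-- Squaring is the Frobenius, which is bijective on a finite field of characteristic two; this is
what makes the dyadic residues of ηK_2 vanish. -/
theorem isUnit_isSquare_of_two_eq_zero {k : Type*} [Field k] [Finite k] (h : (2 : k) = 0) (a : kˣ) :
    IsSquare a := by
  have : CharP k 2 := CharTwo.of_one_ne_zero_of_two_eq_zero one_ne_zero h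
  have : Fintype k := Fintype.ofFinite k
  obtain ⟨b, hb⟩ := FiniteField.isSquare_of_char_two (ringChar.eq k 2) (a : k)
  have hb0 : b ≠ 0 := by
    rintro rfl
    exact a.ne_zero (by simp at hb)
  exact ⟨Units.mk0 b hb0, Units.ext hb⟩

end

open NumberField IsDedekindDomain KMW MWPlace in
theorem lemma2p6 (F : Type*) [Field F] [NumberField F] :
    -- real places
    (∀ (w : InfinitePlace F) (hw : w.IsReal),
      ∃ e : K1Real w hw ≃+ Additive (Units.posSubgroup ℝ),
        ∀ x : K1Real w hw, ((e x).toMul : ℝˣ) =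
          Units.map (InfinitePlace.Completion.extensionEmbeddingOfIsReal hw : w.Completion →* ℝ)
            (toUnits w.Completion x).toMul) ∧
    -- complex places
    (∀ (w : InfinitePlace F) (hw : w.IsComplex),
      ∃ e : K1Complex w hw ≃+ Additive ℂˣ,
        ∀ x : K1Complex w hw, (e x).toMul =
          Units.map (InfinitePlace.Completion.extensionEmbedding w : w.Completion →* ℂ)
            (toUnits w.Completion x).toMul) ∧
    -- nondyadic finite places
    (∀ (v : HeightOneSpectrum (𝓞 F)) (π : v.adicCompletionIntegers F) (hπ : Irreducible π),
      ¬ IsDyadic v →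
      ∃ e : K1Finite v hπ ≃+ Additive (v.adicCompletionIntegers F)ˣ,
        ∀ x : K1Finite v hπ,
          Units.map (algebraMap (v.adicCompletionIntegers F) (v.adicCompletion F) :
            v.adicCompletionIntegers F →* v.adicCompletion F) (e x).toMul =
              (toUnits (v.adicCompletion F) x).toMul) ∧
    -- dyadic places
    (∀ (v : HeightOneSpectrum (𝓞 F)) (π : v.adicCompletionIntegers F) (hπ : Irreducible π),
      IsDyadic v →
      ∃ (j : (WittRing.fundamentalIdeal (v.adicCompletion F) ^ 2 :
            Ideal (WittRing (v.adicCompletion F))) →+ K1Finite v hπ)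
        (q : K1Finite v hπ →+ Additive (v.adicCompletionIntegers F)ˣ),
        Function.Injective j ∧ Function.Exact j q ∧ Function.Surjective q ∧
        (∀ a b : (v.adicCompletion F)ˣ,
          ((j (WittRing.pfisterTwo a b) : graded (v.adicCompletion F) 1) :
            KMW (v.adicCompletion F)) = eta * sym a * sym b) ∧
        (∀ x : K1Finite v hπ,
          Units.map (algebraMap (v.adicCompletionIntegers F) (v.adicCompletion F) :
            v.adicCompletionIntegers F →* v.adicCompletion F) (q x).toMul =
              (toUnits (v.adicCompletion F) x).toMul)) := by
  refine ⟨fun w hw => ?_, fun w hw => ?_, fun v π hπ hv => ?_, fun v π hπ hv => ?_⟩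
  · exact exists_equiv_posSubgroup
      (InfinitePlace.Completion.bijective_extensionEmbeddingOfIsReal hw) _ fun x => Iff.rfl
  · exact exists_equiv_complex
      (InfinitePlace.Completion.bijective_extensionEmbedding_of_isComplex hw) _ fun x => rfl
  · exact exists_equiv_units hπ fun x hx h => eq_zero_of_residueHom_eq_zero hπ
      (fun h2 => hv ((two_eq_zero_iff_isDyadic v).mp h2)) hx h
  · have : CharZero (v.adicCompletion F) :=
      charZero_of_injective_algebraMap (algebraMap F (v.adicCompletion F)).injective
    exact exists_exact_units hπ two_ne_zero fun x hx => residueHom_etaSub_of_isSquare hπ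
      (isUnit_isSquare_of_two_eq_zero ((two_eq_zero_iff_isDyadic v).mpr hv)) hx
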